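/- Let $d\ge 1$, $T\ge 0$, $\mathcal X=[0,1)^d$, and let $\lambda_k$ be Lebesgue measure on $[0,1)^k$. For probability measures $\mu,\nu$ on $[0,1)^k$ put $\|\mu-\nu\|_E=\sup_B|\mu(B)-\nu(B)|$, the supremum over boxes $B=\prod_i[a_i,b_i]$ with $0\le a_i<b_i<1$. For a point set $u^{1:N}$ in $[0,1)^k$ put $\mathcal S(u^{1:N})=\frac1N\sum_n\delta_{u^n}$ and $D(u^{1:N})=\|\mathcal S(u^{1:N})-\lambda_k\|_E$. Let $H:[0,1]\to[0,1]^d$ be a Hilbert space-filling curve with $H(0)=0$, that is, a continuous map such that, for every $m\ge0$, the closed dyadic cubes of side $2^{-m}$ in $[0,1]^d$ can be enumerated as $S_m(0),\dots,S_m(2^{dm}-1)$ with $H([k2^{-dm},(k+1)2^{-dm}])=S_m(k)$, $S_{m+1}(2^dk+i)\subset S_m(k)$ for $0\le i<2^d$, and $S_m(k),S_m(k+1)$ having an edge (an endpoint if $d=1$) in common. Let $h$ be a pseudo-inverse: $h(x)\in[0,1]$ and $H(h(x))=x$ for $x\in\mathcal X$. **Model.** Let $m_0$ be a probability measure on $\mathcal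 X$, let $m_t(x_{t-1},x_t)>0$ ($t\ge1$) be measurable Markov transition densities with respect to $\lambda_d$, and let $G_0(x_0)\ge0$ and $G_t(x_{t-1},x_t)\ge0$ ($t\ge 1$) be measurable. Let $\widetilde{\mathbb Q}_t$ (the smoothing distribution) be the probability measure on $\mathcal X^{t+1}$ proportional to $G_0(x_0)\prod_{s=1}^tG_s(x_{s-1},x_s)\,m_0(dx_0)\prod_{s=1}^tm_s(x_{s-1},x_s)\,dx_s$, and let $\mathbb Q_t$ be its marginal law of $x_t$. For $t\ge 1$ let $$\tilde G_t(x_{t-1},x_t)=\frac{m_t(x_{t-1},x_t)G_t(x_{t-1},x_t)}{\int m_t(y,x_t)G_t(y,x_t)\,\mathbb Q_{t-1}(dy)},\qquad \mathcal M_t(x_t,dx_{t-1})=\tilde G_t(x_{t-1},x_t)\,\mathbb Q_{t-1}(dx_{t-1}).$$ For a probability measure $\pi$ on $\mathcal X$, and a version of its conditional distributions of $x_i$ given $x_{1:i-1}$, let $F_\pi(x)=(F_{\pi,i}(x_i\mid x_{1:i-1}))_{i\le d}$ be the Rosenblatt transform (conditional CDFs). The inverse $F_\pi^{-1}(u)$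 is the $x$ with $x_i=\inf\{z\in[0,1):F_{\pi,i}(z\mid x_{1:i-1})\ge u_i\}$ for all $i$. The same notation is used for kernels: $F_{m_t}(x',\cdot)$ is the transform of $m_t(x',\cdot)$. For weights $w_1,\dots,w_N$ and $u\in[0,1)$ write $\operatorname{inv}(w,u)=\min\{i:\sum_{k\le i}w_k\ge u\}$. **Forward pass.** For each $N$ let $u_0^{1:N}$ be a point set in $[0,1)^d$ and $u_t^{1:N}=(u_t^n,\mathbf v_t^n)_{n\le N}$, $1\le t\le T$, point sets in $[0,1)\times[0,1)^d$ with $u_t^n$ nondecreasing in $n$. Set $x_0^n=F_{m_0}^{-1}(u_0^n)$ and $W_0^n=G_0(x_0^n)/\sum_kG_0(x_0^k)$. For $t=0,\dots,T$ let $\sigma_t$ be a permutation such that $h(x_t^{\sigma_t(1)})\le\dots\le h(x_t^{\sigma_t(N)})$, and for $t=1,\dots,T$ set $$a_{t-1}^n=\operatorname{inv}\big((W_{t-1}^{\sigma_{t-1}(k)})_k,u_t^n\big),\quad \hat x_{t-1}^n=x_{t-1}^{\sigma_{t-1}(a_{t-1}^n)},\quad x_t^n=F_{m_t}^{-1}(\hat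 x_{t-1}^n,\mathbf v_t^n),\quad W_t^n=\frac{G_t(\hat x_{t-1}^n,x_t^n)}{\sum_kG_t(\hat x_{t-1}^k,x_t^k)}.$$ **Backward pass.** Let $\tilde u^{1:N}$ be a point set in $[0,1)^{T+1}$, $\tilde u^n=(\tilde u_0^n,\dots,\tilde u_T^n)$, with $\tilde u_T^n$ nondecreasing in $n$. Set $\tilde x_T^n=x_T^{\sigma_T(b)}$ with $b=\operatorname{inv}((W_T^{\sigma_T(k)})_k,\tilde u_T^n)$. For $t=T-1,\dots,0$ set $\tilde x_t^n=x_t^{\sigma_t(b)}$ with $b=\operatorname{inv}\big((\widetilde W_t^{\sigma_t(k)}(\tilde x_{t+1}^n))_k,\tilde u_t^n\big)$, where $$\widetilde W_t^k(y)=\frac{W_t^k\,m_{t+1}(x_t^k,y)G_{t+1}(x_t^k,y)}{\sum_pW_t^p\,m_{t+1}(x_t^p,y)G_{t+1}(x_t^p,y)}.$$ **Assumptions.** The algorithm is well defined for every $N\ge 1$ (the indices $\operatorname{inv}$ exist), and: 1. As $N\to\infty$, $D(\tilde u^{1:N})\to0$ and $D(u_t^{1:N})\to0$ for $0\le t\le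 T$. 2. For $0\le t\le T$ and every $N$, the points $x_t^1,\dots,x_t^N$ are pairwise distinct. 3. For $0\le t\le T$, $G_t$ is continuous and bounded. 4. For $0\le t\le T$ (with $F_{m_t}(x',x)=F_{m_0}(x)$ for $t=0$): the $i$-th coordinate of $F_{m_t}(x',x)$ is strictly increasing in $x_i$; $(x',x)\mapsto F_{m_t}(x',x)$ is Hölder continuous; and the conditional distributions of $x_i$ given $x_{1:i-1}$ under $m_t(x',\cdot)$ have densities bounded uniformly in $i$, $x'$ and $x_{1:i-1}$. 5. For $0\le t\le T$, $\mathbb Q_t$ has a strictly positive bounded density with respect to $\lambda_d$. 6. For $1\le t\le T$, $\tilde G_t$ is continuous and bounded on $\mathcal X^2$, and for a version of the conditional distributions of $\mathcal M_t(x_t,\cdot)$ the $i$-th coordinate of $F_{\mathcal M_t}(x_t,x_{t-1})$ is strictly increasing in the $i$-th coordinate of $x_{t-1}$ and $F_{\mathcal M_t}$ is Hölder continuous in $(x_t,x_{t-1})$. 7. For $1\le t\le T-1$, the CDF $(x_t,x_{t-1})\mapsto\mathcal M_t(x_t,[0,x_{t-1}])$ is Hölder continuous. 8. For $0\le t\le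 T-1$ there is $\underline c_t>0$ such that $G_t(x_{t-1},x_t)G_{t+1}(x_t,x_{t+1})m_{t+1}(x_t,x_{t+1})\ge\underline c_t$ for all $x_{t-1},x_t,x_{t+1}\in\mathcal X$, where $G_0(x_{-1},x_0)=G_0(x_0)$. 9. For $1\le t\le T-1$, $(x_{t-1},x_t)\mapsto G_t(x_{t-1},x_t)m_t(x_{t-1},x_t)$ is uniformly continuous on $\mathcal X^2$. **Conclusion.** The trajectories produced by the backward pass satisfy $$\big\|\mathcal S(\tilde x_{0:T}^{1:N})-\widetilde{\mathbb Q}_T\big\|_E\to0\qquad(N\to\infty),$$ where $\mathcal X^{T+1}$ is identified with $[0,1)^{(T+1)d}$. -/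

import Mathlib

open MeasureTheory ProbabilityTheory Filter Topology
open scoped ENNReal NNReal

namespace SQMC

noncomputable section

/-! ### Unit cubes, extreme norm, discrepancy -/

/-- The half-open unit interval `[0,1)`. -/
abbrev UI : Type := Set.Ico (0 : ℝ) 1

/-- Lebesgue measure on `[0,1)`. -/
instance instMeasureSpaceUI : MeasureSpace UI where
  volume := Measure.comap Subtype.val volume

instance instIsProbabilityMeasureUI : IsProbabilityMeasure (volume : Measure UI) where
  measure_univ := by
    change Measure.comap Subtype.val volume Set.univ = 1
    rw [comap_subtype_coe_apply measurableSet_Ico, Set.image_univ, Subtype.range_coe,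
      Real.volume_Ico]
    simp

/-- The half-open unit cube `[0,1)^d`, with its product order, topology, sup metric, Borel sets
and Lebesgue measure `volume`. -/
abbrev Cube (d : ℕ) : Type := Fin d → UI

/-- The extreme norm `‖μ - ν‖_E` of the difference of two probability measures on `[0,1)^ι`: the
supremum of `|μ B - ν B|` over the boxes `B = ∏ i, [a i, b i]` with `0 ≤ a i < b i < 1`. -/
def extremeNorm {ι : Type} (μ ν : Measure (ι → UI)) : ℝ :=
  ⨆ B : {B : (ι → UI) × (ι → UI) // ∀ i, B.1 i < B.2 i},
    |μ.real (Set.Icc B.1.1 B.1.2) - ν.real (Set.Icc B.1.1 B.1.2)|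

/-- The empirical measure `(1/N) ∑ n, δ_{x n}` of a point set of size `N`. -/
def empirical {E : Type} [MeasurableSpace E] {N : ℕ} (x : Fin N → E) : Measure E :=
  (N : ℝ≥0∞)⁻¹ • ∑ n, Measure.dirac (x n)

/-- The extreme discrepancy of a point set in `[0,1)^k`. -/
def discrepancy {k N : ℕ} (u : Fin N → Cube k) : ℝ :=
  extremeNorm (empirical u) (volume : Measure (Cube k))

/-- The identification of trajectories in `([0,1)^d)^(T+1)` with points of `[0,1)^((T+1)d)`. -/
def flatten {T d : ℕ} (x : Fin (T + 1) → Cube d) : Fin (T + 1) × Fin d → UI :=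
  fun p => x p.1 p.2

/-- Hölder continuity with some exponent in `(0,1]`. -/
def IsHolder {E E' : Type} [PseudoEMetricSpace E] [PseudoEMetricSpace E'] (f : E → E') : Prop :=
  ∃ C r : ℝ≥0, 0 < r ∧ r ≤ 1 ∧ HolderWith C r f

/-! ### Hilbert curves -/

/-- `H : [0,1] → [0,1]^d` is a Hilbert space-filling curve starting at the origin. For every `m`,
the `2^(d m)` closed dyadic cubes of side `2^(-m)` are enumerated (the `k`-th one has lower corner
`2^(-m) * cell m k`) in such a way that `H` maps the `k`-th closed interval of length `2^(-d m)`
onto the `k`-th cube, the enumerations are nested, and consecutive cubes are adjacent, that is,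
have an edge in common (an endpoint if `d = 1`). -/
structure IsHilbertCurve {d : ℕ} (H : ℝ → Fin d → ℝ) : Prop where
  continuousOn : ContinuousOn H (Set.Icc 0 1)
  map_zero : H 0 = 0
  exists_cell : ∃ cell : ∀ m : ℕ, Fin (2 ^ (d * m)) ≃ (Fin d → Fin (2 ^ m)),
    (∀ m (k : Fin (2 ^ (d * m))),
      H '' Set.Icc ((k : ℝ) / 2 ^ (d * m)) (((k : ℝ) + 1) / 2 ^ (d * m)) =
        {x | ∀ i, ((cell m k i : ℕ) : ℝ) / 2 ^ m ≤ x i ∧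
          x i ≤ (((cell m k i : ℕ) : ℝ) + 1) / 2 ^ m}) ∧
    (∀ m (k : Fin (2 ^ (d * m))) (k' : Fin (2 ^ (d * (m + 1)))),
      (k' : ℕ) / 2 ^ d = k → ∀ i, (cell (m + 1) k' i : ℕ) / 2 = cell m k i) ∧
    (∀ m (k k' : Fin (2 ^ (d * m))), (k' : ℕ) = k + 1 →
      (∀ i, (cell m k' i : ℕ) ≤ cell m k i + 1 ∧ (cell m k i : ℕ) ≤ cell m k' i + 1) ∧
      (2 ≤ d → ∃ i, cell m k' i = cell m k i))

/-- `h` is a pseudo-inverse of `H` on `[0,1)^d`: `h x ∈ [0,1]` and `H (h x) = x`. -/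
def IsPseudoInverse {d : ℕ} (H : ℝ → Fin d → ℝ) (h : Cube d → ℝ) : Prop :=
  ∀ x, h x ∈ Set.Icc (0 : ℝ) 1 ∧ H (h x) = fun i => (x i : ℝ)

/-! ### Rosenblatt transform -/

/-- The first `i` coordinates of a point. -/
def head {d : ℕ} (i : Fin d) (x : Cube d) : Cube i :=
  fun j => x (Fin.castLE i.isLt.le j)

/-- A family of conditional distributions: `κ i (x_1, …, x_{i-1})` is a distribution on `[0,1)`
of the `i`-th coordinate given the previous ones. -/
abbrev CondFamily (d : ℕ) : Type := ∀ i : Fin d, Kernel (Cube i) UI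

/-- `κ` is a version of the successive regular conditional distributions of the probability
measure `π` on `[0,1)^d`. -/
structure IsCondFamily {d : ℕ} (π : Measure (Cube d)) (κ : CondFamily d) : Prop where
  markov : ∀ i, IsMarkovKernel (κ i)
  disintegration : ∀ i, (π.map (head i)) ⊗ₘ κ i = π.map (fun x => (head i x, x i))

/-- The Rosenblatt transform: the `i`-th coordinate is the conditional CDF of the `i`-th
coordinate given the previous ones, evaluated at `x i`. -/
def rosenblatt {d : ℕ} (κ : CondFamily d) (x : Cube d) : Fin d → ℝ :=
  fun i => (κ i (head i x)).real (Set.Iic (x i))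

/-- `x` is the image of `u` under the inverse Rosenblatt transform: for every `i`, `x i` is
`inf {z | F_i(z | x_1, …, x_{i-1}) ≥ u i}` (the infimum is attained, CDFs being
right-continuous). -/
def IsInvRosenblatt {d : ℕ} (κ : CondFamily d) (u x : Cube d) : Prop :=
  ∀ i, IsLeast {z : UI | (u i : ℝ) ≤ (κ i (head i x)).real (Set.Iic z)} (x i)

/-- The `i`-th coordinate of the Rosenblatt transform is strictly increasing in the `i`-th
coordinate of the point, for each value of the parameter `y`. -/
def RosenblattStrictMono {Y : Type} {d : ℕ} (κ : Y → CondFamily d) : Prop :=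
  ∀ y x i, StrictMono fun z : UI => rosenblatt (κ y) (Function.update x i z) i

/-- The Rosenblatt transform is Hölder continuous, jointly in the parameter and the point. -/
def RosenblattHolder {Y : Type} [PseudoEMetricSpace Y] {d : ℕ} (κ : Y → CondFamily d) : Prop :=
  IsHolder fun q : Y × Cube d => rosenblatt (κ q.1) q.2

/-- The conditional distributions have densities that are bounded by a common constant. -/
def CondDensityBounded {Y : Type} {d : ℕ} (κ : Y → CondFamily d) : Prop :=
  ∃ C : ℝ≥0, ∀ y i w, ∃ p : UI → ℝ≥0∞, Measurable p ∧ (∀ z, p z ≤ C) ∧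
    κ y i w = (volume : Measure UI).withDensity p

/-! ### Feynman-Kac models -/

/-- A Feynman-Kac model on `[0,1)^d`: initial distribution `m0`, strictly positive transition
densities `m t x_{t-1} x_t` (`t ≥ 1`), and nonnegative potentials `G0 x_0` and `G t x_{t-1} x_t`
(`t ≥ 1`). The values `m 0` and `G 0` are not used. -/
structure FeynmanKac (d : ℕ) where
  m0 : Measure (Cube d)
  isProbabilityMeasure_m0 : IsProbabilityMeasure m0
  m : ℕ → Cube d → Cube d → ℝ
  measurable_m : ∀ t, 1 ≤ t → Measurable (Function.uncurry (m t))
  m_pos : ∀ t, 1 ≤ t → ∀ x y, 0 < m t x y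
  lintegral_m : ∀ t, 1 ≤ t → ∀ x, ∫⁻ y, ENNReal.ofReal (m t x y) = 1
  G0 : Cube d → ℝ
  measurable_G0 : Measurable G0
  G0_nonneg : ∀ x, 0 ≤ G0 x
  G : ℕ → Cube d → Cube d → ℝ
  measurable_G : ∀ t, 1 ≤ t → Measurable (Function.uncurry (G t))
  G_nonneg : ∀ t, 1 ≤ t → ∀ x y, 0 ≤ G t x y

namespace FeynmanKac

variable {d : ℕ} (M : FeynmanKac d)

/-- The transition kernel `m_t(x, dy) = m_t(x, y) dy`, `t ≥ 1`. -/
def trans (t : ℕ) (x : Cube d) : Measure (Cube d) :=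
  volume.withDensity fun y => ENNReal.ofReal (M.m t x y)

/-- The law of the Markov chain `(x_0, …, x_t)`, that is
`m_0(dx_0) ∏_{s=1}^t m_s(x_{s-1}, x_s) dx_s`. -/
def chainLaw (t : ℕ) : Measure (Fin (t + 1) → Cube d) :=
  (Measure.pi fun i : Fin (t + 1) => if i = 0 then M.m0 else volume).withDensity fun x =>
    ENNReal.ofReal (∏ s : Fin t, M.m (s + 1) (x s.castSucc) (x s.succ))

/-- `G_0(x_0) ∏_{s=1}^t G_s(x_{s-1}, x_s)`. -/
def pathPotential (t : ℕ) (x : Fin (t + 1) → Cube d) : ℝ :=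
  M.G0 (x 0) * ∏ s : Fin t, M.G (s + 1) (x s.castSucc) (x s.succ)

/-- The normalising constant `Z_t`. -/
def Z (t : ℕ) : ℝ≥0∞ := ∫⁻ x, ENNReal.ofReal (M.pathPotential t x) ∂M.chainLaw t

/-- The smoothing distribution (`Q̃_t`), a probability measure on trajectories `x_{0:t}`. -/
def smoothing (t : ℕ) : Measure (Fin (t + 1) → Cube d) :=
  (M.Z t)⁻¹ • (M.chainLaw t).withDensity fun x => ENNReal.ofReal (M.pathPotential t x)

/-- The filtering distribution `Q_t`: the law of `x_t` under the smoothing distribution. -/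
def filtering (t : ℕ) : Measure (Cube d) :=
  (M.smoothing t).map fun x => x (Fin.last t)

/-- `G̃_t(x_{t-1}, x_t)`, the density of the backward kernel with respect to `π`. -/
def Gtilde (t : ℕ) (π : Measure (Cube d)) (x' x : Cube d) : ℝ :=
  M.m t x' x * M.G t x' x / ∫ y, M.m t y x * M.G t y x ∂π

/-- The backward kernel `M_{t,π}(x_t, dx_{t-1}) = G̃_t(x_{t-1}, x_t) π(dx_{t-1})`. -/
def backward (t : ℕ) (π : Measure (Cube d)) (x : Cube d) : Measure (Cube d) :=
  π.withDensity fun x' => ENNReal.ofReal (M.Gtilde t π x' x)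

/-- `G_t(x_{t-1}, x_t)` at every time, with `G_0(x_{-1}, x_0) = G_0(x_0)`. -/
def Gext : ℕ → Cube d → Cube d → ℝ
  | 0, _, x => M.G0 x
  | t + 1, x', x => M.G (t + 1) x' x

end FeynmanKac

/-! ### The SQMC algorithm -/

section Algorithm

variable {d : ℕ}

/-- The normalised weights `W_t^n`, from the particles `x_t^n` and the resampled particles
`xhat t n` (the ancestor at time `t` of particle `n` at time `t + 1`). -/
def weight (M : FeynmanKac d) {N : ℕ} (x xhat : ℕ → Fin N → Cube d) : ℕ → Fin N → ℝ
  | 0, n => M.G0 (x 0 n) / ∑ k, M.G0 (x 0 k)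
  | t + 1, n => M.G (t + 1) (xhat t n) (x (t + 1) n) / ∑ k, M.G (t + 1) (xhat t k) (x (t + 1) k)

/-- `a` is the image `F⁻¹(u) = min {i | F(i) ≥ u}` of `u` under the inverse of the discrete CDF
`F(i) = ∑_{k ≤ i} w k`. -/
def IsInvDiscreteCDF {N : ℕ} (w : Fin N → ℝ) (u : ℝ) (a : Fin N) : Prop :=
  IsLeast {i : Fin N | u ≤ ∑ k ∈ Finset.Iic i, w k} a

/-- An execution up to time `T` of sequential quasi-Monte Carlo with `N` particles and inputs
`u0` (in `[0,1)^d`) and `u t` (in `[0,1)^(d+1)`, `1 ≤ t ≤ T`): particles `x t n`, permutations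
`σ t` that sort the particles at time `t` along the Hilbert curve, and ancestor indices `a t n`,
which are positions in the sorted order. The conditional families `κ0`, `κ t x` are those of the
initial distribution and of the transition kernels. -/
structure Forward (M : FeynmanKac d) (κ0 : CondFamily d) (κ : ℕ → Cube d → CondFamily d)
    (h : Cube d → ℝ) (T : ℕ) {N : ℕ} (u0 : Fin N → Cube d) (u : ℕ → Fin N → Cube (d + 1)) where
  x : ℕ → Fin N → Cube d
  σ : ℕ → Equiv.Perm (Fin N)
  a : ℕ → Fin N → Fin N
  init : ∀ n, IsInvRosenblatt κ0 (u0 n) (x 0 n)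
  sorted : ∀ t, t ≤ T → Monotone fun n => h (x t (σ t n))
  resample : ∀ t, t < T → ∀ n, IsInvDiscreteCDF
    (fun k => weight M x (fun s j => x s (σ s (a s j))) t (σ t k)) (u (t + 1) n 0) (a t n)
  mutate : ∀ t, t < T → ∀ n,
    IsInvRosenblatt (κ (t + 1) (x t (σ t (a t n)))) (Fin.tail (u (t + 1) n)) (x (t + 1) n)

variable {M : FeynmanKac d} {κ0 : CondFamily d} {κ : ℕ → Cube d → CondFamily d}
  {h : Cube d → ℝ} {T N : ℕ} {u0 : Fin N → Cube d} {u : ℕ → Fin N → Cube (d + 1)}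

/-- The weights `W_t^n` of an execution. -/
def Forward.W (R : Forward M κ0 κ h T u0 u) : ℕ → Fin N → ℝ :=
  weight M R.x fun s j => R.x s (R.σ s (R.a s j))

/-- The backward weights `W̃_t^n(x_{t+1})` of an execution. -/
def Forward.backwardWeight (R : Forward M κ0 κ h T u0 u) (t : ℕ) (y : Cube d) (n : Fin N) : ℝ :=
  R.W t n * M.m (t + 1) (R.x t n) y * M.G (t + 1) (R.x t n) y /
    ∑ p, R.W t p * M.m (t + 1) (R.x t p) y * M.G (t + 1) (R.x t p) y

/-- An execution of the backward step with input `v` (in `[0,1)^(T+1)`, coordinate `t` serving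
time `t`) on the output of a forward execution: the `N` simulated trajectories `path n`, and the
selected positions `b t n` in the sorted order. -/
structure Backward (R : Forward M κ0 κ h T u0 u) (v : Fin N → Cube (T + 1)) where
  path : Fin N → Fin (T + 1) → Cube d
  b : Fin (T + 1) → Fin N → Fin N
  path_eq : ∀ n t, path n t = R.x t (R.σ t (b t n))
  last : ∀ n, IsInvDiscreteCDF (fun k => R.W T (R.σ T k)) (v n (Fin.last T)) (b (Fin.last T) n)
  step : ∀ (t : Fin T) n, IsInvDiscreteCDF
    (fun k => R.backwardWeight t (path n t.succ) (R.σ t k)) (v n t.castSucc) (b t.castSucc n)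

end Algorithm

end

end SQMC

/-!
The proof is by weak convergence. On the cube, the discrepancy of a point set tends to zero exactly
when its empirical measure converges weakly to Lebesgue measure, so the assumptions on the inputs
give weak convergence (`wconv_of_discrepancy`), and it suffices to prove that the trajectories
converge weakly to the smoothing distribution. The latter does not charge hyperplanes orthogonal to
the axes, so that the convergence is uniform over boxes (`tendsto_extremeNorm_of_wconv`).

The main tool is the extended continuous mapping theorem `WConv.tendsto_sum`: if weighted point sets
converge weakly to `μ` and bounded functions `F N` converge continuously to `F` at `μ`-almost every
point, then the weighted sums of `F N` converge to `∫ F dμ`.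

All steps of the algorithm are instances of sampling by inversion. A point `x` is selected by means
of a uniform input `u`, given a variable `z`, and for a function `h` that orders the points the
event `h x ≤ s` has the form `u ≤ a_N(s, z)`. If the thresholds `a_N(s, z)` converge continuously in
`z` to the conditional probability of `h ≤ s` under `μ`, for all `s` in grids whose cells are
arbitrarily small, then `(x, z)` converges weakly to `μ` (`wconv_of_sampledAt`). Iterating this over
finitely many coordinates, each with its own input, yields `wconv_of_seqSampledAt`. It is applied in
three situations.

* Inverse Rosenblatt transforms (`wconv_of_isInvRosenblatt`): the coordinates are sampled one after
  the other, and the thresholds are conditional CDFs, which are continuous.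
* Resampling (`wconv_forward_resample`): `h` is the pseudo-inverse of the Hilbert curve, and the
  threshold is the total weight of the particles in an initial segment of the Hilbert order. Such a
  segment is, up to a Lebesgue-null set, a finite union of open dyadic cubes, so that weak
  convergence of the weighted particles implies convergence of the thresholds (`exists_threshold`).
* The backward pass (`wconv_backward`): the coordinates are the states of a trajectory, in reversed
  time. By the backward decomposition (`FeynmanKac.smoothing_map_eq_withDensity`), under the
  smoothing distribution the conditional law of `x_t` given `x_{t+1}, …, x_T` has density
  `G̃_{t+1}(·, x_{t+1})` with respect to the filtering distribution `Q_t`; and the thresholds, which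
  are ratios of weighted sums of `G̃_{t+1}(·, y)` over the particles, converge continuously in `y`
  because `G̃_{t+1}` is jointly continuous and bounded.
-/

namespace SQMC

/-! ### Weak convergence of weighted point sets -/

/-- The weighted point sets `∑ n, w N n • δ_{x N n}` converge weakly to `μ` as `N → ∞`. It is
enough to test against bounded Lipschitz functions. -/
def WConv {E : Type} [PseudoMetricSpace E] [MeasurableSpace E]
    (w : ∀ N : ℕ, Fin N → ℝ) (x : ∀ N : ℕ, Fin N → E) (μ : Measure E) : Prop :=
  ∀ f : E → ℝ, (∃ K : ℝ≥0, LipschitzWith K f) → (∃ C : ℝ, ∀ y, |f y| ≤ C) →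
    Tendsto (fun N => ∑ n, w N n * f (x N n)) atTop (𝓝 (∫ y, f y ∂μ))

section Envelope

variable {E I : Type} [PseudoMetricSpace E]

/-- The `j`-Lipschitz upper envelope, over the indices in `s`, of a bounded family of functions. -/
noncomputable def upperEnvelope (F : I → E → ℝ) (s : Set I) (j : ℕ) (y : E) : ℝ :=
  ⨆ p : s × E, (F p.1 p.2 - j * dist y p.2)

theorem upperEnvelope_bddAbove {F : I → E → ℝ} {C : ℝ} (hF : ∀ i y, |F i y| ≤ C)
    (s : Set I) (j : ℕ) (y : E) :
    BddAbove (Set.range fun p : s × E => F p.1 p.2 - j * dist y p.2) := by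
  refine ⟨C, ?_⟩
  rintro _ ⟨p, rfl⟩
  have h1 := (abs_le.1 (hF p.1 p.2)).2
  have h2 : 0 ≤ (j : ℝ) * dist y p.2 := by positivity
  simp only
  linarith

theorem le_upperEnvelope {F : I → E → ℝ} {C : ℝ} (hF : ∀ i y, |F i y| ≤ C)
    {s : Set I} (j : ℕ) {i : I} (hi : i ∈ s) (y : E) : F i y ≤ upperEnvelope F s j y := by
  refine le_trans ?_ (le_ciSup (upperEnvelope_bddAbove hF s j y) (⟨i, hi⟩, y))
  simp

theorem upperEnvelope_le {F : I → E → ℝ} {C : ℝ} (hF : ∀ i y, |F i y| ≤ C)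
    {s : Set I} (hs : s.Nonempty) (j : ℕ) (y : E) : upperEnvelope F s j y ≤ C := by
  have : Nonempty (s × E) := ⟨(⟨hs.some, hs.some_mem⟩, y)⟩
  refine ciSup_le fun p => ?_
  have h1 := (abs_le.1 (hF p.1 p.2)).2
  have h2 : 0 ≤ (j : ℝ) * dist y p.2 := by positivity
  linarith

theorem abs_upperEnvelope_le {F : I → E → ℝ} {C : ℝ} (hF : ∀ i y, |F i y| ≤ C)
    {s : Set I} (hs : s.Nonempty) (j : ℕ) (y : E) : |upperEnvelope F s j y| ≤ C :=
  abs_le.2 ⟨(abs_le.1 (hF hs.some y)).1.trans (le_upperEnvelope hF j hs.some_mem y),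
    upperEnvelope_le hF hs j y⟩

theorem lipschitzWith_upperEnvelope {F : I → E → ℝ} {C : ℝ} (hF : ∀ i y, |F i y| ≤ C)
    {s : Set I} (hs : s.Nonempty) (j : ℕ) : LipschitzWith j (upperEnvelope F s j) := by
  refine LipschitzWith.of_le_add_mul _ fun y z => ?_
  have : Nonempty (s × E) := ⟨(⟨hs.some, hs.some_mem⟩, y)⟩
  refine ciSup_le fun p => ?_
  have h1 := le_ciSup (upperEnvelope_bddAbove hF s j z) p
  have h2 : (j : ℝ) * dist z p.2 ≤ j * (dist y p.2 + dist y z) := by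
    gcongr
    rw [add_comm, dist_comm y z]
    exact dist_triangle _ _ _
  simp only [NNReal.coe_natCast]
  unfold upperEnvelope
  linarith

/-- Where a family of functions converges continuously, its Lipschitz upper envelopes converge to
the same limit. -/
theorem tendsto_upperEnvelope {F : I → E → ℝ} {C : ℝ} (hF : ∀ i y, |F i y| ≤ C) {L : Filter I}
    [L.NeBot] {s : ℕ → Set I} (hs : L.HasAntitoneBasis s) {y : E} {c : ℝ}
    (hc : Tendsto (fun p : I × E => F p.1 p.2) (L ×ˢ 𝓝 y) (𝓝 c)) :
    Tendsto (fun j => upperEnvelope F (s j) j y) atTop (𝓝 c) := by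
  have hne : ∀ j, (s j).Nonempty := fun j => L.nonempty_of_mem (hs.1.mem_of_mem trivial)
  have hCc : -C ≤ c := ge_of_tendsto hc (Eventually.of_forall fun p => (abs_le.1 (hF p.1 p.2)).1)
  rw [Metric.tendsto_atTop]
  intro ε hε
  have hev := hc.eventually (Metric.ball_mem_nhds c (half_pos hε))
  obtain ⟨⟨j0, δ⟩, ⟨-, hδ⟩, hsub⟩ :=
    (hs.1.prod Metric.nhds_basis_ball).eventually_iff.1 hev
  have hsub' : ∀ i ∈ s j0, ∀ z, dist z y < δ → |F i z - c| < ε / 2 := fun i hi z hz => by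
    have := hsub (x := (i, z)) ⟨hi, hz⟩
    simpa [Real.dist_eq] using this
  simp only at hδ
  obtain ⟨j1, hj1⟩ := exists_nat_ge (2 * C / δ)
  refine ⟨max j0 j1, fun j hj => ?_⟩
  have hjs : s j ⊆ s j0 := hs.2 (le_of_max_le_left hj)
  have hjC : 2 * C ≤ j * δ := by
    rw [div_le_iff₀ hδ] at hj1
    refine hj1.trans ?_
    gcongr
    exact le_of_max_le_right hj
  rw [Real.dist_eq, abs_lt]
  constructor
  · have h1 := le_upperEnvelope hF j (hne j).some_mem y
    have h2 := (abs_lt.1 (hsub' _ (hjs (hne j).some_mem) y (by simpa using hδ))).1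
    linarith
  · have : upperEnvelope F (s j) j y ≤ c + ε / 2 := by
      have : Nonempty (s j × E) := ⟨(⟨(hne j).some, (hne j).some_mem⟩, y)⟩
      refine ciSup_le fun p => ?_
      rcases lt_or_ge (dist y p.2) δ with h | h
      · have h2 := (abs_lt.1 (hsub' _ (hjs p.1.2) p.2 (by rwa [dist_comm]))).2
        have h3 : 0 ≤ (j : ℝ) * dist y p.2 := by positivity
        linarith
      · have h2 := (abs_le.1 (hF p.1 p.2)).2
        have h3 : (j : ℝ) * δ ≤ j * dist y p.2 := by gcongr
        linarith
    linarith

end Envelope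

theorem WConv.congr_measure {E : Type} [PseudoMetricSpace E] [MeasurableSpace E]
    {w : ∀ N : ℕ, Fin N → ℝ} {x : ∀ N : ℕ, Fin N → E} {μ : Measure E} (hx : WConv w x μ)
    {ν : Measure E} (h : μ = ν) : WConv w x ν := h ▸ hx

section WConv

variable {E : Type} [PseudoMetricSpace E] [MeasurableSpace E] [OpensMeasurableSpace E]
  {w : ∀ N : ℕ, Fin N → ℝ} {x : ∀ N : ℕ, Fin N → E} {μ : Measure E}

/-- Upper half of the extended continuous mapping theorem. A fixed Lipschitz envelope dominates the
functions eventually, so that weak convergence applies to it, and its integral exceeds that of the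
limit as little as desired. -/
theorem WConv.eventually_sum_lt (hx : WConv w x μ) [IsFiniteMeasure μ]
    (hw : ∀ N n, 0 ≤ w N n) {I : Type} {L : Filter I}
    [L.IsCountablyGenerated] [L.NeBot] {φ : I → ℕ} (hφ : Tendsto φ L atTop) {F : I → E → ℝ} {C : ℝ}
    (hF : ∀ i y, |F i y| ≤ C) {Flim : E → ℝ}
    (hlim : ∀ᵐ y ∂μ, Tendsto (fun p : I × E => F p.1 p.2) (L ×ˢ 𝓝 y) (𝓝 (Flim y)))
    {ε : ℝ} (hε : 0 < ε) :
    ∀ᶠ i in L, ∑ k, w (φ i) k * F i (x (φ i) k) < ∫ y, Flim y ∂μ + ε := by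
  obtain ⟨s, hs⟩ := L.exists_antitone_basis
  have hne : ∀ j, (s j).Nonempty := fun j => L.nonempty_of_mem (hs.1.mem_of_mem trivial)
  have hint : Tendsto (fun j => ∫ y, upperEnvelope F (s j) j y ∂μ) atTop
      (𝓝 (∫ y, Flim y ∂μ)) := by
    refine tendsto_integral_of_dominated_convergence (fun _ => C) (fun j =>
      (lipschitzWith_upperEnvelope hF (hne j) j).continuous.measurable.aestronglyMeasurable)
      (integrable_const C) (fun j => ?_) ?_
    · exact Eventually.of_forall fun y => abs_upperEnvelope_le hF (hne j) j y
    · filter_upwards [hlim] with y hy using tendsto_upperEnvelope hF hs hy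
  obtain ⟨j, hj⟩ := (hint.eventually (gt_mem_nhds (lt_add_of_pos_right _ (half_pos hε)))).exists
  have h1 := hx _ ⟨_, lipschitzWith_upperEnvelope hF (hne j) j⟩
    ⟨C, abs_upperEnvelope_le hF (hne j) j⟩
  have h2 := hφ.eventually (h1.eventually (gt_mem_nhds (lt_add_of_pos_right _ (half_pos hε))))
  filter_upwards [h2, hs.1.mem_of_mem (i := j) trivial] with i hi hij
  refine lt_of_le_of_lt (Finset.sum_le_sum fun k _ => mul_le_mul_of_nonneg_left
    (le_upperEnvelope hF j hij _) (hw _ k)) (hi.trans ?_)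
  linarith

/-- Extended continuous mapping theorem: if weighted point sets converge weakly to `μ`, and
uniformly bounded functions `F i` converge continuously to `Flim` at `μ`-almost every point, then
the weighted sums of the `F i` converge to the integral of `Flim`. The sequence of point sets may be
reindexed by `φ`, so that the functions may depend on a parameter as well. -/
theorem WConv.tendsto_sum (hx : WConv w x μ) [IsFiniteMeasure μ]
    (hw : ∀ N n, 0 ≤ w N n) {I : Type} {L : Filter I}
    [L.IsCountablyGenerated] {φ : I → ℕ} (hφ : Tendsto φ L atTop) {F : I → E → ℝ} {C : ℝ}
    (hF : ∀ i y, |F i y| ≤ C) {Flim : E → ℝ}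
    (hlim : ∀ᵐ y ∂μ, Tendsto (fun p : I × E => F p.1 p.2) (L ×ˢ 𝓝 y) (𝓝 (Flim y))) :
    Tendsto (fun i => ∑ k, w (φ i) k * F i (x (φ i) k)) L (𝓝 (∫ y, Flim y ∂μ)) := by
  rcases L.eq_or_neBot with rfl | hL
  · exact tendsto_bot
  rw [Metric.tendsto_nhds]
  intro ε hε
  have h1 := hx.eventually_sum_lt hw hφ hF hlim hε
  have h2 := hx.eventually_sum_lt hw hφ (F := fun i y => -F i y) (C := C) (by simpa using hF)
    (Flim := fun y => -Flim y) (by filter_upwards [hlim] with y hy using hy.neg) hε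
  filter_upwards [h1, h2] with i hi1 hi2
  simp only [mul_neg, Finset.sum_neg_distrib, integral_neg] at hi2
  rw [Real.dist_eq, abs_lt]
  constructor <;> linarith

theorem WConv.tendsto_sum_ae_continuousAt (hx : WConv w x μ) [IsFiniteMeasure μ]
    (hw : ∀ N n, 0 ≤ w N n) {f : E → ℝ} {C : ℝ} (hC : ∀ y, |f y| ≤ C)
    (hf : ∀ᵐ y ∂μ, ContinuousAt f y) :
    Tendsto (fun N => ∑ n, w N n * f (x N n)) atTop (𝓝 (∫ y, f y ∂μ)) :=
  hx.tendsto_sum hw (φ := id) tendsto_id (F := fun _ => f) (fun _ => hC)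
    (by filter_upwards [hf] with y hy using hy.tendsto.comp tendsto_snd)

theorem WConv.tendsto_sum_continuous (hx : WConv w x μ) [IsFiniteMeasure μ]
    (hw : ∀ N n, 0 ≤ w N n) {f : E → ℝ} {C : ℝ} (hC : ∀ y, |f y| ≤ C) (hf : Continuous f) :
    Tendsto (fun N => ∑ n, w N n * f (x N n)) atTop (𝓝 (∫ y, f y ∂μ)) :=
  hx.tendsto_sum_ae_continuousAt hw hC (Eventually.of_forall fun _ => hf.continuousAt)

/-- Continuous mapping theorem. -/
theorem WConv.map {E' : Type} [PseudoMetricSpace E'] [MeasurableSpace E'] [BorelSpace E']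
    (hx : WConv w x μ) [IsFiniteMeasure μ] (hw : ∀ N n, 0 ≤ w N n) {g : E → E'}
    (hg : Continuous g) : WConv w (fun N n => g (x N n)) (μ.map g) := by
  rintro f ⟨K, hK⟩ ⟨C, hC⟩
  rw [integral_map hg.measurable.aemeasurable hK.continuous.measurable.aestronglyMeasurable]
  exact hx.tendsto_sum_continuous hw (fun y => hC (g y)) (hK.continuous.comp hg)

end WConv

/-- The uniform weights `1/N`. -/
noncomputable def unif (N : ℕ) (_ : Fin N) : ℝ := (N : ℝ)⁻¹

theorem unif_nonneg (N : ℕ) (n : Fin N) : 0 ≤ unif N n := by unfold unif; positivity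

theorem sum_unif_le (N : ℕ) : ∑ n, unif N n ≤ 1 := by
  simp only [unif, Finset.sum_const, Finset.card_univ, Fintype.card_fin, nsmul_eq_mul]
  exact mul_inv_le_one

/-! ### Low discrepancy point sets converge weakly -/

theorem integral_empirical {E : Type} [MeasurableSpace E] [MeasurableSingletonClass E] {N : ℕ}
    (x : Fin N → E) (f : E → ℝ) : ∫ y, f y ∂empirical x = ∑ n, unif N n * f (x n) := by
  rw [empirical, integral_smul_measure, integral_finsetSum_measure]
  · simp [unif, Finset.mul_sum]
  · intro n _
    exact integrable_dirac (by simp)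

theorem isProbabilityMeasure_empirical {E : Type} [MeasurableSpace E] {N : ℕ} (hN : N ≠ 0)
    (x : Fin N → E) : IsProbabilityMeasure (empirical x) := by
  constructor
  simp [empirical, ENNReal.inv_mul_cancel, hN]

theorem abs_sub_le_extremeNorm {ι : Type} (μ ν : Measure (ι → UI)) [IsProbabilityMeasure μ]
    [IsProbabilityMeasure ν] {a b : ι → UI} (hab : ∀ i, a i < b i) :
    |μ.real (Set.Icc a b) - ν.real (Set.Icc a b)| ≤ extremeNorm μ ν := by
  refine le_ciSup (f := fun B : {B : (ι → UI) × (ι → UI) // ∀ i, B.1 i < B.2 i} =>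
    |μ.real (Set.Icc B.1.1 B.1.2) - ν.real (Set.Icc B.1.1 B.1.2)|) ⟨1, ?_⟩ ⟨(a, b), hab⟩
  rintro _ ⟨B, rfl⟩
  have h1 : μ.real (Set.Icc B.1.1 B.1.2) ≤ 1 := measureReal_le_one
  have h2 : ν.real (Set.Icc B.1.1 B.1.2) ≤ 1 := measureReal_le_one
  have h3 : 0 ≤ μ.real (Set.Icc B.1.1 B.1.2) := measureReal_nonneg
  have h4 : 0 ≤ ν.real (Set.Icc B.1.1 B.1.2) := measureReal_nonneg
  exact abs_le.2 ⟨by linarith, by linarith⟩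

/-- The boxes `[a, b]` with rational `a` and irrational `b`. Two such boxes that meet do so in a
nondegenerate box, so that they form a π-system all of whose members are boxes of positive
volume. -/
def ratIrratBoxes (k : ℕ) : Set (Set (Cube k)) :=
  {s | ∃ a b : Cube k, (∀ i, a i < b i) ∧ (∀ i, ∃ q : ℚ, (a i : ℝ) = q) ∧
    (∀ i, Irrational (b i : ℝ)) ∧ s = Set.Icc a b}

theorem isPiSystem_ratIrratBoxes (k : ℕ) : IsPiSystem (ratIrratBoxes k) := by
  rintro _ ⟨a, b, -, ha, hb, rfl⟩ _ ⟨a', b', -, ha', hb', rfl⟩ ⟨y, hy⟩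
  rw [Set.Icc_inter_Icc] at hy ⊢
  have hq : ∀ i, ∃ q : ℚ, ((a ⊔ a') i : ℝ) = q := fun i => by
    rw [Pi.sup_apply]
    rcases le_total (a i) (a' i) with h | h
    · rw [sup_eq_right.2 h]; exact ha' i
    · rw [sup_eq_left.2 h]; exact ha i
  have hir : ∀ i, Irrational ((b ⊓ b') i : ℝ) := fun i => by
    rw [Pi.inf_apply]
    rcases le_total (b i) (b' i) with h | h
    · rw [inf_eq_left.2 h]; exact hb i
    · rw [inf_eq_right.2 h]; exact hb' i
  refine ⟨_, _, fun i => ?_, hq, hir, rfl⟩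
  refine lt_of_le_of_ne ((hy.1 i).trans (hy.2 i)) fun h => ?_
  obtain ⟨q, hq⟩ := hq i
  exact (hir i).ne_rat q (by rw [← hq, h])

theorem exists_ratIrratBox_subset {k : ℕ} {u : Set (Cube k)} (hu : IsOpen u) {x : Cube k}
    (hx : x ∈ u) : ∃ s ∈ ratIrratBoxes k, s ∈ 𝓝 x ∧ s ⊆ u := by
  obtain ⟨ε, hε, hball⟩ := Metric.isOpen_iff.1 hu x hx
  have hb : ∀ i, ∃ b : UI, x i < b ∧ (b : ℝ) < x i + ε ∧ Irrational (b : ℝ) := fun i => by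
    obtain ⟨r, hr, h1, h2⟩ := exists_irrational_btwn
      (show (x i : ℝ) < min (x i + ε) 1 from lt_min (by linarith) (x i).2.2)
    exact ⟨⟨r, (x i).2.1.trans h1.le, h2.trans_le (min_le_right _ _)⟩, h1,
      h2.trans_le (min_le_left _ _), hr⟩
  have ha : ∀ i, ∃ a : UI, a ≤ x i ∧ (x i : ℝ) - ε < a ∧ (∃ q : ℚ, (a : ℝ) = q) ∧
      Set.Ici a ∈ 𝓝 (x i) := fun i => by
    rcases eq_or_lt_of_le (x i).2.1 with h0 | h0
    · refine ⟨⟨0, by simp⟩, (x i).2.1, ?_, ⟨0, by simp⟩, ?_⟩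
      · rw [← h0]; simpa using hε
      · exact Filter.univ_mem' fun z => z.2.1
    · obtain ⟨q, h1, h2⟩ := exists_rat_btwn (show max ((x i : ℝ) - ε) 0 < x i from
        max_lt (by linarith) h0)
      refine ⟨⟨q, ((le_max_right _ _).trans_lt h1).le, h2.trans (x i).2.2⟩, h2.le,
        (le_max_left _ _).trans_lt h1, ⟨q, rfl⟩, Ici_mem_nhds h2⟩
  choose b hb1 hb2 hb3 using hb
  choose a ha1 ha2 ha3 ha4 using ha
  refine ⟨Set.Icc a b, ⟨a, b, fun i => (ha1 i).trans_lt (hb1 i), ha3, hb3, rfl⟩, ?_, ?_⟩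
  · rw [← Set.pi_univ_Icc]
    exact set_pi_mem_nhds Set.finite_univ fun i _ =>
      (Filter.inter_mem (ha4 i) (Iic_mem_nhds (hb1 i)) : Set.Ici (a i) ∩ Set.Iic (b i) ∈ _)
  · intro y hy
    refine hball ?_
    rw [Metric.mem_ball, dist_pi_lt_iff hε]
    intro i
    have h1 : (a i : ℝ) ≤ y i := hy.1 i
    have h2 : (y i : ℝ) ≤ b i := hy.2 i
    rw [Subtype.dist_eq, Real.dist_eq, abs_lt]
    constructor <;> linarith [ha2 i, hb2 i]

/-- Point sets whose extreme discrepancy tends to zero converge weakly to Lebesgue measure. -/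
theorem wconv_of_discrepancy {k : ℕ} {u : ∀ N : ℕ, Fin N → Cube k}
    (hu : Tendsto (fun N => discrepancy (u N)) atTop (𝓝 0)) : WConv unif u volume := by
  let ν : ProbabilityMeasure (Cube k) := ⟨volume, inferInstance⟩
  let μ : ℕ → ProbabilityMeasure (Cube k) := fun N =>
    ⟨empirical (u (N + 1)), isProbabilityMeasure_empirical N.succ_ne_zero _⟩
  have hμν : Tendsto μ atTop (𝓝 ν) := by
    refine (isPiSystem_ratIrratBoxes k).tendsto_probabilityMeasure_of_tendsto_of_mem ?_
      (fun v hv y hy => exists_ratIrratBox_subset hv hy) ?_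
    · rintro _ ⟨a, b, -, -, -, rfl⟩
      exact measurableSet_Icc
    · rintro _ ⟨a, b, hab, -, -, rfl⟩
      rw [NNReal.tendsto_coe.symm, tendsto_iff_dist_tendsto_zero]
      refine squeeze_zero (fun _ => dist_nonneg) (fun N => ?_) ((tendsto_add_atTop_iff_nat 1).2 hu)
      have := isProbabilityMeasure_empirical N.succ_ne_zero (u (N + 1))
      exact abs_sub_le_extremeNorm (empirical (u (N + 1))) volume hab
  rintro f ⟨K, hK⟩ ⟨C, hC⟩
  have h := tendsto_iff_forall_lipschitz_integral_tendsto.1 hμν f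
    ⟨C + C, fun y z => ?_⟩ ⟨K, hK⟩
  · rw [← tendsto_add_atTop_iff_nat 1]
    exact h.congr fun N => integral_empirical _ _
  · rw [Real.dist_eq]
    exact (abs_sub _ _).trans (add_le_add (hC y) (hC z))

/-! ### Weak convergence controls the extreme norm -/

/-- Pairs of corners of boxes, ranging over the compact cube `[0,1]^ι` rather than `[0,1)^ι`. -/
abbrev Corners (ι : Type) : Type := (ι → Set.Icc (0 : ℝ) 1) × (ι → Set.Icc (0 : ℝ) 1)

/-- Weak convergence to a measure that does not charge hyperplanes orthogonal to the axes implies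
convergence in extreme norm. The indicator of a box depends continuously on its corners off a null
set, so that the differences of the measures of boxes converge continuously to zero in the corners;
on the compact set of all pairs of corners the convergence is then uniform. -/
theorem tendsto_extremeNorm_of_wconv {ι : Type} [Fintype ι] {y : ∀ N : ℕ, Fin N → ι → UI}
    {ν : Measure (ι → UI)} [IsProbabilityMeasure ν]
    (hν : ∀ i (c : UI), ν {x | x i = c} = 0) (hy : WConv unif y ν) :
    Tendsto (fun N => extremeNorm (empirical (y N)) ν) atTop (𝓝 0) := by
  classical
  let S : Corners ι → Set (ι → UI) := fun θ =>
    {x | ∀ i, (θ.1 i : ℝ) ≤ x i ∧ (x i : ℝ) ≤ θ.2 i}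
  let F : Corners ι → (ι → UI) → ℝ := fun θ => (S θ).indicator 1
  have hFb : ∀ θ x, |F θ x| ≤ 1 := fun θ x => by
    by_cases hx : x ∈ S θ <;> simp [F, hx]
  have hSm : ∀ θ, MeasurableSet (S θ) := fun θ => by
    have : S θ = ⋂ i, ({x | (θ.1 i : ℝ) ≤ x i} ∩ {x | (x i : ℝ) ≤ θ.2 i}) := by
      ext x
      simp [S]
    rw [this]
    exact MeasurableSet.iInter fun i => (measurableSet_le (by fun_prop) (by fun_prop)).inter
      (measurableSet_le (by fun_prop) (by fun_prop))
  have hnull : ∀ θ : Corners ι, ∀ᵐ x ∂ν, ∀ i, (x i : ℝ) ≠ θ.1 i ∧ (x i : ℝ) ≠ θ.2 i := by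
    intro θ
    refine ae_all_iff.2 fun i => ?_
    have key : ∀ c : ℝ, ∀ᵐ x ∂ν, (x i : ℝ) ≠ c := fun c => by
      by_cases hc : c ∈ Set.Ico (0 : ℝ) 1
      · have := hν i ⟨c, hc⟩
        filter_upwards [measure_eq_zero_iff_ae_notMem.1 this] with x hx h
        exact hx (Subtype.ext h)
      · exact Eventually.of_forall fun x h => hc (h ▸ (x i).2)
    exact (key _).and (key _)
  have hcont : ∀ θ : Corners ι, ∀ᵐ x ∂ν,
      Tendsto (fun p : Corners ι × (ι → UI) => F p.1 p.2) (𝓝 θ ×ˢ 𝓝 x) (𝓝 (F θ x)) := by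
    intro θ
    filter_upwards [hnull θ] with x hx
    refine tendsto_const_nhds.congr' ?_
    have : ∀ᶠ p in 𝓝 θ ×ˢ 𝓝 x, ∀ i, (((θ.1 i : ℝ) ≤ x i ↔ (p.1.1 i : ℝ) ≤ p.2 i) ∧
        ((x i : ℝ) ≤ θ.2 i ↔ (p.2 i : ℝ) ≤ p.1.2 i)) := by
      rw [← nhds_prod_eq]
      refine eventually_all.2 fun i => ?_
      have c1 : Continuous fun p : Corners ι × (ι → UI) => ((p.1.1 i : ℝ)) := by fun_prop
      have c2 : Continuous fun p : Corners ι × (ι → UI) => ((p.1.2 i : ℝ)) := by fun_prop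
      have c3 : Continuous fun p : Corners ι × (ι → UI) => ((p.2 i : ℝ)) := by fun_prop
      have aux : ∀ {f g : Corners ι × (ι → UI) → ℝ}, Continuous f → Continuous g →
          f (θ, x) ≠ g (θ, x) → ∀ᶠ p in 𝓝 (θ, x), (f (θ, x) ≤ g (θ, x) ↔ f p ≤ g p) := by
        intro f g hf hg hne
        rcases lt_or_gt_of_ne hne with h | h
        · filter_upwards [hf.continuousAt.eventually_lt hg.continuousAt h] with p hp
          exact ⟨fun _ => hp.le, fun _ => h.le⟩
        · filter_upwards [hg.continuousAt.eventually_lt hf.continuousAt h] with p hp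
          exact ⟨fun h' => absurd h' (not_le.2 h), fun h' => absurd h' (not_le.2 hp)⟩
      exact (aux c1 c3 (hx i).1.symm).and (aux c3 c2 (hx i).2)
    filter_upwards [this] with p hp
    have : x ∈ S θ ↔ p.2 ∈ S p.1 := forall_congr' fun i => and_congr (hp i).1 (hp i).2
    by_cases h : x ∈ S θ
    · simp [F, h, this.1 h]
    · have h' : p.2 ∉ S p.1 := fun h' => h (this.2 h')
      simp [F, h, h']
  -- the error for the box with corners `θ`
  let D : ℕ → Corners ι → ℝ := fun N θ => ∑ n, unif N n * F θ (y N n) - ∫ x, F θ x ∂ν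
  have hD : ∀ θ, Tendsto (fun p : ℕ × Corners ι => D p.1 p.2) (atTop ×ˢ 𝓝 θ) (𝓝 0) := by
    intro θ
    have h1 : Tendsto (fun p : ℕ × Corners ι => ∑ n, unif p.1 n * F p.2 (y p.1 n)) (atTop ×ˢ 𝓝 θ)
        (𝓝 (∫ x, F θ x ∂ν)) := by
      refine hy.tendsto_sum unif_nonneg (φ := Prod.fst) tendsto_fst (F := fun p => F p.2)
        (fun p => hFb p.2) ?_
      filter_upwards [hcont θ] with x hx
      exact hx.comp ((tendsto_snd.comp tendsto_fst).prodMk tendsto_snd)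
    have h2 : Tendsto (fun θ' => ∫ x, F θ' x ∂ν) (𝓝 θ) (𝓝 (∫ x, F θ x ∂ν)) := by
      refine tendsto_integral_filter_of_dominated_convergence (fun _ => 1)
        (Eventually.of_forall fun θ' =>
          (measurable_one.indicator (hSm θ')).aestronglyMeasurable)
        (Eventually.of_forall fun θ' => Eventually.of_forall fun x => hFb θ' x)
        (integrable_const 1) ?_
      filter_upwards [hcont θ] with x hx
      exact hx.comp (tendsto_id.prodMk tendsto_const_nhds)
    simpa [D] using h1.sub (h2.comp tendsto_snd)
  have hDu : TendstoUniformly D (fun _ => 0) atTop := by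
    rw [← tendstoLocallyUniformly_iff_tendstoUniformly_of_compactSpace,
      tendstoLocallyUniformly_iff_forall_tendsto]
    intro θ
    rw [tendsto_uniformity_iff_dist_tendsto_zero]
    simpa [Real.dist_eq] using (hD θ).abs
  rw [Metric.tendsto_atTop]
  intro ε hε
  obtain ⟨N0, hN0⟩ := eventually_atTop.1 (Metric.tendstoUniformly_iff.1 hDu (ε / 2) (half_pos hε))
  refine ⟨N0, fun N hN => ?_⟩
  have hle : extremeNorm (empirical (y N)) ν ≤ ε / 2 := by
    refine Real.iSup_le (fun B => ?_) (half_pos hε).le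
    let θ : Corners ι := (fun i => ⟨B.1.1 i, (B.1.1 i).2.1, (B.1.1 i).2.2.le⟩,
      fun i => ⟨B.1.2 i, (B.1.2 i).2.1, (B.1.2 i).2.2.le⟩)
    have hS : S θ = Set.Icc B.1.1 B.1.2 := by
      ext x
      exact forall_and
    have h1 := (hN0 N hN θ).le
    simp only [D] at h1
    rw [Real.dist_eq, zero_sub, abs_neg] at h1
    rwa [← integral_empirical, integral_indicator_one (hSm θ), integral_indicator_one (hSm θ), hS]
      at h1
  have h0 : 0 ≤ extremeNorm (empirical (y N)) ν := Real.iSup_nonneg fun _ => abs_nonneg _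
  rw [Real.dist_eq, sub_zero, abs_of_nonneg h0]
  linarith

/-! ### Sampling one coordinate -/

theorem volume_UI_apply {s : Set UI} : (volume : Measure UI) s = volume (Subtype.val '' s) :=
  comap_subtype_coe_apply measurableSet_Ico _ _

theorem volume_real_setOf_le {c : ℝ} (h0 : 0 ≤ c) (h1 : c ≤ 1) :
    (volume : Measure UI).real {u | (u : ℝ) ≤ c} = c := by
  have h : (volume : Measure UI) {u | (u : ℝ) ≤ c} = ENNReal.ofReal c := by
    rw [volume_UI_apply]
    apply le_antisymm
    · refine (measure_mono (t := Set.Icc 0 c) ?_).trans (by simp)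
      rintro _ ⟨u, hu, rfl⟩
      exact ⟨u.2.1, hu⟩
    · refine le_trans (by simp) (measure_mono (s := Set.Ico 0 c) ?_)
      intro r hr
      exact ⟨⟨r, hr.1, hr.2.trans_le h1⟩, hr.2.le, rfl⟩
  rw [measureReal_def, h, ENNReal.toReal_ofReal h0]

instance instNullSingletonClassUI : NullSingletonClass (volume : Measure UI) where
  measure_singleton a := by
    rw [volume_UI_apply, Set.image_singleton]
    exact measure_singleton _

/-- The index of the interval among `[0, 1/K], (1/K, 2/K], …, ((K-1)/K, 1]` that contains `t`. -/
noncomputable def gridLabel (K : ℕ) (t : ℝ) : ℕ := ⌈(K : ℝ) * t⌉₊ - 1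

/-- A positive `k` exceeds the label exactly when the point does not exceed `k / K`. This fails for
`k = 0`, at points `t ≤ 0`. -/
theorem gridLabel_lt_iff {K k : ℕ} (hK : 0 < K) (hk : 0 < k) {t : ℝ} :
    gridLabel K t < k ↔ t ≤ (k : ℝ) / K := by
  have hK' : (0 : ℝ) < K := by exact_mod_cast hK
  rw [le_div_iff₀ hK', mul_comm, ← Nat.ceil_le, gridLabel]
  omega

theorem gridLabel_lt {K : ℕ} (hK : 0 < K) {t : ℝ} (ht : t ≤ 1) : gridLabel K t < K := by
  rw [gridLabel_lt_iff hK hK, div_self (by exact_mod_cast hK.ne')]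
  exact ht

/-- The graph of a measurable function is a null set for a product with Lebesgue measure. -/
theorem ae_prod_fst_ne {Z : Type} [MeasurableSpace Z] {ρ : Measure Z} [SFinite ρ] {a : Z → ℝ}
    (ha : Measurable a) : ∀ᵐ p ∂(volume : Measure UI).prod ρ, (p.1 : ℝ) ≠ a p.2 := by
  have hm : MeasurableSet {p : UI × Z | (p.1 : ℝ) = a p.2} :=
    measurableSet_eq_fun (by fun_prop) (by fun_prop)
  rw [ae_iff]
  simp only [ne_eq, not_not]
  rw [Measure.prod_apply_symm hm]
  refine (lintegral_congr fun z => ?_).trans lintegral_zero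
  refine Set.Subsingleton.measure_zero ?_ _
  intro u hu u' hu'
  exact Subtype.ext ((hu : (u : ℝ) = a z).trans (hu' : (u' : ℝ) = a z).symm)

section Sampling

variable {X Z : Type} [MeasurableSpace X] [PseudoMetricSpace Z] [MeasurableSpace Z] [BorelSpace Z]
  [SecondCountableTopology Z]

/-- The points `x N n` are sampled, at the level `s` of the ordering function `h`, from the
conditional distribution under `μ` of the first component given the second one, asymptotically: the
input `u N n` decides whether `h (x N n) ≤ s` by comparison with a threshold `aN N (z N n)`, and the
thresholds converge continuously to the conditional probability `a` of the event `h ≤ s`. The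
ordering function need not be measurable; the set `C` is a measurable version of `{h ≤ s}`. -/
def SampledAt (h : X → ℝ) (s : ℝ) (u : ∀ N : ℕ, Fin N → UI) (z : ∀ N : ℕ, Fin N → Z)
    (x : ∀ N : ℕ, Fin N → X) (μ : Measure (X × Z)) : Prop :=
  ∃ (C : Set X) (aN : ℕ → Z → ℝ) (a : Z → ℝ), MeasurableSet C ∧
    (∀ᵐ y ∂μ.map Prod.fst, h y ≤ s ↔ y ∈ C) ∧
    (∀ N n, 0 < u N n → (h (x N n) ≤ s ↔ (u N n : ℝ) ≤ aN N (z N n))) ∧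
    (∀ y, Tendsto (fun p : ℕ × Z => aN p.1 p.2) (atTop ×ˢ 𝓝 y) (𝓝 (a y))) ∧
    Measurable a ∧ (∀ y, 0 ≤ a y ∧ a y ≤ 1) ∧
    ∀ φ : Z → ℝ, Continuous φ → (∃ c, ∀ y, |φ y| ≤ c) →
      ∫ p, φ p.2 * C.indicator 1 p.1 ∂μ = ∫ p, φ p.2 * a p.2 ∂μ

/-- The event `h ≤ s` is, up to inputs equal to zero, the event that the input does not exceed the
threshold. The indicator of the latter converges continuously off the graph of the limiting
threshold, so that the extended continuous mapping theorem applies. -/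
theorem SampledAt.tendsto_sum {h : X → ℝ} {s : ℝ} {u : ∀ N : ℕ, Fin N → UI}
    {z : ∀ N : ℕ, Fin N → Z} {x : ∀ N : ℕ, Fin N → X} {μ : Measure (X × Z)}
    [IsProbabilityMeasure μ] (hs : SampledAt h s u z x μ)
    (huz : WConv unif (fun N n => (u N n, z N n)) (volume.prod (μ.map Prod.snd)))
    {φ : Z → ℝ} (hφ : Continuous φ) {c : ℝ} (hc : ∀ y, |φ y| ≤ c) :
    Tendsto (fun N => ∑ n, unif N n * (φ (z N n) * {t | t ≤ s}.indicator 1 (h (x N n)))) atTop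
      (𝓝 (∫ p, φ p.2 * {t | t ≤ s}.indicator 1 (h p.1) ∂μ)) := by
  obtain ⟨C, aN, a, hC, hhC, hiff, hlim, ham, ha, hint⟩ := hs
  have : IsProbabilityMeasure (μ.map Prod.snd) :=
    Measure.isProbabilityMeasure_map measurable_snd.aemeasurable
  -- the thresholded inputs
  let F : ℕ → UI × Z → ℝ := fun N p => φ p.2 * {q : UI × Z | (q.1 : ℝ) ≤ aN N q.2}.indicator 1 p
  let Fl : UI × Z → ℝ := fun p => φ p.2 * {q : UI × Z | (q.1 : ℝ) ≤ a q.2}.indicator 1 p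
  have ind01 : ∀ {α : Type} (A : Set α) (p : α), |A.indicator (1 : α → ℝ) p| ≤ 1 :=
    fun A p => by by_cases hp : p ∈ A <;> simp [hp]
  have hF : ∀ N p, |F N p| ≤ c := fun N p => by
    rw [abs_mul]
    exact (mul_le_of_le_one_right (abs_nonneg _) (ind01 _ _)).trans (hc _)
  have h1 : Tendsto (fun N => ∑ n, unif N n * F N (u N n, z N n)) atTop
      (𝓝 (∫ p, Fl p ∂(volume.prod (μ.map Prod.snd)))) := by
    refine huz.tendsto_sum unif_nonneg (φ := id) tendsto_id hF ?_
    filter_upwards [ae_prod_fst_ne (ρ := μ.map Prod.snd) ham] with p hp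
    have t1 : Tendsto (fun q : ℕ × (UI × Z) => aN q.1 q.2.2) (atTop ×ˢ 𝓝 p) (𝓝 (a p.2)) :=
      (hlim p.2).comp (tendsto_fst.prodMk ((continuous_snd.tendsto p).comp tendsto_snd))
    have t2 : Tendsto (fun q : ℕ × (UI × Z) => (q.2.1 : ℝ)) (atTop ×ˢ 𝓝 p) (𝓝 (p.1 : ℝ)) :=
      ((continuous_subtype_val.comp continuous_fst).tendsto p).comp tendsto_snd
    have t3 : Tendsto (fun q : ℕ × (UI × Z) => φ q.2.2) (atTop ×ˢ 𝓝 p) (𝓝 (φ p.2)) :=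
      ((hφ.comp continuous_snd).tendsto p).comp tendsto_snd
    refine t3.mul (tendsto_const_nhds.congr' ?_)
    rcases lt_or_gt_of_ne hp with h | h
    · filter_upwards [t2.eventually_lt t1 h] with q hq
      rw [Set.indicator_of_mem (show p ∈ {q : UI × Z | (q.1 : ℝ) ≤ a q.2} from h.le),
        Set.indicator_of_mem (show q.2 ∈ {q' : UI × Z | (q'.1 : ℝ) ≤ aN q.1 q'.2} from hq.le)]
      rfl
    · filter_upwards [t1.eventually_lt t2 h] with q hq
      rw [Set.indicator_of_notMem (show p ∉ {q : UI × Z | (q.1 : ℝ) ≤ a q.2} from h.not_ge),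
        Set.indicator_of_notMem
          (show q.2 ∉ {q' : UI × Z | (q'.1 : ℝ) ≤ aN q.1 q'.2} from hq.not_ge)]
  have hset : MeasurableSet {q : UI × Z | (q.1 : ℝ) ≤ a q.2} :=
    measurableSet_le (by fun_prop) (by fun_prop)
  have h2 : ∫ p, Fl p ∂(volume.prod (μ.map Prod.snd)) =
      ∫ p, φ p.2 * {t | t ≤ s}.indicator 1 (h p.1) ∂μ := by
    have hFl : Integrable Fl (volume.prod (μ.map Prod.snd)) := by
      refine Integrable.of_bound (C := c) (Measurable.aestronglyMeasurable ?_)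
        (Eventually.of_forall fun p => ?_)
      · exact (hφ.measurable.comp measurable_snd).mul (measurable_one.indicator hset)
      · rw [Real.norm_eq_abs, abs_mul]
        exact (mul_le_of_le_one_right (abs_nonneg _) (ind01 _ _)).trans (hc _)
    rw [integral_prod_symm _ hFl]
    have : ∀ y, ∫ v : UI, Fl (v, y) = φ y * a y := fun y => by
      have e : (fun v : UI => Fl (v, y)) =
          fun v => φ y * {v : UI | (v : ℝ) ≤ a y}.indicator 1 v := by
        funext v
        rfl
      rw [e, integral_const_mul, integral_indicator_one (measurableSet_le (by fun_prop)
        (by fun_prop)), volume_real_setOf_le (ha y).1 (ha y).2]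
    simp only [this]
    rw [integral_map (f := fun y => φ y * a y) measurable_snd.aemeasurable
      (hφ.measurable.mul ham).aestronglyMeasurable, ← hint φ hφ ⟨c, hc⟩]
    refine integral_congr_ae ?_
    filter_upwards [ae_of_ae_map measurable_fst.aemeasurable hhC] with p hp
    by_cases hpC : p.1 ∈ C
    · rw [Set.indicator_of_mem hpC, Set.indicator_of_mem (show h p.1 ∈ {t | t ≤ s} from hp.2 hpC)]
      rfl
    · rw [Set.indicator_of_notMem hpC,
        Set.indicator_of_notMem (show h p.1 ∉ {t | t ≤ s} from fun h' => hpC (hp.1 h'))]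
  -- inputs equal to zero are asymptotically negligible
  let G : UI × Z → ℝ := fun p => c * {q : UI × Z | q.1 = 0}.indicator 1 p
  have hne0 : ∀ᵐ p ∂(volume : Measure UI).prod (μ.map Prod.snd), p.1 ≠ 0 := by
    filter_upwards [ae_prod_fst_ne (ρ := μ.map Prod.snd) (a := fun _ => 0) measurable_const]
      with p hp h
    exact hp (by rw [h]; rfl)
  have h3 : Tendsto (fun N => ∑ n, unif N n * G (u N n, z N n)) atTop (𝓝 0) := by
    have h0 : ∫ p, G p ∂((volume : Measure UI).prod (μ.map Prod.snd)) = 0 := by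
      refine integral_eq_zero_of_ae ?_
      filter_upwards [hne0] with p hp
      simp [G, hp]
    rw [← h0]
    refine huz.tendsto_sum_ae_continuousAt unif_nonneg (C := |c|) (fun p => ?_) ?_
    · rw [abs_mul]
      exact mul_le_of_le_one_right (abs_nonneg _) (ind01 _ _)
    · filter_upwards [hne0] with p hp
      refine (continuousAt_const (y := (0 : ℝ))).congr ?_
      filter_upwards [(isOpen_ne.preimage continuous_fst).mem_nhds hp] with q hq
      have hq' : q.1 ≠ 0 := hq
      simp [G, hq']
  rw [h2] at h1
  have h4 : Tendsto (fun N => ∑ n, unif N n * (φ (z N n) * {t | t ≤ s}.indicator 1 (h (x N n))) -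
      ∑ n, unif N n * F N (u N n, z N n)) atTop (𝓝 0) := by
    refine squeeze_zero_norm (fun N => ?_) h3
    rw [← Finset.sum_sub_distrib]
    refine (norm_sum_le _ _).trans (Finset.sum_le_sum fun n _ => ?_)
    rw [← mul_sub, norm_mul, Real.norm_of_nonneg (unif_nonneg N n)]
    refine mul_le_mul_of_nonneg_left ?_ (unif_nonneg N n)
    rcases eq_or_lt_of_le (show (0 : UI) ≤ u N n from (u N n).2.1) with h0 | h0
    · simp only [G, F]
      rw [← mul_sub, Set.indicator_of_mem (show (u N n, z N n) ∈ {q : UI × Z | q.1 = 0} from h0.symm),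
        norm_mul]
      refine mul_le_mul (hc _) ?_ (norm_nonneg _) ((abs_nonneg _).trans (hc (z N n)))
      simp only [Set.indicator, Set.mem_ofPred_eq, Pi.one_apply, Real.norm_eq_abs]
      split_ifs <;> norm_num
    · have e := hiff N n h0
      have : φ (z N n) * {t | t ≤ s}.indicator 1 (h (x N n)) - F N (u N n, z N n) = 0 := by
        simp only [F, Set.indicator, Set.mem_ofPred_eq, Pi.one_apply, e, sub_self]
      rw [this, norm_zero]
      refine mul_nonneg ((abs_nonneg _).trans (hc (z N n))) ?_
      exact Set.indicator_nonneg (fun _ _ => zero_le_one) _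
  simpa using h4.add h1

theorem tendsto_of_forall_approx {b : ℕ → ℝ} {l : ℝ}
    (h : ∀ ε > 0, ∃ (c : ℕ → ℝ) (m : ℝ), Tendsto c atTop (𝓝 m) ∧ (∀ N, |b N - c N| ≤ ε) ∧
      |l - m| ≤ ε) : Tendsto b atTop (𝓝 l) := by
  rw [Metric.tendsto_atTop]
  intro ε hε
  obtain ⟨c, m, hcm, hb, hl⟩ := h (ε / 4) (by linarith)
  obtain ⟨N0, hN0⟩ := Metric.tendsto_atTop.1 hcm (ε / 4) (by linarith)
  refine ⟨N0, fun N hN => ?_⟩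
  have h1 := hN0 N hN
  rw [Real.dist_eq, abs_lt] at *
  rw [abs_le] at hl
  have h2 := abs_le.1 (hb N)
  constructor <;> linarith

/-- Points sampled, at all levels of arbitrarily fine grids, from the conditional distributions of
`μ` converge jointly with the conditioning variables to `μ`. -/
theorem wconv_of_sampledAt [PseudoMetricSpace X] [BorelSpace X] [SecondCountableTopology X]
    {h : X → ℝ} (h1 : ∀ x, h x ≤ 1) {u : ∀ N : ℕ, Fin N → UI}
    {z : ∀ N : ℕ, Fin N → Z} {x : ∀ N : ℕ, Fin N → X} {μ : Measure (X × Z)}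
    [IsProbabilityMeasure μ]
    (huz : WConv unif (fun N n => (u N n, z N n)) (volume.prod (μ.map Prod.snd)))
    (hgrid : ∀ ε > 0, ∃ K : ℕ, 0 < K ∧
      (∀ y y' : X, gridLabel K (h y) = gridLabel K (h y') → dist y y' ≤ ε) ∧
      ∀ k : ℕ, 0 < k → k < K → SampledAt h ((k : ℝ) / K) u z x μ) :
    WConv unif (fun N n => (x N n, z N n)) μ := by
  classical
  rintro f ⟨L, hL⟩ ⟨c, hc⟩
  have hμs : IsProbabilityMeasure (μ.map Prod.snd) :=
    Measure.isProbabilityMeasure_map measurable_snd.aemeasurable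
  have hX : Nonempty X := by
    obtain ⟨p⟩ := (inferInstance : NeZero μ).ne |> fun _ => μ.nonempty_of_neZero
    exact ⟨p.1⟩
  refine tendsto_of_forall_approx fun ε hε => ?_
  obtain ⟨K, hK, hcell, hsamp⟩ := hgrid (ε / (L + 1)) (by positivity)
  -- a representative of each cell
  let rep : ℕ → X := fun k => if hk : ∃ y, gridLabel K (h y) = k then hk.choose else hX.some
  have hrep : ∀ y, dist y (rep (gridLabel K (h y))) ≤ ε / (L + 1) := fun y => by
    have hk : ∃ y', gridLabel K (h y') = gridLabel K (h y) := ⟨y, rfl⟩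
    simp only [rep, dif_pos hk]
    exact hcell _ _ hk.choose_spec.symm
  -- the levels `0` and `K` are trivial, the others are covered by `hsamp`
  let J : ℕ → X → ℝ := fun k y => if gridLabel K (h y) < k then 1 else 0
  have hJs : ∀ k, 0 < k → ∀ y, J k y = {t | t ≤ (k : ℝ) / K}.indicator 1 (h y) := fun k hk y => by
    simp only [J, Set.indicator, Set.mem_ofPred_eq, gridLabel_lt_iff hK hk, Pi.one_apply]
  have hJm : ∀ k, k ≤ K → AEStronglyMeasurable (fun p : X × Z => J k p.1) μ := fun k hk => by
    rcases Nat.eq_zero_or_pos k with rfl | hk0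
    · simp only [J, not_lt_zero, if_false]
      exact aestronglyMeasurable_const
    rcases hk.eq_or_lt with rfl | hkK
    · simp only [J, gridLabel_lt hK (h1 _), if_true]
      exact aestronglyMeasurable_const
    obtain ⟨C, -, -, hC, hhC, -⟩ := hsamp k hk0 hkK
    refine AEStronglyMeasurable.congr (f := fun p : X × Z => C.indicator (1 : X → ℝ) p.1)
      ((measurable_one.indicator hC).comp measurable_fst).aestronglyMeasurable ?_
    filter_upwards [ae_of_ae_map measurable_fst.aemeasurable hhC] with p hp
    rw [hJs k hk0]
    simp only [Set.indicator, Set.mem_ofPred_eq, hp, Pi.one_apply]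
  have hJb : ∀ k y, |J k y| ≤ 1 := fun k y => by
    simp only [J]; split_ifs <;> simp
  have hfr : ∀ k, Continuous fun y : Z => f (rep k, y) := fun k => hL.continuous.comp (by fun_prop)
  have hJlim : ∀ k, k ≤ K → ∀ φ : Z → ℝ, Continuous φ → (∀ y, |φ y| ≤ c) →
      Tendsto (fun N => ∑ n, unif N n * (φ (z N n) * J k (x N n))) atTop
        (𝓝 (∫ p, φ p.2 * J k p.1 ∂μ)) := fun k hk φ hφ hφc => by
    rcases Nat.eq_zero_or_pos k with rfl | hk0
    · simp [J]
    rcases hk.eq_or_lt with rfl | hkK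
    · simp only [J, gridLabel_lt hK (h1 _), if_true, mul_one]
      have := huz.tendsto_sum_continuous unif_nonneg (f := fun p => φ p.2) (fun p => hφc p.2)
        (hφ.comp continuous_snd)
      rw [← integral_map (φ := Prod.snd) (f := φ) measurable_snd.aemeasurable
        hφ.measurable.aestronglyMeasurable]
      convert! this using 2
      rw [← integral_map (φ := Prod.snd) (f := φ) measurable_snd.aemeasurable
        hφ.measurable.aestronglyMeasurable]
      congr 1
      rw [← Measure.snd, ← Measure.snd, Measure.snd_prod]
    simp only [hJs k hk0]
    exact (hsamp k hk0 hkK).tendsto_sum huz hφ hφc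
  -- the approximation of `f` that is constant in the first variable on each cell
  let ft : X × Z → ℝ := fun p =>
    ∑ k ∈ Finset.range K, f (rep k, p.2) * (J (k + 1) p.1 - J k p.1)
  have hft : ∀ p, ft p = f (rep (gridLabel K (h p.1)), p.2) := fun p => by
    simp only [ft]
    rw [Finset.sum_eq_single_of_mem (gridLabel K (h p.1))
      (Finset.mem_range.2 (gridLabel_lt hK (h1 _)))]
    · simp [J]
    · intro k _ hk
      have : J (k + 1) p.1 = J k p.1 := by
        simp only [J]
        refine if_congr ?_ rfl rfl
        omega
      rw [this, sub_self, mul_zero]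
  have hclose : ∀ p, |f p - ft p| ≤ ε := fun p => by
    rw [hft, ← Real.dist_eq]
    refine (hL.dist_le_mul _ _).trans ?_
    have : dist p (rep (gridLabel K (h p.1)), p.2) ≤ ε / (L + 1) := by
      rw [Prod.dist_eq]
      exact max_le (hrep p.1) (by simp only [dist_self]; positivity)
    calc (L : ℝ) * dist p (rep (gridLabel K (h p.1)), p.2) ≤ (L + 1) * (ε / (L + 1)) := by
          gcongr
          simp
      _ = ε := by field_simp
  have hint : ∀ k, k ≤ K → ∀ k', Integrable (fun p : X × Z => f (rep k', p.2) * J k p.1) μ :=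
    fun k hk k' => by
      refine Integrable.of_bound (C := c) (((hfr k').comp
        continuous_snd).measurable.aestronglyMeasurable.mul (hJm k hk))
        (Eventually.of_forall fun p => ?_)
      rw [Real.norm_eq_abs, abs_mul]
      exact (mul_le_of_le_one_right (abs_nonneg _) (hJb _ _)).trans (hc _)
  have hint' : ∀ k ∈ Finset.range K,
      Integrable (fun p : X × Z => f (rep k, p.2) * (J (k + 1) p.1 - J k p.1)) μ := fun k hk => by
    have hk := Finset.mem_range.1 hk
    simp only [mul_sub]
    exact (hint (k + 1) hk k).sub (hint k hk.le k)
  refine ⟨fun N => ∑ n, unif N n * ft (x N n, z N n), ∫ p, ft p ∂μ, ?_, fun N => ?_, ?_⟩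
  · have : ∀ N, ∑ n, unif N n * ft (x N n, z N n) = ∑ k ∈ Finset.range K,
        (∑ n, unif N n * (f (rep k, z N n) * J (k + 1) (x N n)) -
          ∑ n, unif N n * (f (rep k, z N n) * J k (x N n))) := fun N => by
      simp only [ft, Finset.mul_sum]
      rw [Finset.sum_comm]
      refine Finset.sum_congr rfl fun k _ => ?_
      rw [← Finset.sum_sub_distrib]
      refine Finset.sum_congr rfl fun n _ => ?_
      ring
    simp only [this]
    rw [show ∫ p, ft p ∂μ = ∑ k ∈ Finset.range K, (∫ p, f (rep k, p.2) * J (k + 1) p.1 ∂μ -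
      ∫ p, f (rep k, p.2) * J k p.1 ∂μ) from ?_]
    · refine tendsto_finsetSum _ fun k hk => ?_
      have hk := Finset.mem_range.1 hk
      exact (hJlim (k + 1) hk _ (hfr k) fun y => hc _).sub
        (hJlim k hk.le _ (hfr k) fun y => hc _)
    · simp only [ft]
      rw [integral_finsetSum _ hint']
      refine Finset.sum_congr rfl fun k hk => ?_
      have hk := Finset.mem_range.1 hk
      simp only [mul_sub]
      exact integral_sub (hint (k + 1) hk k) (hint k hk.le k)
  · rw [← Finset.sum_sub_distrib]
    refine (Finset.abs_sum_le_sum_abs _ _).trans ?_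
    calc ∑ n, |unif N n * f (x N n, z N n) - unif N n * ft (x N n, z N n)|
        ≤ ∑ n, unif N n * ε := Finset.sum_le_sum fun n _ => by
          rw [← mul_sub, abs_mul, abs_of_nonneg (unif_nonneg N n)]
          exact mul_le_mul_of_nonneg_left (hclose _) (unif_nonneg N n)
      _ ≤ 1 * ε := by
          rw [← Finset.sum_mul]
          exact mul_le_mul_of_nonneg_right (sum_unif_le N) hε.le
      _ = ε := one_mul ε
  · have hfi : Integrable f μ := Integrable.of_bound (C := c)
      hL.continuous.measurable.aestronglyMeasurable (Eventually.of_forall hc)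
    rw [← integral_sub hfi (integrable_finsetSum _ hint')]
    refine (abs_integral_le_integral_abs).trans ?_
    refine (integral_mono_of_nonneg (Eventually.of_forall fun _ => abs_nonneg _)
      (integrable_const ε) (Eventually.of_forall hclose)).trans ?_
    simp

end Sampling

/-! ### Sampling the coordinates one after the other -/

section Masks

variable {ι X : Type} (r : ι → ℕ)

/-- The coordinates of rank less than `k`; the others are replaced by a dummy value `o`. -/
def maskLT (o : X) (k : ℕ) (x : ι → X) : ι → X := fun j => if r j < k then x j else o

/-- The coordinates of rank at least `k`; the others are replaced by a dummy value `o`. -/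
def maskGE (o : X) (k : ℕ) (x : ι → X) : ι → X := fun j => if k ≤ r j then x j else o

variable {r}

theorem continuous_maskGE [TopologicalSpace X] (o : X) (k : ℕ) : Continuous (maskGE r o k) :=
  continuous_pi fun j => by unfold maskGE; split_ifs <;> fun_prop

theorem measurable_maskLT [MeasurableSpace X] (o : X) (k : ℕ) : Measurable (maskLT r o k) :=
  measurable_pi_lambda _ fun j => by unfold maskLT; split_ifs <;> fun_prop

theorem measurable_maskGE [MeasurableSpace X] (o : X) (k : ℕ) : Measurable (maskGE r o k) :=
  measurable_pi_lambda _ fun j => by unfold maskGE; split_ifs <;> fun_prop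

theorem update_maskLT [DecidableEq ι] (hr : Function.Injective r) (o : X) (x : ι → X) (i : ι) :
    Function.update (maskLT r o (r i) x) i (x i) = maskLT r o (r i + 1) x := by
  funext j
  rcases eq_or_ne j i with rfl | h
  · simp [maskLT]
  · have : r j ≠ r i := fun h' => h (hr h')
    rw [Function.update_of_ne h]
    unfold maskLT
    refine if_congr ?_ rfl rfl
    omega

theorem maskGE_maskGE (o : X) {k l : ℕ} (h : k ≤ l) (x : ι → X) :
    maskGE r o l (maskGE r o k x) = maskGE r o l x := by
  funext j
  by_cases hj : l ≤ r j
  · simp [maskGE, hj, h.trans hj]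
  · simp [maskGE, hj]

end Masks

theorem prod_prod_map_rotate {α β γ : Type} [MeasurableSpace α] [MeasurableSpace β]
    [MeasurableSpace γ] (μ : Measure α) (ν : Measure β) (ρ : Measure γ) [SFinite μ] [SFinite ν]
    [SFinite ρ] :
    (μ.prod (ν.prod ρ)).map (fun p => (p.2.1, (p.1, p.2.2))) = ν.prod (μ.prod ρ) := by
  refine Measure.ext_of_lintegral _ fun f hf => ?_
  rw [lintegral_map hf (by fun_prop), lintegral_prod _ (by fun_prop), lintegral_prod _ (by fun_prop)]
  have h1 : ∀ a, ∫⁻ q, f (q.1, (a, q.2)) ∂ν.prod ρ = ∫⁻ b, ∫⁻ c, f (b, (a, c)) ∂ρ ∂ν := fun a =>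
    lintegral_prod _ (by fun_prop)
  have h2 : ∀ b, ∫⁻ q, f (b, q) ∂μ.prod ρ = ∫⁻ a, ∫⁻ c, f (b, (a, c)) ∂ρ ∂μ := fun b =>
    lintegral_prod _ (by fun_prop)
  simp only [h1, h2]
  refine lintegral_lintegral_swap (f := fun a b => ∫⁻ c, f (b, (a, c)) ∂ρ)
    (Measurable.aemeasurable ?_)
  simp only [Function.uncurry_def]
  exact Measurable.lintegral_prod_right' (f := fun q : (α × β) × γ => f (q.1.2, (q.1.1, q.2)))
    (by fun_prop)

section Sequential

variable {ι : Type} [Fintype ι] {r : ι → ℕ}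

/-- A uniformly distributed coordinate is independent of the coordinates of larger rank. -/
theorem volume_map_eval_maskGE (i : ι) :
    (volume : Measure (ι → UI)).map (fun v => (v i, maskGE r (0 : UI) (r i + 1) v)) =
      (volume : Measure UI).prod (volume.map (maskGE r (0 : UI) (r i + 1))) := by
  classical
  let S : Finset ι := {i}
  let T : Finset ι := Finset.univ.filter fun j => r i + 1 ≤ r j
  have hST : Disjoint S T := by
    rw [Finset.disjoint_singleton_left]
    simp [T]
  have hind : iIndepFun (fun (j : ι) (v : ι → UI) => v j) (volume : Measure (ι → UI)) :=
    iIndepFun_pi (X := fun _ => id) fun _ => aemeasurable_id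
  have h := hind.indepFun_finset S T hST fun j => measurable_pi_apply j
  have hφ : Measurable fun w : S → UI => w ⟨i, Finset.mem_singleton_self i⟩ :=
    measurable_pi_apply (X := fun _ : S => UI) _
  have h' := h.comp (φ := fun w : S → UI => w ⟨i, Finset.mem_singleton_self i⟩)
    (ψ := fun w : T → UI => fun j => if hj : j ∈ T then w ⟨j, hj⟩ else 0)
    hφ (measurable_pi_lambda _ fun j => by
      by_cases hj : j ∈ T
      · simp only [hj, dif_pos]; exact measurable_pi_apply (X := fun _ : T => UI) _
      · simp only [hj, dif_neg, not_false_iff]; exact measurable_const)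
  have e1 : ((fun w : S → UI => w ⟨i, Finset.mem_singleton_self i⟩) ∘ fun (v : ι → UI) (j : S) => v j)
      = fun v => v i := rfl
  have e2 : ((fun w : T → UI => fun j => if hj : j ∈ T then w ⟨j, hj⟩ else 0) ∘
      fun (v : ι → UI) (j : T) => v j) = maskGE r (0 : UI) (r i + 1) := by
    funext v j
    simp [maskGE, T]
  rw [e1, e2] at h'
  rw [h'.map_prod_eq_prod_map_map (measurable_pi_apply i).aemeasurable
    (measurable_maskGE _ _).aemeasurable]
  congr 1
  exact (measurePreserving_eval (fun _ : ι => (volume : Measure UI)) i).map_eq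

variable {X Y : Type} [PseudoMetricSpace X] [MeasurableSpace X] [SecondCountableTopology X]
  [PseudoMetricSpace Y] [MeasurableSpace Y] [SecondCountableTopology Y]

/-- At the level `s`, the `i`-th coordinates of the points are sampled from the conditional
distribution under `μ` given the parameter and the coordinates of smaller rank. This is
`SampledAt` for one coordinate of a point of `ι → X`. -/
def SeqSampledAt (r : ι → ℕ) (o : X) (h : X → ℝ) (s : ℝ) (v : ∀ N : ℕ, Fin N → ι → UI)
    (y : ∀ N : ℕ, Fin N → Y) (x : ∀ N : ℕ, Fin N → ι → X) (μ : Measure (Y × (ι → X))) (i : ι) :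
    Prop :=
  ∃ (C : Set X) (aN : ℕ → Y × (ι → X) → ℝ) (a : Y × (ι → X) → ℝ), MeasurableSet C ∧
    (∀ᵐ t ∂μ.map (fun p => p.2 i), h t ≤ s ↔ t ∈ C) ∧
    (∀ N n, 0 < v N n i →
      (h (x N n i) ≤ s ↔ (v N n i : ℝ) ≤ aN N (y N n, maskLT r o (r i) (x N n)))) ∧
    (∀ z, Tendsto (fun p : ℕ × (Y × (ι → X)) => aN p.1 p.2) (atTop ×ˢ 𝓝 z) (𝓝 (a z))) ∧
    Measurable a ∧ (∀ z, 0 ≤ a z ∧ a z ≤ 1) ∧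
    ∀ φ : Y × (ι → X) → ℝ, Continuous φ → (∃ c, ∀ z, |φ z| ≤ c) →
      ∫ p, φ (p.1, maskLT r o (r i) p.2) * C.indicator 1 (p.2 i) ∂μ =
        ∫ p, φ (p.1, maskLT r o (r i) p.2) * a (p.1, maskLT r o (r i) p.2) ∂μ

/-- Law of the parameter, of the coordinates of rank less than `k` of a point, and of the inputs
of rank at least `k` that are still to be used. -/
noncomputable def partialLaw (r : ι → ℕ) (o : X) (k : ℕ) (μ : Measure (Y × (ι → X))) :
    Measure ((Y × (ι → X)) × (ι → UI)) :=
  (μ.map fun p => (p.1, maskLT r o k p.2)).prod (volume.map (maskGE r (0 : UI) k))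

variable {h : X → ℝ} {v : ∀ N : ℕ, Fin N → ι → UI} {y : ∀ N : ℕ, Fin N → Y}
  {x : ∀ N : ℕ, Fin N → ι → X} {μ : Measure (Y × (ι → X))} [IsProbabilityMeasure μ] {o : X}

theorem partialLaw_map_rotate (i : ι) :
    (partialLaw r o (r i) μ).map (fun q => (q.2 i, (q.1, maskGE r (0 : UI) (r i + 1) q.2))) =
      (volume : Measure UI).prod ((μ.map fun p => (p.1, maskLT r o (r i) p.2)).prod
        (volume.map (maskGE r (0 : UI) (r i + 1)))) := by
  have hm1 := measurable_maskGE (r := r) (0 : UI) (r i)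
  have hm2 := measurable_maskGE (r := r) (0 : UI) (r i + 1)
  have hm3 := measurable_maskLT (r := r) o (r i)
  have : IsProbabilityMeasure (μ.map fun p => (p.1, maskLT r o (r i) p.2)) :=
    Measure.isProbabilityMeasure_map (by fun_prop)
  have : IsProbabilityMeasure ((volume : Measure (ι → UI)).map (maskGE r (0 : UI) (r i + 1))) :=
    Measure.isProbabilityMeasure_map (by fun_prop)
  have hα : ∀ {β : Type} [MeasurableSpace β] (g : (ι → UI) → β), Measurable g →
      (μ.map fun p => (p.1, maskLT r o (r i) p.2)).prod (volume.map g) =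
        ((μ.map fun p => (p.1, maskLT r o (r i) p.2)).prod volume).map (Prod.map id g) :=
    fun g hg => by rw [← Measure.map_prod_map _ _ measurable_id hg, Measure.map_id]
  rw [← prod_prod_map_rotate, ← volume_map_eval_maskGE, partialLaw, hα _ (by fun_prop),
    hα _ (by fun_prop), Measure.map_map (by fun_prop) (by fun_prop),
    Measure.map_map (by fun_prop) (by fun_prop)]
  congr 1
  funext q
  simp only [Function.comp_apply, Prod.map, id, maskGE_maskGE (0 : UI) (Nat.le_succ (r i))]
  simp [maskGE]

variable [BorelSpace X] [BorelSpace Y]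

/-- One step of sequential sampling: the coordinate of rank `k`, if there is one, is sampled given the
previous ones and the inputs not yet used. -/
theorem wconv_partial_succ (hr : Function.Injective r) (h1 : ∀ x, h x ≤ 1)
    (hgrid : ∀ ε > 0, ∃ K : ℕ, 0 < K ∧
      (∀ x x' : X, gridLabel K (h x) = gridLabel K (h x') → dist x x' ≤ ε) ∧
      ∀ k : ℕ, 0 < k → k < K → ∀ i, SeqSampledAt r o h ((k : ℝ) / K) v y x μ i) {k : ℕ}
    (hk : WConv unif (fun N n => ((y N n, maskLT r o k (x N n)), maskGE r (0 : UI) k (v N n)))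
      (partialLaw r o k μ)) :
    WConv unif (fun N n => ((y N n, maskLT r o (k + 1) (x N n)), maskGE r (0 : UI) (k + 1) (v N n)))
      (partialLaw r o (k + 1) μ) := by
  classical
  by_cases hi : ∃ i, r i = k
  swap
  · -- no coordinate has rank `k`
    have e1 : ∀ x : ι → X, maskLT r o (k + 1) x = maskLT r o k x := fun x => by
      funext j
      refine if_congr ?_ rfl rfl
      have : r j ≠ k := fun h => hi ⟨j, h⟩
      omega
    have e2 : (maskGE r (0 : UI) (k + 1)) = maskGE r (0 : UI) k := by
      funext v j
      refine if_congr ?_ rfl rfl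
      have : r j ≠ k := fun h => hi ⟨j, h⟩
      omega
    simpa only [partialLaw, e1, e2] using hk
  obtain ⟨i, rfl⟩ := hi
  have hm2 := measurable_maskGE (r := r) (0 : UI) (r i + 1)
  have hm3 := measurable_maskLT (r := r) o (r i)
  have hm4 := measurable_maskLT (r := r) o (r i + 1)
  have hc2 := continuous_maskGE (r := r) (0 : UI) (r i + 1)
  have i1 : IsProbabilityMeasure (μ.map fun p => (p.1, maskLT r o (r i) p.2)) :=
    Measure.isProbabilityMeasure_map (by fun_prop)
  have i2 : IsProbabilityMeasure ((volume : Measure (ι → UI)).map (maskGE r (0 : UI) (r i + 1))) :=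
    Measure.isProbabilityMeasure_map (by fun_prop)
  have i3 : IsProbabilityMeasure ((volume : Measure (ι → UI)).map (maskGE r (0 : UI) (r i))) :=
    Measure.isProbabilityMeasure_map (measurable_maskGE _ _).aemeasurable
  have i4 : IsProbabilityMeasure (partialLaw r o (r i) μ) := by
    unfold partialLaw; infer_instance
  -- the joint law of the new coordinate, the previous ones and the remaining inputs
  let g : (Y × (ι → X)) × (ι → UI) → X × ((Y × (ι → X)) × (ι → UI)) := fun q =>
    (q.1.2 i, ((q.1.1, maskLT r o (r i) q.1.2), maskGE r (0 : UI) (r i + 1) q.2))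
  have hg : Measurable g := by fun_prop
  let μ' := (μ.prod (volume : Measure (ι → UI))).map g
  have i5 : IsProbabilityMeasure μ' := Measure.isProbabilityMeasure_map hg.aemeasurable
  have hsnd : μ'.map Prod.snd = (μ.map fun p => (p.1, maskLT r o (r i) p.2)).prod
      (volume.map (maskGE r (0 : UI) (r i + 1))) := by
    rw [Measure.map_prod_map _ _ (by fun_prop) (by fun_prop),
      Measure.map_map (by fun_prop) (by fun_prop)]
    rfl
  have huz : WConv unif (fun N n => (v N n i,
      ((y N n, maskLT r o (r i) (x N n)), maskGE r (0 : UI) (r i + 1) (v N n))))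
      (volume.prod (μ'.map Prod.snd)) := by
    rw [hsnd, ← partialLaw_map_rotate]
    refine (funext fun N => funext fun n => ?_ : (fun N n => _) = _) ▸ hk.map unif_nonneg
      (g := fun q => (q.2 i, (q.1, maskGE r (0 : UI) (r i + 1) q.2))) (by fun_prop)
    simp only [maskGE_maskGE (0 : UI) (Nat.le_succ (r i))]
    simp [maskGE]
  have key := wconv_of_sampledAt (x := fun N n => x N n i) h1 huz fun ε hε => by
    obtain ⟨K, hK, hcell, hs⟩ := hgrid ε hε
    refine ⟨K, hK, hcell, fun k hk hkK => ?_⟩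
    obtain ⟨C, aN, a, hC, hhC, hiff, hlim, ham, ha, hint⟩ := hs k hk hkK i
    have hindb : ∀ x, |C.indicator (1 : X → ℝ) x| ≤ 1 := fun x => by
      by_cases hx : x ∈ C <;> simp [hx]
    refine ⟨C, fun N z => aN N z.1, fun z => a z.1, hC, ?_, hiff, fun z => ?_,
      ham.comp measurable_fst, fun z => ha _, fun φ hφ hφc => ?_⟩
    · rw [show μ'.map Prod.fst = μ.map fun p => p.2 i from ?_]
      · exact hhC
      rw [Measure.map_map measurable_fst hg]
      change (μ.prod volume).map ((fun p : Y × (ι → X) => p.2 i) ∘ Prod.fst) = _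
      rw [← Measure.map_map (by fun_prop) measurable_fst]
      congr 1
      exact Measure.fst_prod
    · exact (hlim z.1).comp (tendsto_fst.prodMk ((continuous_fst.tendsto z).comp tendsto_snd))
    · obtain ⟨c, hc⟩ := hφc
      have hφm := hφ.measurable
      have hCm : Measurable (C.indicator (1 : X → ℝ)) := measurable_one.indicator hC
      rw [integral_map (f := fun p : X × ((Y × (ι → X)) × (ι → UI)) => φ p.2 * C.indicator 1 p.1)
          hg.aemeasurable
          (Measurable.aestronglyMeasurable (by fun_prop)),
        integral_map (f := fun p : X × ((Y × (ι → X)) × (ι → UI)) => φ p.2 * a p.2.1) hg.aemeasurable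
          (Measurable.aestronglyMeasurable (by fun_prop)),
        integral_prod_symm, integral_prod_symm]
      · refine integral_congr_ae (Eventually.of_forall fun w => ?_)
        exact hint (fun z => φ (z, maskGE r (0 : UI) (r i + 1) w)) (by fun_prop)
          ⟨c, fun z => hc _⟩
      · refine Integrable.of_bound (C := c) (Measurable.aestronglyMeasurable (by fun_prop))
          (Eventually.of_forall fun p => ?_)
        rw [Real.norm_eq_abs, abs_mul, abs_of_nonneg (ha _).1]
        exact (mul_le_of_le_one_right (abs_nonneg _) (ha _).2).trans (hc _)
      · refine Integrable.of_bound (C := c) (Measurable.aestronglyMeasurable (by fun_prop))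
          (Eventually.of_forall fun p => ?_)
        rw [Real.norm_eq_abs, abs_mul]
        exact (mul_le_of_le_one_right (abs_nonneg _) (hindb _)).trans (hc _)
  have hfin := key.map unif_nonneg (g := fun q : X × ((Y × (ι → X)) × (ι → UI)) =>
    ((q.2.1.1, Function.update q.2.1.2 i q.1), q.2.2)) (by fun_prop)
  simp only [update_maskLT hr] at hfin
  refine hfin.congr_measure ?_
  rw [Measure.map_map (by fun_prop) hg, partialLaw,
    Measure.map_prod_map _ _ (by fun_prop) (by fun_prop)]
  congr 1
  funext q
  simp only [Function.comp_apply, g, update_maskLT hr]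
  rfl

/-- Sequential sampling: if the coordinates of the points `x N n` are sampled one after the other
from the conditional distributions of `μ`, each with its own uniform input, then the points converge
jointly with the parameter to `μ`. -/
theorem wconv_of_seqSampledAt (hr : Function.Injective r) (h1 : ∀ x, h x ≤ 1)
    (hyv : WConv unif (fun N n => (y N n, v N n)) ((μ.map Prod.fst).prod volume))
    (hgrid : ∀ ε > 0, ∃ K : ℕ, 0 < K ∧
      (∀ x x' : X, gridLabel K (h x) = gridLabel K (h x') → dist x x' ≤ ε) ∧
      ∀ k : ℕ, 0 < k → k < K → ∀ i, SeqSampledAt r o h ((k : ℝ) / K) v y x μ i) :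
    WConv unif (fun N n => (y N n, x N n)) μ := by
  have i1 : IsProbabilityMeasure (μ.map Prod.fst) :=
    Measure.isProbabilityMeasure_map measurable_fst.aemeasurable
  have hall : ∀ k, WConv unif
      (fun N n => ((y N n, maskLT r o k (x N n)), maskGE r (0 : UI) k (v N n)))
      (partialLaw r o k μ) := by
    intro k
    induction k with
    | zero =>
      have e1 : maskGE r (0 : UI) 0 = id := by
        funext v j
        simp [maskGE]
      have e2 : ∀ x : ι → X, maskLT r o 0 x = fun _ => o := fun x => by
        funext j
        simp [maskLT]
      simp only [partialLaw, e1, e2, Measure.map_id, id]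
      have := hyv.map unif_nonneg (g := fun q : Y × (ι → UI) => ((q.1, fun _ : ι => o), q.2))
        (by fun_prop)
      refine this.congr_measure ?_
      have e3 : (fun q : Y × (ι → UI) => ((q.1, fun _ : ι => o), q.2)) =
        Prod.map (fun z => (z, fun _ : ι => o)) id := rfl
      rw [e3, ← Measure.map_prod_map _ _ (by fun_prop) measurable_id, Measure.map_id,
        Measure.map_map (by fun_prop) (by fun_prop)]
      rfl
    | succ k ih => exact wconv_partial_succ hr h1 hgrid ih
  obtain ⟨k, hk⟩ : ∃ k, ∀ j, r j < k :=
    ⟨Finset.univ.sup r + 1, fun j => Nat.lt_succ_of_le (Finset.le_sup (Finset.mem_univ j))⟩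
  have e : ∀ x : ι → X, maskLT r o k x = x := fun x => by
    funext j
    simp [maskLT, hk j]
  have i2 : IsProbabilityMeasure ((volume : Measure (ι → UI)).map (maskGE r (0 : UI) k)) :=
    Measure.isProbabilityMeasure_map (measurable_maskGE _ _).aemeasurable
  have hkk := hall k
  simp only [partialLaw, e] at hkk
  have e' : (fun p : Y × (ι → X) => (p.1, p.2)) = id := rfl
  rw [e', Measure.map_id] at hkk
  refine (hkk.map unif_nonneg continuous_fst).congr_measure ?_
  exact Measure.fst_prod

end Sequential

/-! ### Inverse Rosenblatt transforms -/

theorem abs_sub_le_of_gridLabel_eq {K : ℕ} (hK : 0 < K) {s t : ℝ} (hs : 0 ≤ s) (ht : 0 ≤ t)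
    (h : gridLabel K s = gridLabel K t) : |s - t| ≤ 1 / K := by
  have key : ∀ {s t : ℝ}, 0 ≤ s → 0 ≤ t → gridLabel K s = gridLabel K t → s - t ≤ 1 / K := by
    intro s t hs ht h
    have h1 : s ≤ ((gridLabel K s + 1 : ℕ) : ℝ) / K :=
      (gridLabel_lt_iff hK (Nat.succ_pos _)).1 (Nat.lt_succ_self _)
    have h2 : ((gridLabel K s : ℕ) : ℝ) / K ≤ t := by
      rcases Nat.eq_zero_or_pos (gridLabel K s) with h0 | h0
      · simpa [h0] using ht
      · by_contra hlt
        exact absurd ((gridLabel_lt_iff hK h0).2 (not_le.1 hlt).le) (by rw [← h]; exact lt_irrefl _)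
    push_cast at h1
    rw [add_div] at h1
    linarith
  exact abs_sub_le_iff.2 ⟨key hs ht h, key ht hs h.symm⟩

theorem measurable_head {d : ℕ} (i : Fin d) : Measurable (head i : Cube d → Cube i) :=
  measurable_pi_lambda _ fun _ => measurable_pi_apply _

/-- A point whose first coordinates are prescribed; the others are zero. -/
def extendHead {d : ℕ} (i : Fin d) (w : Cube i) : Cube d :=
  fun j => if hj : (j : ℕ) < i then w ⟨j, hj⟩ else 0

theorem measurable_extendHead {d : ℕ} (i : Fin d) : Measurable (extendHead i) :=
  measurable_pi_lambda _ fun j => by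
    unfold extendHead
    split_ifs with hj
    · exact measurable_pi_apply (X := fun _ : Fin i => UI) _
    · exact measurable_const

theorem extendHead_head {d : ℕ} (i : Fin d) (x : Cube d) :
    extendHead i (head i x) = maskLT Fin.val 0 i x := by
  funext j
  by_cases hj : (j : ℕ) < i
  · simp only [extendHead, maskLT, hj, dif_pos, if_true]
    rfl
  · simp [extendHead, maskLT, hj]

theorem head_maskLT {d : ℕ} (i : Fin d) (x : Cube d) (o : UI) :
    head i (maskLT Fin.val o i x) = head i x := by
  funext j
  have : ((Fin.castLE i.isLt.le j : Fin d) : ℕ) < i := j.isLt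
  simp [head, maskLT]

theorem head_update {d : ℕ} (i : Fin d) (x : Cube d) (s : UI) :
    head i (Function.update x i s) = head i x := by
  funext j
  have : Fin.castLE i.isLt.le j ≠ i := fun h => by
    have := congrArg Fin.val h
    have h2 := j.isLt
    simp at this
    omega
  simp [head, this]

theorem rosenblatt_update {d : ℕ} (κ : CondFamily d) (x : Cube d) (i : Fin d) (s : UI) :
    rosenblatt κ (Function.update x i s) i = (κ i (head i x)).real (Set.Iic s) := by
  simp [rosenblatt, head_update]

/-- The defining property of conditional distributions, tested against a function of the previous
coordinates and a set of values of the next one. -/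
theorem IsCondFamily.integral_mul_indicator {d : ℕ} {π : Measure (Cube d)} [IsProbabilityMeasure π]
    {κ : CondFamily d} (hκ : IsCondFamily π κ) (i : Fin d) {ψ : Cube i → ℝ} (hψ : Measurable ψ)
    {c : ℝ} (hc : ∀ w, |ψ w| ≤ c) {C : Set UI} (hC : MeasurableSet C) :
    ∫ x, ψ (head i x) * C.indicator 1 (x i) ∂π =
      ∫ x, ψ (head i x) * (κ i (head i x)).real C ∂π := by
  have := hκ.markov i
  have hm := measurable_head i
  have : IsProbabilityMeasure (π.map (head i)) := Measure.isProbabilityMeasure_map hm.aemeasurable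
  have hCm : Measurable (C.indicator (1 : UI → ℝ)) := measurable_one.indicator hC
  have hindb : ∀ x, |C.indicator (1 : UI → ℝ) x| ≤ 1 := fun x => by
    by_cases hx : x ∈ C <;> simp [hx]
  have hκm : Measurable fun w => (κ i w).real C :=
    (Kernel.measurable_coe (κ i) hC).ennreal_toReal
  rw [← integral_map (φ := fun x => (head i x, x i)) (f := fun p : Cube i × UI =>
      ψ p.1 * C.indicator 1 p.2) (by fun_prop) (Measurable.aestronglyMeasurable (by fun_prop)),
    ← hκ.disintegration i, Measure.integral_compProd,
    ← integral_map (φ := head i) (f := fun w => ψ w * (κ i w).real C) hm.aemeasurable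
      (Measurable.aestronglyMeasurable (by fun_prop))]
  · refine integral_congr_ae (Eventually.of_forall fun w => ?_)
    simp only
    rw [integral_const_mul, integral_indicator_one hC]
  · refine Integrable.of_bound (C := c) (Measurable.aestronglyMeasurable (by fun_prop))
      (Eventually.of_forall fun p => ?_)
    rw [Real.norm_eq_abs, abs_mul]
    exact (mul_le_of_le_one_right (abs_nonneg _) (hindb _)).trans (hc _)

/-- If the parameters `y N n` and the uniform inputs `v N n` converge jointly to `ρ ⊗ λ`, then the
images `x N n` of the inputs under the inverse Rosenblatt transforms of a kernel `K` satisfy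
`(y, x) → ρ ⊗ K`. Only the continuity of the Rosenblatt transform matters. -/
theorem wconv_of_isInvRosenblatt {d : ℕ} {Y : Type} [PseudoMetricSpace Y] [MeasurableSpace Y]
    [BorelSpace Y] [SecondCountableTopology Y] {ρ : Measure Y} [IsProbabilityMeasure ρ]
    {K : Kernel Y (Cube d)} [IsMarkovKernel K] {κ : Y → CondFamily d}
    (hκ : ∀ y, IsCondFamily (K y) (κ y))
    (hcont : Continuous fun q : Y × Cube d => rosenblatt (κ q.1) q.2)
    {y : ∀ N : ℕ, Fin N → Y} {v x : ∀ N : ℕ, Fin N → Cube d}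
    (hx : ∀ N n, IsInvRosenblatt (κ (y N n)) (v N n) (x N n))
    (hyv : WConv unif (fun N n => (y N n, v N n)) (ρ.prod volume)) :
    WConv unif (fun N n => (y N n, x N n)) (ρ ⊗ₘ K) := by
  refine wconv_of_seqSampledAt (r := Fin.val) (o := (0 : UI)) (h := fun t : UI => (t : ℝ))
    (v := v) Fin.val_injective (fun t => t.2.2.le) ?_ fun ε hε => ?_
  · have : (ρ ⊗ₘ K).map Prod.fst = ρ := Measure.fst_compProd ρ K
    rwa [this]
  obtain ⟨k0, hk0⟩ := exists_nat_one_div_lt hε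
  have hK : 0 < k0 + 1 := Nat.succ_pos _
  refine ⟨k0 + 1, hK, fun t t' h => ?_, fun k hk hkK i => ?_⟩
  · rw [Subtype.dist_eq, Real.dist_eq]
    refine (abs_sub_le_of_gridLabel_eq hK t.2.1 t'.2.1 h).trans ?_
    push_cast
    exact hk0.le
  have hs : ((k : ℝ) / ((k0 + 1 : ℕ) : ℝ)) ∈ Set.Ico (0 : ℝ) 1 :=
    ⟨by positivity, by
      rw [div_lt_one (by exact_mod_cast hK)]
      exact_mod_cast hkK⟩
  set s : UI := ⟨_, hs⟩
  have hle : ∀ t : UI, (t : ℝ) ≤ (k : ℝ) / ((k0 + 1 : ℕ) : ℝ) ↔ t ≤ s := fun t => Iff.rfl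
  -- the threshold is the conditional CDF at `s`, the same for all `N`
  let a : Y × Cube d → ℝ := fun z => rosenblatt (κ z.1) (Function.update z.2 i s) i
  have ha : Continuous a := by
    have h1 : Continuous fun z : Y × Cube d => (z.1, Function.update z.2 i s) := by fun_prop
    exact (continuous_apply i).comp (hcont.comp h1)
  have haeq : ∀ q x, a (q, x) = (κ q i (head i x)).real (Set.Iic s) := fun q x =>
    rosenblatt_update _ _ _ _
  have hamask : ∀ q x, a (q, maskLT Fin.val 0 i x) = (κ q i (head i x)).real (Set.Iic s) :=
    fun q x => by rw [haeq, head_maskLT]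
  have ha01 : ∀ z, 0 ≤ a z ∧ a z ≤ 1 := fun z => by
    have := (hκ z.1).markov i
    rw [haeq]
    exact ⟨measureReal_nonneg, measureReal_le_one⟩
  have hindb : ∀ x, |(Set.Iic s).indicator (1 : UI → ℝ) x| ≤ 1 := fun x => by
    by_cases hx : x ∈ Set.Iic s <;> simp only [hx, Set.indicator_of_mem,
      Set.indicator_of_notMem, not_false_iff] <;> simp
  have hmm := measurable_maskLT (r := (Fin.val : Fin d → ℕ)) (0 : UI) i
  have hCm : Measurable ((Set.Iic s).indicator (1 : UI → ℝ)) :=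
    measurable_one.indicator measurableSet_Iic
  refine ⟨Set.Iic s, fun _ => a, a, measurableSet_Iic, Eventually.of_forall hle, fun N n _ => ?_,
    fun z => (ha.tendsto z).comp tendsto_snd, ha.measurable, ha01, ?_⟩
  · beta_reduce
    rw [hle, hamask]
    have := (hκ (y N n)).markov i
    constructor
    · intro h
      exact (hx N n i).1.trans (measureReal_mono (Set.Iic_subset_Iic.2 h))
    · intro h
      exact (hx N n i).2 h
  · rintro φ hφ ⟨c, hc⟩
    have ham := ha.measurable
    have hφm := hφ.measurable
    have int1 : Integrable (fun p : Y × Cube d => φ (p.1, maskLT Fin.val 0 i p.2) *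
        (Set.Iic s).indicator 1 (p.2 i)) (ρ ⊗ₘ K) := by
      refine Integrable.of_bound (C := c) (Measurable.aestronglyMeasurable (by fun_prop))
        (Eventually.of_forall fun p => ?_)
      rw [Real.norm_eq_abs, abs_mul]
      exact (mul_le_of_le_one_right (abs_nonneg _) (hindb _)).trans (hc _)
    have int2 : Integrable (fun p : Y × Cube d => φ (p.1, maskLT Fin.val 0 i p.2) *
        a (p.1, maskLT Fin.val 0 i p.2)) (ρ ⊗ₘ K) := by
      refine Integrable.of_bound (C := c) (Measurable.aestronglyMeasurable (by fun_prop))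
        (Eventually.of_forall fun p => ?_)
      rw [Real.norm_eq_abs, abs_mul, abs_of_nonneg (ha01 _).1]
      exact (mul_le_of_le_one_right (abs_nonneg _) (ha01 _).2).trans (hc _)
    rw [Measure.integral_compProd int1, Measure.integral_compProd int2]
    refine integral_congr_ae (Eventually.of_forall fun q => ?_)
    have := (hκ q).integral_mul_indicator i (ψ := fun w => φ (q, extendHead i w))
      (hφm.comp (measurable_const.prodMk (measurable_extendHead i))) (fun w => hc _)
      (measurableSet_Iic (a := s))
    simpa only [extendHead_head, hamask] using this

/-! ### Cells of the Hilbert curve -/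

theorem gridLabel_div_le {K : ℕ} (hK : 0 < K) {t : ℝ} (ht : 0 ≤ t) :
    (gridLabel K t : ℝ) / K ≤ t := by
  rcases Nat.eq_zero_or_pos (gridLabel K t) with h0 | h0
  · simpa [h0] using ht
  · by_contra hlt
    exact absurd ((gridLabel_lt_iff hK h0).2 (not_le.1 hlt).le) (lt_irrefl _)

theorem le_gridLabel_div {K : ℕ} (hK : 0 < K) {t : ℝ} : t ≤ ((gridLabel K t : ℝ) + 1) / K := by
  have := (gridLabel_lt_iff (t := t) hK (Nat.succ_pos _)).1 (Nat.lt_succ_self _)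
  exact_mod_cast this

section Hilbert

variable {d : ℕ} {H : ℝ → Fin d → ℝ} {h : Cube d → ℝ}

/-- The closed dyadic cube of `[0,1)^d` of side `2^(-m)` with lower corner `2^(-m) * c`. -/
def closedCell {d : ℕ} (m : ℕ) (c : Fin d → Fin (2 ^ m)) : Set (Cube d) :=
  {x | ∀ i, ((c i : ℕ) : ℝ) / 2 ^ m ≤ x i ∧ (x i : ℝ) ≤ (((c i : ℕ) : ℝ) + 1) / 2 ^ m}

/-- The open dyadic cube of side `2^(-m)` with lower corner `2^(-m) * c`. -/
def openCell {d : ℕ} (m : ℕ) (c : Fin d → Fin (2 ^ m)) : Set (Cube d) :=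
  {x | ∀ i, ((c i : ℕ) : ℝ) / 2 ^ m < x i ∧ (x i : ℝ) < (((c i : ℕ) : ℝ) + 1) / 2 ^ m}

theorem isOpen_openCell (m : ℕ) (c : Fin d → Fin (2 ^ m)) : IsOpen (openCell m c) := by
  have : openCell m c = ⋂ i, ({x | ((c i : ℕ) : ℝ) / 2 ^ m < x i} ∩
      {x | (x i : ℝ) < (((c i : ℕ) : ℝ) + 1) / 2 ^ m}) := by
    ext x
    simp [openCell]
  rw [this]
  exact isOpen_iInter_of_finite fun i =>
    (isOpen_lt (by fun_prop) (by fun_prop)).inter (isOpen_lt (by fun_prop) (by fun_prop))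

theorem eq_of_mem_openCell_of_mem_closedCell {m : ℕ} {c c' : Fin d → Fin (2 ^ m)} {x : Cube d}
    (hx : x ∈ openCell m c) (hx' : x ∈ closedCell m c') : c' = c := by
  funext i
  have h1 := hx i
  have h2 := hx' i
  have h3 : ((c i : ℕ) : ℝ) < ((c' i : ℕ) : ℝ) + 1 := by
    have := h1.1.trans_le h2.2
    rwa [div_lt_div_iff_of_pos_right (by positivity)] at this
  have h4 : ((c' i : ℕ) : ℝ) < ((c i : ℕ) : ℝ) + 1 := by
    have := h2.1.trans_lt h1.2
    rwa [div_lt_div_iff_of_pos_right (by positivity)] at this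
  have h3' : (c i : ℕ) < (c' i : ℕ) + 1 := by exact_mod_cast h3
  have h4' : (c' i : ℕ) < (c i : ℕ) + 1 := by exact_mod_cast h4
  exact Fin.ext (by omega)

/-- The boundaries of the dyadic cubes are Lebesgue-null. -/
theorem ae_exists_mem_openCell (m : ℕ) :
    ∀ᵐ x ∂(volume : Measure (Cube d)), ∃ c, x ∈ openCell m c := by
  have hne : ∀ᵐ x ∂(volume : Measure (Cube d)), ∀ i, ∀ j : Fin (2 ^ m),
      (x i : ℝ) ≠ ((j : ℕ) : ℝ) / 2 ^ m := by
    refine ae_all_iff.2 fun i => ae_all_iff.2 fun j => ?_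
    have hj : ((j : ℕ) : ℝ) / 2 ^ m ∈ Set.Ico (0 : ℝ) 1 :=
      ⟨by positivity, by
        rw [div_lt_one (by positivity)]
        exact_mod_cast j.isLt⟩
    have := Measure.pi_hyperplane (fun _ : Fin d => (volume : Measure UI)) i ⟨_, hj⟩
    filter_upwards [measure_eq_zero_iff_ae_notMem.1 this] with x hx h
    exact hx (Subtype.ext h)
  filter_upwards [hne] with x hx
  have hlt : ∀ i, ⌊(2 : ℝ) ^ m * x i⌋₊ < 2 ^ m := fun i => by
    rw [Nat.floor_lt (mul_nonneg (by positivity) (x i).2.1)]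
    push_cast
    exact mul_lt_of_lt_one_right (by positivity) (x i).2.2
  refine ⟨fun i => ⟨⌊(2 : ℝ) ^ m * x i⌋₊, hlt i⟩, fun i => ⟨lt_of_le_of_ne ?_ (hx i _).symm, ?_⟩⟩
  · rw [div_le_iff₀' (by positivity)]
    exact Nat.floor_le (mul_nonneg (by positivity) (x i).2.1)
  · rw [lt_div_iff₀' (by positivity)]
    exact Nat.lt_floor_add_one _

/-- A point whose image under the pseudo-inverse lies in the `k`-th interval of level `m` belongs
to the `k`-th cube of level `m`. -/
theorem exists_cell_equiv (hH : IsHilbertCurve H) (hh : IsPseudoInverse H h) (m : ℕ) :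
    ∃ cell : Fin (2 ^ (d * m)) ≃ (Fin d → Fin (2 ^ m)), ∀ (x : Cube d) (k : Fin (2 ^ (d * m))),
      gridLabel (2 ^ (d * m)) (h x) = k → x ∈ closedCell m (cell k) := by
  obtain ⟨cell, hcell, -⟩ := hH.exists_cell
  refine ⟨cell m, fun x k hk => ?_⟩
  have hmem : H (h x) ∈ H '' Set.Icc ((k : ℝ) / 2 ^ (d * m)) (((k : ℝ) + 1) / 2 ^ (d * m)) := by
    refine ⟨h x, ⟨?_, ?_⟩, rfl⟩
    · have := gridLabel_div_le (K := 2 ^ (d * m)) (by positivity) (hh x).1.1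
      rw [hk] at this
      exact_mod_cast this
    · have := le_gridLabel_div (K := 2 ^ (d * m)) (t := h x) (by positivity)
      rw [hk] at this
      exact_mod_cast this
  rw [hcell, (hh x).2] at hmem
  exact hmem

/-- Points in the same interval of the Hilbert order lie in a common dyadic cube. -/
theorem dist_le_of_gridLabel_eq (hH : IsHilbertCurve H) (hh : IsPseudoInverse H h) (m : ℕ)
    {x y : Cube d} (hxy : gridLabel (2 ^ (d * m)) (h x) = gridLabel (2 ^ (d * m)) (h y)) :
    dist x y ≤ 1 / 2 ^ m := by
  obtain ⟨cell, hcell⟩ := exists_cell_equiv hH hh m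
  have hlt := gridLabel_lt (K := 2 ^ (d * m)) (by positivity) (hh x).1.2
  have hx := hcell x ⟨_, hlt⟩ rfl
  have hy := hcell y ⟨_, hlt⟩ hxy.symm
  refine (dist_pi_le_iff (by positivity)).2 fun i => ?_
  have h1 := hx i
  have h2 := hy i
  rw [add_div] at h1 h2
  rw [Subtype.dist_eq, Real.dist_eq, abs_le]
  constructor <;> linarith [h1.1, h1.2, h2.1, h2.2]

theorem gridLabel_eq_of_mem_openCell (hH : IsHilbertCurve H) (hh : IsPseudoInverse H h) (m : ℕ) :
    ∃ lab : (Fin d → Fin (2 ^ m)) → ℕ, ∀ c, ∀ x ∈ openCell m c,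
      gridLabel (2 ^ (d * m)) (h x) = lab c := by
  obtain ⟨cell, hcell⟩ := exists_cell_equiv hH hh m
  refine ⟨fun c => cell.symm c, fun c x hx => ?_⟩
  have hlt := gridLabel_lt (K := 2 ^ (d * m)) (by positivity) (hh x).1.2
  have := eq_of_mem_openCell_of_mem_closedCell hx (hcell x ⟨_, hlt⟩ rfl)
  simp [← this]

/-- The position of a point along the Hilbert curve is, up to the resolution of a dyadic grid,
locally constant near almost every point. -/
theorem ae_eventually_gridLabel_eq (hH : IsHilbertCurve H) (hh : IsPseudoInverse H h) (m : ℕ) :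
    ∀ᵐ x ∂(volume : Measure (Cube d)), ∀ᶠ x' in 𝓝 x,
      gridLabel (2 ^ (d * m)) (h x') = gridLabel (2 ^ (d * m)) (h x) := by
  obtain ⟨lab, hlab⟩ := gridLabel_eq_of_mem_openCell hH hh m
  filter_upwards [ae_exists_mem_openCell m] with x hx
  obtain ⟨c, hc⟩ := hx
  filter_upwards [(isOpen_openCell m c).mem_nhds hc] with x' hx'
  rw [hlab c x' hx', hlab c x hc]

theorem aemeasurable_gridLabel (hH : IsHilbertCurve H) (hh : IsPseudoInverse H h) (m : ℕ) :
    AEMeasurable (fun x => gridLabel (2 ^ (d * m)) (h x)) (volume : Measure (Cube d)) := by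
  classical
  obtain ⟨lab, hlab⟩ := gridLabel_eq_of_mem_openCell hH hh m
  refine ⟨fun x => ∑ c, (openCell m c).indicator (fun _ => lab c) x,
    Finset.measurable_sum _ fun c _ =>
      measurable_const.indicator (isOpen_openCell m c).measurableSet, ?_⟩
  filter_upwards [ae_exists_mem_openCell m] with x hx
  obtain ⟨c, hc⟩ := hx
  rw [hlab c x hc, Finset.sum_eq_single c]
  · rw [Set.indicator_of_mem hc]
  · intro c' _ hne
    refine Set.indicator_of_notMem (fun hc' => hne ?_) _
    exact eq_of_mem_openCell_of_mem_closedCell hc fun i => ⟨(hc' i).1.le, (hc' i).2.le⟩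
  · simp

end Hilbert

/-! ### Resampling along the Hilbert curve -/

/-- The inverse of a discrete CDF selects an index below a given level of the ordering exactly when
the input does not exceed the total weight below that level. The input must be positive: the input
zero selects the first index, even if the weight below the level is zero. -/
theorem IsInvDiscreteCDF.le_iff {N : ℕ} {w q : Fin N → ℝ} (hw : ∀ k, 0 ≤ w k) (hq : Monotone q)
    {u : ℝ} (hu : 0 < u) {b : Fin N} (hb : IsInvDiscreteCDF w u b) (s : ℝ) :
    q b ≤ s ↔ u ≤ ∑ k, w k * {t | t ≤ s}.indicator 1 (q k) := by
  classical
  have hsum : ∑ k, w k * {t | t ≤ s}.indicator 1 (q k) =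
      ∑ k ∈ Finset.univ.filter (fun k => q k ≤ s), w k := by
    rw [Finset.sum_filter]
    refine Finset.sum_congr rfl fun k _ => ?_
    by_cases hk : q k ≤ s <;> simp [hk]
  rw [hsum]
  constructor
  · intro h
    refine (show u ≤ _ from hb.1).trans (Finset.sum_le_sum_of_subset_of_nonneg ?_ fun k _ _ => hw k)
    intro k hk
    simpa using (hq (Finset.mem_Iic.1 hk)).trans h
  · intro h
    have hne : (Finset.univ.filter (fun k => q k ≤ s)).Nonempty := by
      by_contra hne
      rw [Finset.not_nonempty_iff_eq_empty] at hne
      rw [hne, Finset.sum_empty] at h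
      exact absurd h (not_le.2 hu)
    have hmax := Finset.max'_mem _ hne
    have hmem : u ≤ ∑ k ∈ Finset.Iic (Finset.max' _ hne), w k :=
      h.trans (Finset.sum_le_sum_of_subset_of_nonneg
        (fun k hk => Finset.mem_Iic.2 (Finset.le_max' _ k hk)) fun k _ _ => hw k)
    exact (hq (hb.2 hmem)).trans (Finset.mem_filter.1 hmax).2

section Resampling

variable {d : ℕ} {H : ℝ → Fin d → ℝ} {h : Cube d → ℝ} {Z : Type} [PseudoMetricSpace Z]
  [MeasurableSpace Z]

/-- The weights `w k`, tilted by `g` and normalised. -/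
noncomputable def tilted {N : ℕ} (w : Fin N → ℝ) (p : Fin N → Cube d) (g : Cube d × Z → ℝ) (z : Z)
    (k : Fin N) : ℝ :=
  w k * g (p k, z) / ∑ j, w j * g (p j, z)

/-- Let weighted points `p` converge weakly to `Q`. Selecting, with the inverse of the discrete CDF
in Hilbert order, one of these points with tilted weights amounts to comparing the input with a
threshold which converges continuously to the probability of the corresponding part of the
Hilbert curve under the tilted measure. -/
theorem exists_threshold [BorelSpace Z] [SecondCountableTopology Z] (hH : IsHilbertCurve H)
    (hh : IsPseudoInverse H h)
    {w : ∀ N : ℕ, Fin N → ℝ} (hw : ∀ N n, 0 ≤ w N n) {p : ∀ N : ℕ, Fin N → Cube d}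
    {Q : Measure (Cube d)} [IsProbabilityMeasure Q] (hQ : Q ≪ volume) (hp : WConv w p Q)
    {g : Cube d × Z → ℝ} (hg : Continuous g) {c : ℝ} (hgc : ∀ q, 0 ≤ g q ∧ g q ≤ c)
    (hg1 : ∀ z, ∫ y, g (y, z) ∂Q = 1) (m : ℕ) {k : ℕ} (hk : 0 < k) :
    ∃ (C : Set (Cube d)) (aN : ℕ → Z → ℝ) (a : Z → ℝ), MeasurableSet C ∧
      (∀ᵐ y ∂Q, h y ≤ (k : ℝ) / (2 ^ (d * m) : ℕ) ↔ y ∈ C) ∧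
      (∀ (N : ℕ) (σ : Equiv.Perm (Fin N)), (Monotone fun n => h (p N (σ n))) →
        ∀ (z : Z) (u : ℝ) (b : Fin N), 0 < u →
          IsInvDiscreteCDF (fun n => tilted (w N) (p N) g z (σ n)) u b →
          (h (p N (σ b)) ≤ (k : ℝ) / (2 ^ (d * m) : ℕ) ↔ u ≤ aN N z)) ∧
      (∀ z, Tendsto (fun q : ℕ × Z => aN q.1 q.2) (atTop ×ˢ 𝓝 z) (𝓝 (a z))) ∧
      Measurable a ∧ (∀ z, 0 ≤ a z ∧ a z ≤ 1) ∧
      ∀ z, a z = ∫ y, C.indicator 1 y * g (y, z) ∂Q := by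
  have hK : 0 < 2 ^ (d * m) := by positivity
  set s : ℝ := (k : ℝ) / (2 ^ (d * m) : ℕ) with hs
  have hlab : ∀ y, h y ≤ s ↔ gridLabel (2 ^ (d * m)) (h y) < k := fun y =>
    (gridLabel_lt_iff hK hk).symm
  have hae := (aemeasurable_gridLabel hH hh m).mono_ac hQ
  -- `h` itself need not be measurable
  let C : Set (Cube d) := hae.mk _ ⁻¹' Set.Iio k
  have hC : MeasurableSet C := hae.measurable_mk measurableSet_Iio
  have hhC : ∀ᵐ y ∂Q, h y ≤ s ↔ y ∈ C := by
    filter_upwards [hae.ae_eq_mk] with y hy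
    rw [hlab, hy]
    rfl
  have hCm : Measurable (C.indicator (1 : Cube d → ℝ)) := measurable_one.indicator hC
  have hC01 : ∀ y, 0 ≤ C.indicator (1 : Cube d → ℝ) y ∧ C.indicator (1 : Cube d → ℝ) y ≤ 1 :=
    fun y => by by_cases hy : y ∈ C <;> simp [hy]
  let ind : Cube d → ℝ := fun y => {t | t ≤ s}.indicator 1 (h y)
  have hind01 : ∀ y, 0 ≤ ind y ∧ ind y ≤ 1 := fun y => by
    by_cases hy : h y ≤ s <;> simp [ind, hy]
  have hindC : ∀ᵐ y ∂Q, ind y = C.indicator 1 y := by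
    filter_upwards [hhC] with y hy
    by_cases hyC : y ∈ C
    · simp [ind, hyC, hy.2 hyC]
    · have hys : ¬ h y ≤ s := fun h' => hyC (hy.1 h')
      simp [ind, hyC, hys]
  have hgm := hg.measurable
  have hgi : ∀ z, Integrable (fun y => g (y, z)) Q := fun z =>
    Integrable.of_bound (C := c) (Measurable.aestronglyMeasurable (by fun_prop))
      (Eventually.of_forall fun y => by
        rw [Real.norm_of_nonneg (hgc _).1]; exact (hgc _).2)
  -- `aN N z` is the total tilted weight of the points of `{h ≤ s}`
  let a : Z → ℝ := fun z => ∫ y, C.indicator 1 y * g (y, z) ∂Q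
  let aN : ℕ → Z → ℝ := fun N z => ∑ n, tilted (w N) (p N) g z n * ind (p N n)
  have hgabs : ∀ q, |g q| ≤ c := fun q => by rw [abs_of_nonneg (hgc q).1]; exact (hgc q).2
  refine ⟨C, aN, a, hC, hhC, ?_, fun z => ?_, ?_, fun z => ⟨?_, ?_⟩, fun z => rfl⟩
  · intro N σ hσ z u b hu hb
    have hnn : ∀ n, 0 ≤ tilted (w N) (p N) g z n := fun n =>
      div_nonneg (mul_nonneg (hw N n) (hgc _).1)
        (Finset.sum_nonneg fun j _ => mul_nonneg (hw N j) (hgc _).1)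
    rw [IsInvDiscreteCDF.le_iff (fun n => hnn (σ n)) hσ hu hb s]
    have := Equiv.sum_comp σ fun n => tilted (w N) (p N) g z n * ind (p N n)
    simp only [aN, ← this]
    rfl
  · have hA : Tendsto (fun q : ℕ × Z => ∑ n, w q.1 n * (g (p q.1 n, q.2) * ind (p q.1 n)))
        (atTop ×ˢ 𝓝 z) (𝓝 (a z)) := by
      rw [show a z = ∫ y, g (y, z) * ind y ∂Q from integral_congr_ae (by
        filter_upwards [hindC] with y hy
        rw [hy, mul_comm])]
      refine hp.tendsto_sum hw (φ := Prod.fst) tendsto_fst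
        (F := fun q y => g (y, q.2) * ind y) (C := c) (fun q y => ?_) ?_
      · rw [abs_mul, abs_of_nonneg (hind01 y).1]
        exact (mul_le_of_le_one_right (abs_nonneg _) (hind01 y).2).trans (hgabs _)
      · filter_upwards [hQ.ae_le (ae_eventually_gridLabel_eq hH hh m)] with y hy
        have t1 : Tendsto (fun q : (ℕ × Z) × Cube d => g (q.2, q.1.2))
            ((atTop ×ˢ 𝓝 z) ×ˢ 𝓝 y) (𝓝 (g (y, z))) := by
          refine (hg.tendsto (y, z)).comp ?_
          rw [nhds_prod_eq]
          exact tendsto_snd.prodMk (tendsto_snd.comp tendsto_fst)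
        refine t1.mul (tendsto_const_nhds.congr' ?_)
        filter_upwards [tendsto_snd.eventually hy] with q hq
        simp only [ind, Set.indicator, Set.mem_ofPred_eq, hlab, hq]
        rfl
    have hB : Tendsto (fun q : ℕ × Z => ∑ n, w q.1 n * g (p q.1 n, q.2))
        (atTop ×ˢ 𝓝 z) (𝓝 1) := by
      rw [← hg1 z]
      refine hp.tendsto_sum hw (φ := Prod.fst) tendsto_fst
        (F := fun q y => g (y, q.2)) (C := c) (fun q y => hgabs _) ?_
      refine Eventually.of_forall fun y => (hg.tendsto (y, z)).comp ?_
      rw [nhds_prod_eq]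
      exact tendsto_snd.prodMk (tendsto_snd.comp tendsto_fst)
    have := hA.div hB one_ne_zero
    rw [div_one] at this
    refine this.congr fun q => ?_
    simp only [aN, tilted, Finset.sum_div, Pi.div_apply]
    refine Finset.sum_congr rfl fun n _ => ?_
    ring
  · exact (StronglyMeasurable.integral_prod_left (f := fun y z => C.indicator 1 y * g (y, z))
      (Measurable.stronglyMeasurable (by fun_prop))).measurable
  · exact integral_nonneg fun y => mul_nonneg (hC01 y).1 (hgc _).1
  · rw [← hg1 z]
    refine integral_mono_of_nonneg (Eventually.of_forall fun y =>
      mul_nonneg (hC01 y).1 (hgc _).1) (hgi z) (Eventually.of_forall fun y => ?_)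
    exact mul_le_of_le_one_left (hgc _).1 (hC01 y).2

/-- Under the tilted measure `g(y, z) Q(dy) ρ(dz)`, the conditional probability of `C` given `z` is
`∫ 1_C(y) g(y, z) Q(dy)`. -/
theorem integral_withDensity_mul_indicator {X Z : Type} [MeasurableSpace X] [MeasurableSpace Z]
    {Q : Measure X} [IsProbabilityMeasure Q] {ρ : Measure Z} [IsProbabilityMeasure ρ] {g : X × Z → ℝ}
    (hg : Measurable g) {c : ℝ} (hgc : ∀ q, 0 ≤ g q ∧ g q ≤ c) (hg1 : ∀ z, ∫ y, g (y, z) ∂Q = 1)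
    {C : Set X} (hC : MeasurableSet C) {φ : Z → ℝ} (hφ : Measurable φ) {b : ℝ}
    (hb : ∀ z, |φ z| ≤ b) :
    ∫ q, φ q.2 * C.indicator 1 q.1
        ∂(Q.prod ρ).withDensity (fun q => ENNReal.ofReal (g q)) =
      ∫ q, φ q.2 * ∫ y, C.indicator 1 y * g (y, q.2) ∂Q
        ∂(Q.prod ρ).withDensity (fun q => ENNReal.ofReal (g q)) := by
  have hCm : Measurable (C.indicator (1 : X → ℝ)) := measurable_one.indicator hC
  have hC01 : ∀ y, 0 ≤ C.indicator (1 : X → ℝ) y ∧ C.indicator (1 : X → ℝ) y ≤ 1 :=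
    fun y => by by_cases hy : y ∈ C <;> simp [hy]
  have ham : Measurable fun z => ∫ y, C.indicator 1 y * g (y, z) ∂Q :=
    (StronglyMeasurable.integral_prod_left (f := fun y z => C.indicator 1 y * g (y, z))
      (Measurable.stronglyMeasurable (by fun_prop))).measurable
  have hgi : ∀ z, Integrable (fun y => g (y, z)) Q := fun z =>
    Integrable.of_bound (C := c) (Measurable.aestronglyMeasurable (by fun_prop))
      (Eventually.of_forall fun y => by
        rw [Real.norm_of_nonneg (hgc _).1]; exact (hgc _).2)
  have ha1 : ∀ z, |∫ y, C.indicator 1 y * g (y, z) ∂Q| ≤ 1 := fun z => by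
    rw [abs_of_nonneg (integral_nonneg fun y => mul_nonneg (hC01 y).1 (hgc _).1), ← hg1 z]
    refine integral_mono_of_nonneg (Eventually.of_forall fun y =>
      mul_nonneg (hC01 y).1 (hgc _).1) (hgi z) (Eventually.of_forall fun y => ?_)
    exact mul_le_of_le_one_left (hgc _).1 (hC01 y).2
  have hb0 : ∀ z : Z, 0 ≤ b := fun z => (abs_nonneg _).trans (hb z)
  rw [integral_withDensity_eq_integral_toReal_smul (by fun_prop) (by simp),
    integral_withDensity_eq_integral_toReal_smul (by fun_prop) (by simp)]
  simp only [ENNReal.toReal_ofReal (hgc _).1, smul_eq_mul]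
  rw [integral_prod_symm, integral_prod_symm]
  · refine integral_congr_ae (Eventually.of_forall fun z => ?_)
    simp only
    rw [integral_mul_const, hg1, one_mul, ← integral_const_mul]
    refine integral_congr_ae (Eventually.of_forall fun y => ?_)
    simp only
    ring
  · refine Integrable.of_bound (C := c * (b * 1)) (hg.mul ((hφ.comp measurable_snd).mul
      (ham.comp measurable_snd))).aestronglyMeasurable
      (Eventually.of_forall fun q => ?_)
    rw [norm_mul, norm_mul, Real.norm_of_nonneg (hgc _).1]
    exact mul_le_mul (hgc _).2 (mul_le_mul (hb _) (ha1 _) (norm_nonneg _) (hb0 q.2))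
      (by positivity) ((hgc q).1.trans (hgc q).2)
  · refine Integrable.of_bound (C := c * (b * 1)) (Measurable.aestronglyMeasurable (by fun_prop))
      (Eventually.of_forall fun q => ?_)
    rw [norm_mul, norm_mul, Real.norm_of_nonneg (hgc _).1]
    refine mul_le_mul (hgc _).2 (mul_le_mul (hb _) ?_ (norm_nonneg _) (hb0 q.2))
      (by positivity) ((hgc q).1.trans (hgc q).2)
    rw [Real.norm_of_nonneg (hC01 _).1]
    exact (hC01 _).2

end Resampling

/-! ### Path measures of Feynman-Kac models -/

namespace FeynmanKac

variable {d : ℕ} (M : FeynmanKac d)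

attribute [instance] FeynmanKac.isProbabilityMeasure_m0

/-- The unnormalised path measure, whose total mass is `Z t`. -/
noncomputable def pathMeasure (t : ℕ) : Measure (Fin (t + 1) → Cube d) :=
  (M.chainLaw t).withDensity fun x => ENNReal.ofReal (M.pathPotential t x)

/-- The product `m_t G_t` of the transition density and the potential. -/
def mG (t : ℕ) (q : Cube d × Cube d) : ℝ := M.m t q.1 q.2 * M.G t q.1 q.2

theorem measurable_mG {t : ℕ} (ht : 1 ≤ t) : Measurable (M.mG t) :=
  (M.measurable_m t ht).mul (M.measurable_G t ht)

theorem mG_nonneg {t : ℕ} (ht : 1 ≤ t) (q : Cube d × Cube d) : 0 ≤ M.mG t q :=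
  mul_nonneg (M.m_pos t ht _ _).le (M.G_nonneg t ht _ _)

theorem Z_eq (t : ℕ) : M.Z t = M.pathMeasure t Set.univ := by
  rw [pathMeasure, withDensity_apply _ MeasurableSet.univ, Measure.restrict_univ, Z]

theorem smoothing_eq (t : ℕ) : M.smoothing t = (M.Z t)⁻¹ • M.pathMeasure t := rfl

/-- The density of the path measure with respect to the product measure. -/
def pathDensity (t : ℕ) (x : Fin (t + 1) → Cube d) : ℝ :=
  (∏ s : Fin t, M.m (s + 1) (x s.castSucc) (x s.succ)) * M.pathPotential t x

theorem measurable_pathPotential (t : ℕ) : Measurable (M.pathPotential t) := by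
  refine (M.measurable_G0.comp (measurable_pi_apply 0)).mul
    (Finset.measurable_prod _ fun s _ => ?_)
  exact (M.measurable_G (s + 1) (Nat.le_add_left _ _)).comp
    (f := fun x : Fin (t + 1) → Cube d => (x s.castSucc, x s.succ))
    ((measurable_pi_apply s.castSucc).prodMk (measurable_pi_apply s.succ))

theorem measurable_prod_m (t : ℕ) : Measurable fun x : Fin (t + 1) → Cube d =>
    ∏ s : Fin t, M.m (s + 1) (x s.castSucc) (x s.succ) :=
  Finset.measurable_prod _ fun s _ => (M.measurable_m (s + 1) (Nat.le_add_left _ _)).comp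
    (f := fun x : Fin (t + 1) → Cube d => (x s.castSucc, x s.succ))
    ((measurable_pi_apply s.castSucc).prodMk (measurable_pi_apply s.succ))

theorem prod_m_nonneg (t : ℕ) (x : Fin (t + 1) → Cube d) :
    0 ≤ ∏ s : Fin t, M.m (s + 1) (x s.castSucc) (x s.succ) :=
  Finset.prod_nonneg fun _ _ => (M.m_pos _ (Nat.le_add_left _ _) _ _).le

theorem pathDensity_nonneg (t : ℕ) (x : Fin (t + 1) → Cube d) : 0 ≤ M.pathDensity t x :=
  mul_nonneg (M.prod_m_nonneg t x) (mul_nonneg (M.G0_nonneg _)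
    (Finset.prod_nonneg fun _ _ => M.G_nonneg _ (Nat.le_add_left _ _) _ _))

theorem measurable_pathDensity (t : ℕ) : Measurable (M.pathDensity t) :=
  (M.measurable_prod_m t).mul (M.measurable_pathPotential t)

instance sigmaFinite_ite (n : ℕ) (i : Fin (n + 1)) :
    SigmaFinite (if i = 0 then M.m0 else (volume : Measure (Cube d))) := by
  split_ifs <;> infer_instance

theorem lintegral_pathMeasure (t : ℕ) {F : (Fin (t + 1) → Cube d) → ℝ≥0∞} (hF : Measurable F) :
    ∫⁻ x, F x ∂M.pathMeasure t = ∫⁻ x, ENNReal.ofReal (M.pathDensity t x) * F x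
      ∂Measure.pi fun i : Fin (t + 1) => if i = 0 then M.m0 else volume := by
  have h1 := (M.measurable_pathPotential t).ennreal_ofReal
  have h2 := (M.measurable_prod_m t).ennreal_ofReal
  rw [pathMeasure, lintegral_withDensity_eq_lintegral_mul _ h1 hF, chainLaw,
    lintegral_withDensity_eq_lintegral_mul _ h2 (h1.mul hF)]
  refine lintegral_congr fun x => ?_
  simp only [Pi.mul_apply, pathDensity]
  rw [ENNReal.ofReal_mul (M.prod_m_nonneg t x), mul_assoc]

theorem measurable_snoc (t : ℕ) : Measurable fun p : (Fin t → Cube d) × Cube d =>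
    (Fin.snoc (α := fun _ => Cube d) p.1 p.2 : Fin (t + 1) → Cube d) := by
  refine measurable_pi_lambda _ fun i => ?_
  refine Fin.lastCases ?_ (fun j => ?_) i
  · simpa using measurable_snd
  · simp only [Fin.snoc_castSucc]
    exact (measurable_pi_apply j).comp measurable_fst

theorem pathDensity_snoc (t : ℕ) (x : Fin (t + 1) → Cube d) (y : Cube d) :
    M.pathDensity (t + 1) (Fin.snoc (α := fun _ => Cube d) x y) =
      M.pathDensity t x * M.mG (t + 1) (x (Fin.last t), y) := by
  have h0 : (Fin.snoc (α := fun _ => Cube d) x y : Fin (t + 2) → Cube d) 0 = x 0 := by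
    rw [← Fin.castSucc_zero, Fin.snoc_castSucc]
  simp only [pathDensity, pathPotential, Fin.prod_univ_castSucc, h0, Fin.succ_castSucc,
    Fin.snoc_castSucc, Fin.succ_last, Fin.snoc_last, mG, Fin.val_castSucc, Fin.val_last]
  ring

/-- The path measure at time `t + 1` extends the one at time `t` by one step. -/
theorem lintegral_pathMeasure_succ (t : ℕ) {F : (Fin (t + 2) → Cube d) → ℝ≥0∞}
    (hF : Measurable F) :
    ∫⁻ x, F x ∂M.pathMeasure (t + 1) = ∫⁻ x, (∫⁻ y,
      ENNReal.ofReal (M.mG (t + 1) (x (Fin.last t), y)) *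
        F (Fin.snoc (α := fun _ => Cube d) x y)) ∂M.pathMeasure t := by
  have hs := measurable_snoc (d := d) (t + 1)
  have hg := M.measurable_mG (t := t + 1) (Nat.le_add_left _ _)
  have hD := M.measurable_pathDensity t
  have hD' := M.measurable_pathDensity (t + 1)
  have hinner : Measurable fun x : Fin (t + 1) → Cube d => ∫⁻ y,
      ENNReal.ofReal (M.mG (t + 1) (x (Fin.last t), y)) *
        F (Fin.snoc (α := fun _ => Cube d) x y) :=
    Measurable.lintegral_prod_right' (f := fun q : (Fin (t + 1) → Cube d) × Cube d =>
      ENNReal.ofReal (M.mG (t + 1) (q.1 (Fin.last t), q.2)) *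
        F (Fin.snoc (α := fun _ => Cube d) q.1 q.2)) (by fun_prop)
  rw [M.lintegral_pathMeasure (t + 1) hF, M.lintegral_pathMeasure t hinner]
  have hmp := (measurePreserving_piFinSuccAbove (α := fun _ => Cube d)
    (fun i : Fin (t + 2) => if i = 0 then M.m0 else volume) (Fin.last (t + 1))).symm
  rw [hmp.lintegral_map_equiv]
  have e1 : (fun j : Fin (t + 1) => if (Fin.last (t + 1)).succAbove j = 0 then M.m0 else
      (volume : Measure (Cube d))) = fun j => if j = 0 then M.m0 else volume := by
    funext j
    rw [Fin.succAbove_last]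
    refine if_congr ?_ rfl rfl
    exact Fin.castSucc_eq_zero_iff
  have e2 : (if Fin.last (t + 1) = 0 then M.m0 else (volume : Measure (Cube d))) = volume :=
    if_neg (Fin.last_pos).ne'
  rw [e1, e2]
  have e3 : ∀ q : Cube d × (Fin (t + 1) → Cube d),
      (MeasurableEquiv.piFinSuccAbove (fun _ => Cube d) (Fin.last (t + 1))).symm q =
        Fin.snoc (α := fun _ => Cube d) q.2 q.1 := fun q => Fin.insertNth_last' _ _
  simp only [e3]
  rw [lintegral_prod_symm _ (Measurable.aemeasurable (by fun_prop))]
  refine lintegral_congr fun x => ?_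
  rw [← lintegral_const_mul _ (by fun_prop)]
  refine lintegral_congr fun y => ?_
  rw [pathDensity_snoc, ENNReal.ofReal_mul (M.pathDensity_nonneg t x), mul_assoc]

theorem lintegral_pathMeasure_zero {F : (Fin 1 → Cube d) → ℝ≥0∞} (hF : Measurable F) :
    ∫⁻ x, F x ∂M.pathMeasure 0 = ∫⁻ x, ENNReal.ofReal (M.G0 x) * F (fun _ => x) ∂M.m0 := by
  have h0 := M.measurable_G0
  rw [M.lintegral_pathMeasure 0 hF]
  have hmp := (measurePreserving_piUnique (X := fun _ : Fin 1 => Cube d)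
    (fun i : Fin 1 => if i = 0 then M.m0 else volume)).symm
  rw [hmp.lintegral_map_equiv]
  have e : (if (default : Fin 1) = 0 then M.m0 else (volume : Measure (Cube d))) = M.m0 :=
    if_pos rfl
  rw [e]
  refine lintegral_congr fun x => ?_
  have e3 : (MeasurableEquiv.piUnique (fun _ : Fin 1 => Cube d)).symm x = fun _ => x := by
    funext i
    rw [Subsingleton.elim i default]
    rfl
  rw [e3]
  simp [pathDensity, pathPotential]

/-! ### Filtering distributions -/

section Filtering

variable {M} {t : ℕ}

/-- If `Z t` were zero or infinite, the smoothing distribution, and with it the filtering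
distribution, would be the zero measure. -/
theorem Z_ne_zero (h : M.filtering t ≠ 0) : M.Z t ≠ 0 := fun h0 => by
  have : M.pathMeasure t = 0 := by rw [← Measure.measure_univ_eq_zero, ← Z_eq, h0]
  exact h (by rw [filtering, smoothing_eq, this, smul_zero, Measure.map_zero])

theorem Z_ne_top (h : M.filtering t ≠ 0) : M.Z t ≠ ∞ := fun h0 =>
  h (by rw [filtering, smoothing_eq, h0, ENNReal.inv_top, zero_smul, Measure.map_zero])

theorem isProbabilityMeasure_smoothing (h : M.filtering t ≠ 0) :
    IsProbabilityMeasure (M.smoothing t) := by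
  constructor
  rw [smoothing_eq, Measure.smul_apply, ← Z_eq, smul_eq_mul,
    ENNReal.inv_mul_cancel (Z_ne_zero h) (Z_ne_top h)]

theorem isProbabilityMeasure_filtering (h : M.filtering t ≠ 0) :
    IsProbabilityMeasure (M.filtering t) := by
  have := isProbabilityMeasure_smoothing h
  exact Measure.isProbabilityMeasure_map (measurable_pi_apply _).aemeasurable

theorem pathMeasure_eq (h : M.filtering t ≠ 0) : M.pathMeasure t = M.Z t • M.smoothing t := by
  rw [smoothing_eq, smul_smul, ENNReal.mul_inv_cancel (Z_ne_zero h) (Z_ne_top h), one_smul]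

theorem lintegral_last_pathMeasure (h : M.filtering t ≠ 0) {F : Cube d → ℝ≥0∞}
    (hF : Measurable F) :
    ∫⁻ x, F (x (Fin.last t)) ∂M.pathMeasure t = M.Z t * ∫⁻ x, F x ∂M.filtering t := by
  rw [pathMeasure_eq h, lintegral_smul_measure, filtering,
    lintegral_map hF (measurable_pi_apply (Fin.last t)), smul_eq_mul]

/-- One step of the filtering recursion, in unnormalised form. -/
theorem lintegral_filtering_succ (h : M.filtering t ≠ 0) (h' : M.filtering (t + 1) ≠ 0)
    {F : Cube d → ℝ≥0∞} (hF : Measurable F) :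
    M.Z (t + 1) * ∫⁻ y, F y ∂M.filtering (t + 1) =
      M.Z t * ∫⁻ x, (∫⁻ y, ENNReal.ofReal (M.mG (t + 1) (x, y)) * F y) ∂M.filtering t := by
  have hg := M.measurable_mG (t := t + 1) (Nat.le_add_left _ _)
  have hin : Measurable fun x => ∫⁻ y, ENNReal.ofReal (M.mG (t + 1) (x, y)) * F y :=
    Measurable.lintegral_prod_right' (f := fun q : Cube d × Cube d =>
      ENNReal.ofReal (M.mG (t + 1) q) * F q.2) (by fun_prop)
  rw [← lintegral_last_pathMeasure h' hF, ← lintegral_last_pathMeasure h hin,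
    M.lintegral_pathMeasure_succ t (F := fun x => F (x (Fin.last (t + 1)))) (by fun_prop)]
  simp only [Fin.snoc_last]

/-- The Markov kernel of the transitions at time `t`. -/
noncomputable def transKernel (M : FeynmanKac d) (t : ℕ) : Kernel (Cube d) (Cube d) :=
  Kernel.withDensity (Kernel.const _ volume) fun x y => ENNReal.ofReal (M.m t x y)

theorem transKernel_apply (ht : 1 ≤ t) (x : Cube d) : M.transKernel t x = M.trans t x := by
  rw [transKernel, Kernel.withDensity_apply _ (M.measurable_m t ht).ennreal_ofReal,
    Kernel.const_apply, trans]

theorem isMarkovKernel_transKernel (ht : 1 ≤ t) : IsMarkovKernel (M.transKernel t) :=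
  ⟨fun x => ⟨by
    rw [transKernel_apply ht, trans, withDensity_apply _ MeasurableSet.univ,
      Measure.restrict_univ, M.lintegral_m t ht]⟩⟩

/-- The filtering recursion: mutation by the transition kernel, followed by reweighting with the
potential, turns `Q_t` into a multiple of `Q_{t+1}`. -/
theorem filtering_succ_eq_map (h : M.filtering t ≠ 0) (h' : M.filtering (t + 1) ≠ 0) :
    ((M.filtering t ⊗ₘ M.transKernel (t + 1)).withDensity
      fun q => ENNReal.ofReal (M.G (t + 1) q.1 q.2)).map Prod.snd =
      (M.Z (t + 1) / M.Z t) • M.filtering (t + 1) := by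
  have ht : 1 ≤ t + 1 := Nat.le_add_left _ _
  have := isProbabilityMeasure_filtering h
  have := isMarkovKernel_transKernel (M := M) ht
  have hG : Measurable fun q : Cube d × Cube d => ENNReal.ofReal (M.G (t + 1) q.1 q.2) :=
    (M.measurable_G (t + 1) ht).ennreal_ofReal
  have hm : Measurable fun q : Cube d × Cube d => ENNReal.ofReal (M.m (t + 1) q.1 q.2) :=
    (M.measurable_m (t + 1) ht).ennreal_ofReal
  refine Measure.ext_of_lintegral _ fun F hF => ?_
  rw [lintegral_map hF measurable_snd, lintegral_withDensity_eq_lintegral_mul _ hG (by fun_prop),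
    lintegral_smul_measure, smul_eq_mul, div_eq_mul_inv, mul_right_comm, mul_comm (M.Z (t + 1)),
    mul_comm _ (M.Z t)⁻¹, mul_comm _ (M.Z (t + 1)), lintegral_filtering_succ h h' hF, ← mul_assoc,
    ENNReal.inv_mul_cancel (Z_ne_zero h) (Z_ne_top h), one_mul,
    Measure.lintegral_compProd (by fun_prop)]
  refine lintegral_congr fun x => ?_
  have hm' : Measurable fun y => ENNReal.ofReal (M.m (t + 1) x y) :=
    hm.comp measurable_prodMk_left
  have hGF : Measurable fun y => ENNReal.ofReal (M.G (t + 1) x y) * F y :=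
    (hG.comp measurable_prodMk_left).mul hF
  rw [transKernel_apply ht, trans]
  change ∫⁻ y, ENNReal.ofReal (M.G (t + 1) x y) * F y ∂_ = _
  rw [lintegral_withDensity_eq_lintegral_mul _ hm' hGF]
  refine lintegral_congr fun y => ?_
  simp only [Pi.mul_apply, mG]
  rw [ENNReal.ofReal_mul (M.m_pos (t + 1) ht _ _).le, mul_assoc]

theorem integral_filtering_succ (h : M.filtering t ≠ 0) (h' : M.filtering (t + 1) ≠ 0)
    {f : Cube d → ℝ} (hf : Measurable f) :
    ∫ q, M.G (t + 1) q.1 q.2 * f q.2 ∂(M.filtering t ⊗ₘ M.transKernel (t + 1)) =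
      (M.Z (t + 1) / M.Z t).toReal * ∫ y, f y ∂M.filtering (t + 1) := by
  have ht : 1 ≤ t + 1 := Nat.le_add_left _ _
  have hG : Measurable fun q : Cube d × Cube d => ENNReal.ofReal (M.G (t + 1) q.1 q.2) :=
    (M.measurable_G (t + 1) ht).ennreal_ofReal
  rw [← smul_eq_mul, ← integral_smul_measure, ← filtering_succ_eq_map h h',
    integral_map measurable_snd.aemeasurable hf.aestronglyMeasurable,
    integral_withDensity_eq_integral_toReal_smul hG (by simp)]
  simp only [ENNReal.toReal_ofReal (M.G_nonneg (t + 1) ht _ _), smul_eq_mul]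

theorem integral_filtering_zero (h : M.filtering 0 ≠ 0) (f : Cube d → ℝ) :
    ∫ y, M.G0 y * f y ∂M.m0 = (M.Z 0).toReal * ∫ y, f y ∂M.filtering 0 := by
  have hG : Measurable fun y => ENNReal.ofReal (M.G0 y) := M.measurable_G0.ennreal_ofReal
  have key : M.m0.withDensity (fun y => ENNReal.ofReal (M.G0 y)) = M.Z 0 • M.filtering 0 := by
    refine Measure.ext_of_lintegral _ fun F hF => ?_
    rw [lintegral_withDensity_eq_lintegral_mul _ hG hF, lintegral_smul_measure, smul_eq_mul,
      ← lintegral_last_pathMeasure h hF,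
      M.lintegral_pathMeasure_zero (F := fun x => F (x (Fin.last 0))) (by fun_prop)]
    rfl
  rw [← smul_eq_mul, ← integral_smul_measure, ← key,
    integral_withDensity_eq_integral_toReal_smul hG (by simp)]
  simp only [ENNReal.toReal_ofReal (M.G0_nonneg _), smul_eq_mul]

end Filtering

end FeynmanKac

/-! ### Backward decomposition of the smoothing distribution -/

instance instIsOpenPosMeasureUI : (volume : Measure UI).IsOpenPosMeasure := by
  refine ⟨fun U hU hne h0 => ?_⟩
  obtain ⟨x, hx⟩ := hne
  obtain ⟨ε, hε, hball⟩ := Metric.isOpen_iff.1 hU x hx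
  have hsub : Set.Ico (x : ℝ) (min (x + ε) 1) ⊆ Subtype.val '' U := fun r hr => by
    refine ⟨⟨r, x.2.1.trans hr.1, hr.2.trans_le (min_le_right _ _)⟩, hball ?_, rfl⟩
    rw [Metric.mem_ball, Subtype.dist_eq, Real.dist_eq, abs_of_nonneg (sub_nonneg.2 hr.1)]
    have := hr.2.trans_le (min_le_left _ _)
    linarith
  rw [volume_UI_apply] at h0
  have h1 := measure_mono_null hsub h0
  rw [Real.volume_Ico, ENNReal.ofReal_eq_zero] at h1
  have h2 : (x : ℝ) < min (x + ε) 1 := lt_min (by linarith) x.2.2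
  linarith

namespace FeynmanKac

variable {d : ℕ} {M : FeynmanKac d} {t : ℕ}

/-- `G̃_{t+1}(·, y)` is a density with respect to `Q_t` for every `y`. The lower bound on `m G` makes
the normalising integral positive wherever it is finite, which is almost everywhere; the continuity
of `G̃` extends the identity to all `y`, including those where the integral might a priori be
infinite, so that its value in Lean, and that of `G̃`, would be zero. -/
theorem integral_Gtilde (h : M.filtering t ≠ 0) {c : ℝ} (hc : 0 < c)
    (hmG : ∀ q, c ≤ M.mG (t + 1) q) (hG_bdd : ∃ C, ∀ x' x, M.G (t + 1) x' x ≤ C)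
    (hcont : Continuous (Function.uncurry (M.Gtilde (t + 1) (M.filtering t))))
    (hbdd : ∃ C, ∀ x' x, M.Gtilde (t + 1) (M.filtering t) x' x ≤ C) (y : Cube d) :
    ∫ x, M.Gtilde (t + 1) (M.filtering t) x y ∂M.filtering t = 1 := by
  have ht : 1 ≤ t + 1 := Nat.le_add_left _ _
  have := isProbabilityMeasure_filtering h
  obtain ⟨C, hC⟩ := hG_bdd
  obtain ⟨B, hB⟩ := hbdd
  have hg := M.measurable_mG (t := t + 1) ht
  have hm := M.measurable_m (t + 1) ht
  have hnn : ∀ x y, 0 ≤ M.Gtilde (t + 1) (M.filtering t) x y := fun x y =>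
    div_nonneg (M.mG_nonneg ht (x, y)) (integral_nonneg fun x => M.mG_nonneg ht (x, y))
  -- `m G` is integrable in its first argument, for almost every value of the second one
  have hfin : ∫⁻ y, ∫⁻ x, ENNReal.ofReal (M.mG (t + 1) (x, y)) ∂M.filtering t < ∞ := by
    rw [lintegral_lintegral_swap (Measurable.aemeasurable (by fun_prop))]
    calc ∫⁻ x, (∫⁻ y, ENNReal.ofReal (M.mG (t + 1) (x, y))) ∂M.filtering t
        ≤ ∫⁻ _, ENNReal.ofReal C ∂M.filtering t := by
          refine lintegral_mono fun x => ?_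
          calc ∫⁻ y, ENNReal.ofReal (M.mG (t + 1) (x, y))
              ≤ ∫⁻ y, ENNReal.ofReal C * ENNReal.ofReal (M.m (t + 1) x y) := by
                refine lintegral_mono fun y => ?_
                rw [mG, mul_comm, ENNReal.ofReal_mul (M.G_nonneg _ ht _ _)]
                gcongr
                exact hC _ _
            _ = ENNReal.ofReal C := by
                rw [lintegral_const_mul' _ _ ENNReal.ofReal_ne_top, M.lintegral_m _ ht, mul_one]
      _ < ∞ := by simp
  have hae : ∀ᵐ y ∂(volume : Measure (Cube d)),
      ∫ x, M.Gtilde (t + 1) (M.filtering t) x y ∂M.filtering t = 1 := by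
    have hmeas : Measurable fun y => ∫⁻ x, ENNReal.ofReal (M.mG (t + 1) (x, y)) ∂M.filtering t :=
      Measurable.lintegral_prod_left' (f := fun q => ENNReal.ofReal (M.mG (t + 1) q)) (by fun_prop)
    filter_upwards [ae_lt_top hmeas hfin.ne] with y hy
    have hint : Integrable (fun x => M.mG (t + 1) (x, y)) (M.filtering t) := by
      refine ⟨Measurable.aestronglyMeasurable (by fun_prop), ?_⟩
      rwa [hasFiniteIntegral_iff_ofReal (Eventually.of_forall fun x => M.mG_nonneg ht _)]
    have hpos : c ≤ ∫ x, M.mG (t + 1) (x, y) ∂M.filtering t := by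
      have := integral_mono (integrable_const c) hint fun x => hmG _
      simpa using this
    have : ∫ x, M.Gtilde (t + 1) (M.filtering t) x y ∂M.filtering t =
        (∫ x, M.mG (t + 1) (x, y) ∂M.filtering t) / ∫ x, M.mG (t + 1) (x, y) ∂M.filtering t :=
      integral_div _ _
    rw [this, div_self (hc.trans_le hpos).ne']
  have hcts : Continuous fun y => ∫ x, M.Gtilde (t + 1) (M.filtering t) x y ∂M.filtering t := by
    refine continuous_of_dominated (bound := fun _ => B) (fun y => ?_)
      (fun y => Eventually.of_forall fun x => ?_) (integrable_const B)
      (Eventually.of_forall fun x => ?_)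
    · exact (hcont.comp (Continuous.prodMk_left y)).measurable.aestronglyMeasurable
    · rw [Real.norm_of_nonneg (hnn x y)]; exact hB x y
    · exact hcont.comp (Continuous.prodMk_right x)
  exact congrFun ((Continuous.ae_eq_iff_eq (μ := volume) hcts continuous_const).1 hae) y

theorem integral_mG_ne_zero
    (h1 : ∀ y, ∫ x, M.Gtilde (t + 1) (M.filtering t) x y ∂M.filtering t = 1)
    (y : Cube d) : ∫ x, M.mG (t + 1) (x, y) ∂M.filtering t ≠ 0 := by
  intro h0
  have := h1 y
  have e : ∀ x, M.Gtilde (t + 1) (M.filtering t) x y = 0 := fun x => by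
    have h0' : ∫ x, M.m (t + 1) x y * M.G (t + 1) x y ∂M.filtering t = 0 := h0
    rw [Gtilde, h0', div_zero]
  simp [e] at this

theorem lintegral_mG_mul_Gtilde
    (h1 : ∀ y, ∫ x, M.Gtilde (t + 1) (M.filtering t) x y ∂M.filtering t = 1)
    (x y : Cube d) :
    (∫⁻ x, ENNReal.ofReal (M.mG (t + 1) (x, y)) ∂M.filtering t) *
      ENNReal.ofReal (M.Gtilde (t + 1) (M.filtering t) x y) =
        ENNReal.ofReal (M.mG (t + 1) (x, y)) := by
  have ht : 1 ≤ t + 1 := Nat.le_add_left _ _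
  have hne := integral_mG_ne_zero h1 y
  have hint : Integrable (fun x => M.mG (t + 1) (x, y)) (M.filtering t) := by
    by_contra h
    exact hne (integral_undef h)
  rw [← ofReal_integral_eq_lintegral_ofReal hint (Eventually.of_forall fun x => M.mG_nonneg ht _),
    ← ENNReal.ofReal_mul (integral_nonneg fun x => M.mG_nonneg ht _)]
  congr 1
  exact mul_div_cancel₀ _ hne

/-- The coordinates of index larger than `t`; the others are replaced by zero. -/
def keepGT {d n : ℕ} (t : ℕ) (x : Fin n → Cube d) : Fin n → Cube d :=
  fun j => if t < j then x j else 0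

theorem measurable_keepGT {n : ℕ} (t : ℕ) : Measurable (keepGT t : (Fin n → Cube d) → _) :=
  measurable_pi_lambda _ fun j => by unfold keepGT; split_ifs <;> fun_prop

theorem keepGT_snoc_keepGT {n : ℕ} (t : ℕ) (x : Fin n → Cube d) (y : Cube d) :
    keepGT t (Fin.snoc (α := fun _ => Cube d) (keepGT t x) y : Fin (n + 1) → Cube d) =
      keepGT t (Fin.snoc (α := fun _ => Cube d) x y : Fin (n + 1) → Cube d) := by
  funext j
  refine Fin.lastCases ?_ (fun j => ?_) j
  · simp [keepGT]
  · simp only [keepGT, Fin.snoc_castSucc, Fin.val_castSucc]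
    split_ifs <;> rfl

/-- Backward Markov property of the path measure at time `T > t`: given the states after time `t`,
the state at time `t` is distributed according to the backward kernel. -/
theorem lintegral_pathMeasure_backward (h : M.filtering t ≠ 0)
    (hcont : Continuous (Function.uncurry (M.Gtilde (t + 1) (M.filtering t))))
    (h1 : ∀ y, ∫ x, M.Gtilde (t + 1) (M.filtering t) x y ∂M.filtering t = 1)
    {T : ℕ} (htT : t + 1 ≤ T) {F : Cube d × (Fin (T + 1) → Cube d) → ℝ≥0∞} (hF : Measurable F) :
    ∫⁻ x, F (x ⟨t, by omega⟩, keepGT t x) ∂M.pathMeasure T =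
      ∫⁻ x', ∫⁻ x, ENNReal.ofReal (M.Gtilde (t + 1) (M.filtering t) x (x' ⟨t + 1, by omega⟩)) *
        F (x, keepGT t x') ∂M.filtering t ∂M.pathMeasure T := by
  have := isProbabilityMeasure_filtering h
  have hGt := hcont.measurable
  have hGt' : Measurable fun q : Cube d × Cube d =>
    M.Gtilde (t + 1) (M.filtering t) q.1 q.2 := hGt
  induction T, htT using Nat.le_induction with
  | base =>
    have hg := M.measurable_mG (t := t + 1) (Nat.le_add_left _ _)
    have hk := measurable_keepGT (d := d) (n := t + 2) t
    have hs := measurable_snoc (d := d) (t + 1)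
    -- only the last coordinate is kept
    let e : Cube d → Fin (t + 2) → Cube d := fun y =>
      keepGT t (Fin.snoc (α := fun _ => Cube d) (0 : Fin (t + 1) → Cube d) y)
    have he : ∀ (x : Fin (t + 1) → Cube d) y,
        keepGT t (Fin.snoc (α := fun _ => Cube d) x y : Fin (t + 2) → Cube d) = e y := fun x y => by
      have h0 : ∀ x : Fin (t + 1) → Cube d, keepGT t x = 0 := fun x => by
        funext j
        have : ¬ t < (j : ℕ) := by omega
        simp [keepGT, this]
      simp only [e]
      rw [← keepGT_snoc_keepGT t x y, h0 x]
    have hem : Measurable e := hk.comp (hs.comp (measurable_const.prodMk measurable_id))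
    have c1 : ∀ (x : Fin (t + 1) → Cube d) y,
        (Fin.snoc (α := fun _ => Cube d) x y : Fin (t + 2) → Cube d) ⟨t, by omega⟩ =
          x (Fin.last t) := fun x y => Fin.snoc_castSucc (α := fun _ => Cube d) y x (Fin.last t)
    have c2 : ∀ (x : Fin (t + 1) → Cube d) y,
        (Fin.snoc (α := fun _ => Cube d) x y : Fin (t + 2) → Cube d) ⟨t + 1, by omega⟩ = y :=
      fun x y => Fin.snoc_last (α := fun _ => Cube d) y x
    have hB : Measurable fun y => ∫⁻ x, ENNReal.ofReal (M.Gtilde (t + 1) (M.filtering t) x y) *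
        F (x, e y) ∂M.filtering t :=
      Measurable.lintegral_prod_left' (f := fun q : Cube d × Cube d =>
        ENNReal.ofReal (M.Gtilde (t + 1) (M.filtering t) q.1 q.2) * F (q.1, e q.2)) (by fun_prop)
    have hA : Measurable fun a => ∫⁻ y, ENNReal.ofReal (M.mG (t + 1) (a, y)) * F (a, e y) :=
      Measurable.lintegral_prod_right' (f := fun q : Cube d × Cube d =>
        ENNReal.ofReal (M.mG (t + 1) q) * F (q.1, e q.2)) (by fun_prop)
    have hA' : Measurable fun a => ∫⁻ y, ENNReal.ofReal (M.mG (t + 1) (a, y)) *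
        ∫⁻ x, ENNReal.ofReal (M.Gtilde (t + 1) (M.filtering t) x y) * F (x, e y) ∂M.filtering t :=
      Measurable.lintegral_prod_right' (f := fun q : Cube d × Cube d =>
        ENNReal.ofReal (M.mG (t + 1) q) * ∫⁻ x, ENNReal.ofReal
          (M.Gtilde (t + 1) (M.filtering t) x q.2) * F (x, e q.2) ∂M.filtering t) (by fun_prop)
    have hR : Measurable fun x' : Fin (t + 2) → Cube d => ∫⁻ x,
        ENNReal.ofReal (M.Gtilde (t + 1) (M.filtering t) x (x' ⟨t + 1, by omega⟩)) *
          F (x, keepGT t x') ∂M.filtering t :=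
      Measurable.lintegral_prod_left' (f := fun q : Cube d × (Fin (t + 2) → Cube d) =>
        ENNReal.ofReal (M.Gtilde (t + 1) (M.filtering t) q.1 (q.2 ⟨t + 1, by omega⟩)) *
          F (q.1, keepGT t q.2)) (by fun_prop)
    rw [M.lintegral_pathMeasure_succ t (F := fun x => F (x ⟨t, by omega⟩, keepGT t x))
        (by fun_prop), M.lintegral_pathMeasure_succ t hR]
    simp only [c1, c2, he]
    rw [lintegral_last_pathMeasure h hA, lintegral_last_pathMeasure h hA']
    congr 1
    refine (lintegral_lintegral_swap (Measurable.aemeasurable (by fun_prop))).trans (Eq.trans ?_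
      (lintegral_lintegral_swap (Measurable.aemeasurable (by fun_prop))).symm)
    refine lintegral_congr fun y => ?_
    rw [lintegral_mul_const _ (by fun_prop), ← lintegral_const_mul _ (by fun_prop)]
    refine lintegral_congr fun x => ?_
    rw [← mul_assoc, lintegral_mG_mul_Gtilde h1]
  | succ T hT ih =>
    have hg := M.measurable_mG (t := T + 1) (Nat.le_add_left _ _)
    have hk := measurable_keepGT (d := d) (n := T + 2) t
    have hk' := measurable_keepGT (d := d) (n := T + 1) t
    have hs := measurable_snoc (d := d) (T + 1)
    have c1 : ∀ (x : Fin (T + 1) → Cube d) y,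
        (Fin.snoc (α := fun _ => Cube d) x y : Fin (T + 2) → Cube d) ⟨t, by omega⟩ =
          x ⟨t, by omega⟩ := fun x y =>
      Fin.snoc_castSucc (α := fun _ => Cube d) y x ⟨t, by omega⟩
    have c2 : ∀ (x : Fin (T + 1) → Cube d) y,
        (Fin.snoc (α := fun _ => Cube d) x y : Fin (T + 2) → Cube d) ⟨t + 1, by omega⟩ =
          x ⟨t + 1, by omega⟩ :=
      fun x y => Fin.snoc_castSucc (α := fun _ => Cube d) y x ⟨t + 1, by omega⟩
    have c3 : ∀ x : Fin (T + 1) → Cube d, keepGT t x (Fin.last T) = x (Fin.last T) := fun x =>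
      if_pos (by simp only [Fin.val_last]; omega)
    -- integrate out the last state
    let F' : Cube d × (Fin (T + 1) → Cube d) → ℝ≥0∞ := fun q => ∫⁻ y,
      ENNReal.ofReal (M.mG (T + 1) (q.2 (Fin.last T), y)) *
        F (q.1, keepGT t (Fin.snoc (α := fun _ => Cube d) q.2 y))
    have hF' : Measurable F' :=
      Measurable.lintegral_prod_right' (f := fun p : (Cube d × (Fin (T + 1) → Cube d)) × Cube d =>
        ENNReal.ofReal (M.mG (T + 1) (p.1.2 (Fin.last T), p.2)) *
          F (p.1.1, keepGT t (Fin.snoc (α := fun _ => Cube d) p.1.2 p.2))) (by fun_prop)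
    have hR : Measurable fun x' : Fin (T + 2) → Cube d => ∫⁻ x,
        ENNReal.ofReal (M.Gtilde (t + 1) (M.filtering t) x (x' ⟨t + 1, by omega⟩)) *
          F (x, keepGT t x') ∂M.filtering t :=
      Measurable.lintegral_prod_left' (f := fun q : Cube d × (Fin (T + 2) → Cube d) =>
        ENNReal.ofReal (M.Gtilde (t + 1) (M.filtering t) q.1 (q.2 ⟨t + 1, by omega⟩)) *
          F (q.1, keepGT t q.2)) (by fun_prop)
    rw [M.lintegral_pathMeasure_succ T (F := fun x => F (x ⟨t, by omega⟩, keepGT t x))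
        (by fun_prop), M.lintegral_pathMeasure_succ T hR]
    simp only [c1, c2]
    have ih' := ih hF'
    simp only [F', c3, keepGT_snoc_keepGT] at ih'
    rw [ih']
    refine lintegral_congr fun x' => ?_
    have swap : ∀ y : Cube d, ENNReal.ofReal (M.mG (T + 1) (x' (Fin.last T), y)) *
        ∫⁻ x, ENNReal.ofReal (M.Gtilde (t + 1) (M.filtering t) x (x' ⟨t + 1, by omega⟩)) *
          F (x, keepGT t (Fin.snoc (α := fun _ => Cube d) x' y)) ∂M.filtering t =
        ∫⁻ x, ENNReal.ofReal (M.Gtilde (t + 1) (M.filtering t) x (x' ⟨t + 1, by omega⟩)) *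
          (ENNReal.ofReal (M.mG (T + 1) (x' (Fin.last T), y)) *
          F (x, keepGT t (Fin.snoc (α := fun _ => Cube d) x' y))) ∂M.filtering t := fun y => by
      rw [← lintegral_const_mul' _ _ ENNReal.ofReal_ne_top]
      refine lintegral_congr fun x => ?_
      ring
    simp only [swap]
    rw [lintegral_lintegral_swap (Measurable.aemeasurable (by fun_prop))]
    refine lintegral_congr fun x => ?_
    rw [← lintegral_const_mul' _ _ ENNReal.ofReal_ne_top]

/-- The backward decomposition as an identity of laws. -/
theorem smoothing_map_eq_withDensity (h : M.filtering t ≠ 0)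
    (hcont : Continuous (Function.uncurry (M.Gtilde (t + 1) (M.filtering t))))
    (h1 : ∀ y, ∫ x, M.Gtilde (t + 1) (M.filtering t) x y ∂M.filtering t = 1)
    {T : ℕ} (hT : M.filtering T ≠ 0) (htT : t + 1 ≤ T) :
    (M.smoothing T).map (fun x => (x ⟨t, by omega⟩, keepGT t x)) =
      ((M.filtering t).prod ((M.smoothing T).map (keepGT t))).withDensity fun q =>
        ENNReal.ofReal (M.Gtilde (t + 1) (M.filtering t) q.1 (q.2 ⟨t + 1, by omega⟩)) := by
  have := isProbabilityMeasure_filtering h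
  have := isProbabilityMeasure_smoothing hT
  have hk := measurable_keepGT (d := d) (n := T + 1) t
  have := Measure.isProbabilityMeasure_map (μ := M.smoothing T) hk.aemeasurable
  have hGt : Measurable fun q : Cube d × Cube d =>
    M.Gtilde (t + 1) (M.filtering t) q.1 q.2 := hcont.measurable
  refine Measure.ext_of_lintegral _ fun F hF => ?_
  have hin : Measurable fun y : Fin (T + 1) → Cube d => ∫⁻ x,
      ENNReal.ofReal (M.Gtilde (t + 1) (M.filtering t) x (y ⟨t + 1, by omega⟩)) *
        F (x, y) ∂M.filtering t :=
    Measurable.lintegral_prod_left' (f := fun q : Cube d × (Fin (T + 1) → Cube d) =>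
        ENNReal.ofReal (M.Gtilde (t + 1) (M.filtering t) q.1 (q.2 ⟨t + 1, by omega⟩)) *
          F q) (by fun_prop)
  rw [lintegral_map hF (by fun_prop), lintegral_withDensity_eq_lintegral_mul _ (by fun_prop) hF,
    lintegral_prod_symm _ (Measurable.aemeasurable (by fun_prop))]
  simp only [Pi.mul_apply]
  rw [lintegral_map hin hk, smoothing_eq, lintegral_smul_measure, lintegral_smul_measure,
    lintegral_pathMeasure_backward h hcont h1 htT hF]
  congr 1
  refine lintegral_congr fun x' => lintegral_congr fun x => ?_
  rw [show keepGT t x' ⟨t + 1, by omega⟩ = x' ⟨t + 1, by omega⟩ from if_pos (Nat.lt_succ_self t)]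

/-- The law of `x_t` under a later smoothing distribution is absolutely continuous with respect to
the filtering distribution. -/
theorem smoothing_map_absolutelyContinuous (h : M.filtering t ≠ 0) {T : ℕ} (htT : t ≤ T) :
    (M.smoothing T).map (fun x => x ⟨t, by omega⟩) ≪ M.filtering t := by
  refine Measure.AbsolutelyContinuous.mk fun A hA h0 => ?_
  have hev : ∀ (n : ℕ) (i : Fin n), Measurable fun x : Fin n → Cube d => x i := fun n i =>
    measurable_pi_apply i
  rw [Measure.map_apply (hev _ _) hA, smoothing_eq, Measure.smul_apply]
  suffices hp : M.pathMeasure T ((fun x => x ⟨t, by omega⟩) ⁻¹' A) = 0 by rw [hp, smul_zero]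
  induction T, htT using Nat.le_induction with
  | base =>
    have := lintegral_last_pathMeasure h (measurable_one.indicator hA)
    rw [lintegral_indicator_one hA, h0, mul_zero] at this
    have hm : MeasurableSet ((fun x : Fin (t + 1) → Cube d => x ⟨t, by omega⟩) ⁻¹' A) :=
      hev _ _ hA
    rw [← lintegral_indicator_one hm, ← this]
    rfl
  | succ T hT ih =>
    have hs := measurable_snoc (d := d) (T + 1)
    have hm : MeasurableSet ((fun x : Fin (T + 1) → Cube d => x ⟨t, by omega⟩) ⁻¹' A) :=
      hev _ _ hA
    have hm' : MeasurableSet ((fun x : Fin (T + 2) → Cube d => x ⟨t, by omega⟩) ⁻¹' A) :=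
      hev _ _ hA
    have hae : ∀ᵐ x ∂M.pathMeasure T, x ⟨t, by omega⟩ ∉ A := measure_eq_zero_iff_ae_notMem.1 ih
    rw [← lintegral_indicator_one hm', M.lintegral_pathMeasure_succ T (measurable_one.indicator hm')]
    refine (lintegral_congr_ae ?_).trans lintegral_zero
    filter_upwards [hae] with x hx
    have hx' : ∀ y, (Fin.snoc (α := fun _ => Cube d) x y : Fin (T + 2) → Cube d) ∉
        (fun x : Fin (T + 2) → Cube d => x ⟨t, by omega⟩) ⁻¹' A := fun y hy => by
      have e : (Fin.snoc (α := fun _ => Cube d) x y : Fin (T + 2) → Cube d) ⟨t, by omega⟩ =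
        x ⟨t, by omega⟩ := Fin.snoc_castSucc (α := fun _ => Cube d) y x ⟨t, by omega⟩
      exact hx (e ▸ hy)
    simp [Set.indicator_of_notMem (hx' _)]

end FeynmanKac

/-! ### Consistency of the forward pass -/

theorem IsHolder.continuous {E E' : Type} [PseudoEMetricSpace E] [PseudoEMetricSpace E']
    {f : E → E'} (hf : IsHolder f) : Continuous f := by
  obtain ⟨C, r, hr, -, h⟩ := hf
  exact h.continuous hr

/-- Self-normalised importance weights: if point sets converge weakly to `μ`, then, weighted
proportionally to `G` and mapped by `π`, they converge weakly to the law under `π` of the normalised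
measure `G • μ`. -/
theorem WConv.reweight {E E' : Type} [PseudoMetricSpace E] [MeasurableSpace E]
    [OpensMeasurableSpace E] [PseudoMetricSpace E'] [MeasurableSpace E']
    {x : ∀ N : ℕ, Fin N → E} {μ : Measure E} [IsProbabilityMeasure μ] (hx : WConv unif x μ)
    {G : E → ℝ} (hG : Continuous G) {c : ℝ} (hGc : ∀ y, |G y| ≤ c) {π : E → E'}
    (hπ : Continuous π) {ν : Measure E'} [IsProbabilityMeasure ν] {z : ℝ} (hz : z ≠ 0)
    (hν : ∀ f : E' → ℝ, Continuous f → ∫ y, G y * f (π y) ∂μ = z * ∫ y, f y ∂ν) :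
    WConv (fun N n => G (x N n) / ∑ k, G (x N k)) (fun N n => π (x N n)) ν := by
  rintro f ⟨K, hK⟩ ⟨b, hb⟩
  have h1 : Tendsto (fun N => ∑ n, unif N n * (G (x N n) * f (π (x N n)))) atTop
      (𝓝 (z * ∫ y, f y ∂ν)) := by
    rw [← hν f hK.continuous]
    refine hx.tendsto_sum_continuous unif_nonneg (f := fun y => G y * f (π y)) (C := c * b)
      (fun y => ?_) (hG.mul (hK.continuous.comp hπ))
    rw [abs_mul]
    exact mul_le_mul (hGc y) (hb _) (abs_nonneg _) ((abs_nonneg _).trans (hGc y))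
  have h2 : Tendsto (fun N => ∑ n, unif N n * G (x N n)) atTop (𝓝 z) := by
    have := hν (fun _ => 1) continuous_const
    simp only [mul_one, integral_const, probReal_univ, smul_eq_mul] at this
    rw [← this]
    exact hx.tendsto_sum_continuous unif_nonneg hGc hG
  have h3 := h1.div h2 hz
  rw [mul_div_cancel_left₀ _ hz] at h3
  refine h3.congr fun N => ?_
  rcases Nat.eq_zero_or_pos N with rfl | hN
  · simp
  have hN' : ((N : ℝ)⁻¹) ≠ 0 := inv_ne_zero (by exact_mod_cast hN.ne')
  simp only [Pi.div_apply, unif, ← Finset.mul_sum]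
  rw [mul_div_mul_left _ _ hN', Finset.sum_div]
  refine Finset.sum_congr rfl fun n _ => ?_
  ring

section Weights

variable {d : ℕ} {M : FeynmanKac d} {N : ℕ} {x xhat : ℕ → Fin N → Cube d}

theorem weight_nonneg (t : ℕ) (n : Fin N) : 0 ≤ weight M x xhat t n := by
  cases t with
  | zero => exact div_nonneg (M.G0_nonneg _) (Finset.sum_nonneg fun _ _ => M.G0_nonneg _)
  | succ t =>
    exact div_nonneg (M.G_nonneg _ (Nat.le_add_left _ _) _ _)
      (Finset.sum_nonneg fun _ _ => M.G_nonneg _ (Nat.le_add_left _ _) _ _)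

/-- The weights are normalised, unless they all vanish. -/
theorem weight_div_sum (t : ℕ) (n : Fin N) :
    weight M x xhat t n / ∑ k, weight M x xhat t k = weight M x xhat t n := by
  have key : ∀ (g : Fin N → ℝ), (g n / ∑ k, g k) / ∑ j, g j / ∑ k, g k = g n / ∑ k, g k := by
    intro g
    rw [← Finset.sum_div]
    rcases eq_or_ne (∑ k, g k) 0 with h | h
    · simp [h]
    · rw [div_self h, div_one]
  cases t with
  | zero => exact key fun k => M.G0 (x 0 k)
  | succ t => exact key fun k => M.G (t + 1) (xhat t k) (x (t + 1) k)

theorem tilted_weight_one {Z : Type} (t : ℕ) (p : Fin N → Cube d) (z : Z) (n : Fin N) :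
    tilted (weight M x xhat t) p (fun _ => 1) z n = weight M x xhat t n := by
  simp only [tilted, mul_one]
  exact weight_div_sum t n

end Weights

/-- The dyadic grids of the Hilbert order have arbitrarily small cells. -/
theorem exists_gridLabel_dist_le {d : ℕ} {H : ℝ → Fin d → ℝ} {h : Cube d → ℝ}
    (hH : IsHilbertCurve H) (hh : IsPseudoInverse H h) {ε : ℝ} (hε : 0 < ε) :
    ∃ m : ℕ, ∀ x y : Cube d, gridLabel (2 ^ (d * m)) (h x) = gridLabel (2 ^ (d * m)) (h y) →
      dist x y ≤ ε := by
  obtain ⟨m, hm⟩ := exists_pow_lt_of_lt_one hε (show (1 / 2 : ℝ) < 1 by norm_num)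
  refine ⟨m, fun x y hxy => (dist_le_of_gridLabel_eq hH hh m hxy).trans ?_⟩
  rw [one_div_pow] at hm
  exact hm.le

/-- The inputs of the resampling step and of the mutation step are independent. -/
theorem volume_map_zero_tail (k : ℕ) :
    (volume : Measure (Cube (k + 1))).map (fun v => (v 0, (Fin.tail v : Cube k))) =
      (volume : Measure UI).prod volume :=
  (measurePreserving_piFinSuccAbove (fun _ : Fin (k + 1) => (volume : Measure UI)) 0).map_eq

section Forward

variable {d : ℕ} {H : ℝ → Fin d → ℝ} {h : Cube d → ℝ} {M : FeynmanKac d} {κ0 : CondFamily d}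
  {κ : ℕ → Cube d → CondFamily d} {T : ℕ} {u0 : ∀ N : ℕ, Fin N → Cube d}
  {u : ∀ N : ℕ, ℕ → Fin N → Cube (d + 1)} (R : ∀ N, Forward M κ0 κ h T (u0 N) (u N))

theorem Forward.W_nonneg (N t : ℕ) (n : Fin N) : 0 ≤ (R N).W t n := weight_nonneg t n

/-- Initialisation of the forward pass. -/
theorem wconv_forward_zero (hκ0 : IsCondFamily M.m0 κ0)
    (hu0 : Tendsto (fun N => discrepancy (u0 N)) atTop (𝓝 0))
    (hG0_cont : Continuous M.G0) (hG0_bdd : ∃ C, ∀ x, M.G0 x ≤ C)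
    (hF0 : Continuous fun q : Unit × Cube d => rosenblatt κ0 q.2) (hQ : M.filtering 0 ≠ 0) :
    WConv (fun N => (R N).W 0) (fun N => (R N).x 0) (M.filtering 0) := by
  have := FeynmanKac.isProbabilityMeasure_filtering hQ
  obtain ⟨c, hc⟩ := hG0_bdd
  have h1 : WConv unif (fun N n => ((), u0 N n)) ((Measure.dirac ()).prod volume) := by
    rw [Measure.dirac_prod]
    exact (wconv_of_discrepancy hu0).map unif_nonneg (by fun_prop)
  have h2 := wconv_of_isInvRosenblatt (K := Kernel.const Unit M.m0) (κ := fun _ => κ0)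
    (fun _ => by simpa using hκ0) hF0 (fun N n => (R N).init n) h1
  have h3 := h2.map unif_nonneg continuous_snd
  rw [Measure.compProd_const] at h3
  have h4 : WConv unif (fun N => (R N).x 0) M.m0 := h3.congr_measure Measure.snd_prod
  refine h4.reweight hG0_cont (c := c) (fun y => ?_) continuous_id
    (z := (M.Z 0).toReal) ?_ (fun f _ => FeynmanKac.integral_filtering_zero hQ f)
  · rw [abs_of_nonneg (M.G0_nonneg y)]; exact hc y
  · exact (ENNReal.toReal_pos (FeynmanKac.Z_ne_zero hQ) (FeynmanKac.Z_ne_top hQ)).ne'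

/-- Resampling along the Hilbert curve: the selected ancestors and the inputs of the mutation step
converge jointly to a product measure. -/
theorem wconv_forward_resample (hH : IsHilbertCurve H) (hh : IsPseudoInverse H h) {t : ℕ}
    (ht : t < T) (hu : Tendsto (fun N => discrepancy (u N (t + 1))) atTop (𝓝 0))
    {Q : Measure (Cube d)} [IsProbabilityMeasure Q] (hQ : Q ≪ volume)
    (hW : WConv (fun N => (R N).W t) (fun N => (R N).x t) Q) :
    WConv unif (fun N n => ((R N).x t ((R N).σ t ((R N).a t n)),
      (Fin.tail (u N (t + 1) n) : Cube d))) (Q.prod volume) := by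
  have hfst : (Q.prod (volume : Measure (Cube d))).map Prod.fst = Q := Measure.fst_prod
  have hsnd : (Q.prod (volume : Measure (Cube d))).map Prod.snd = volume := Measure.snd_prod
  refine wconv_of_sampledAt (h := h) (u := fun N n => u N (t + 1) n 0) (fun x => (hh x).1.2) ?_
    fun ε hε => ?_
  · rw [hsnd, ← volume_map_zero_tail]
    exact (wconv_of_discrepancy hu).map unif_nonneg (by unfold Fin.tail; fun_prop)
  obtain ⟨m, hm⟩ := exists_gridLabel_dist_le hH hh hε
  refine ⟨2 ^ (d * m), by positivity, hm, fun k hk _ => ?_⟩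
  obtain ⟨C, aN, a, hC, hhC, hiff, hlim, ham, ha, haC⟩ :=
    exists_threshold (Z := Cube d) hH hh (fun N n => Forward.W_nonneg R N t n) hQ hW
      (g := fun _ => 1) continuous_const (c := 1) (fun _ => ⟨zero_le_one, le_rfl⟩)
      (fun _ => by simp) m hk
  refine ⟨C, aN, a, hC, by rwa [hfst], fun N n hn => ?_, hlim, ham, ha, ?_⟩
  · refine hiff N ((R N).σ t) ((R N).sorted t ht.le) _ _ _ hn ?_
    have := (R N).resample t ht n
    simpa only [Forward.W, tilted_weight_one] using this
  · rintro φ hφ ⟨b, hb⟩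
    have := integral_withDensity_mul_indicator (Q := Q) (ρ := (volume : Measure (Cube d)))
      (g := fun _ => 1) measurable_const (c := 1) (fun _ => ⟨zero_le_one, le_rfl⟩)
      (fun _ => by simp) hC hφ.measurable hb
    simp only [ENNReal.ofReal_one] at this
    rw [show (fun _ : Cube d × Cube d => (1 : ℝ≥0∞)) = 1 from rfl, withDensity_one] at this
    simpa only [haC] using this

/-- One step of the forward pass: resampling, mutation, reweighting. -/
theorem wconv_forward_succ (hH : IsHilbertCurve H) (hh : IsPseudoInverse H h) {t : ℕ}
    (ht : t < T) (hu : Tendsto (fun N => discrepancy (u N (t + 1))) atTop (𝓝 0))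
    (hκ : ∀ x, IsCondFamily (M.trans (t + 1) x) (κ (t + 1) x))
    (hG_cont : Continuous (Function.uncurry (M.G (t + 1))))
    (hG_bdd : ∃ C, ∀ x' x, M.G (t + 1) x' x ≤ C)
    (hF : Continuous fun q : Cube d × Cube d => rosenblatt (κ (t + 1) q.1) q.2)
    (hQ : M.filtering t ≠ 0) (hQ' : M.filtering (t + 1) ≠ 0) (hQac : M.filtering t ≪ volume)
    (hW : WConv (fun N => (R N).W t) (fun N => (R N).x t) (M.filtering t)) :
    WConv (fun N => (R N).W (t + 1)) (fun N => (R N).x (t + 1)) (M.filtering (t + 1)) := by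
  have ht1 : 1 ≤ t + 1 := Nat.le_add_left _ _
  have := FeynmanKac.isProbabilityMeasure_filtering hQ
  have := FeynmanKac.isProbabilityMeasure_filtering hQ'
  have := FeynmanKac.isMarkovKernel_transKernel (M := M) ht1
  obtain ⟨c, hc⟩ := hG_bdd
  have h1 := wconv_of_isInvRosenblatt (K := M.transKernel (t + 1)) (κ := κ (t + 1))
    (fun x => by rw [FeynmanKac.transKernel_apply ht1]; exact hκ x) hF
    (fun N n => (R N).mutate t ht n) (wconv_forward_resample R hH hh ht hu hQac hW)
  refine h1.reweight (G := Function.uncurry (M.G (t + 1))) hG_cont (c := c) (fun q => ?_)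
    continuous_snd (z := (M.Z (t + 1) / M.Z t).toReal) ?_
    (fun f hf => FeynmanKac.integral_filtering_succ hQ hQ' hf.measurable)
  · rw [Function.uncurry, abs_of_nonneg (M.G_nonneg _ ht1 _ _)]; exact hc _ _
  · refine (ENNReal.toReal_pos ?_ ?_).ne'
    · exact (ENNReal.div_pos (FeynmanKac.Z_ne_zero hQ') (FeynmanKac.Z_ne_top hQ)).ne'
    · exact ENNReal.div_ne_top (FeynmanKac.Z_ne_top hQ') (FeynmanKac.Z_ne_zero hQ)

end Forward

/-! ### Consistency of the backward pass -/

section Backward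

variable {d : ℕ} {H : ℝ → Fin d → ℝ} {h : Cube d → ℝ} {M : FeynmanKac d} {κ0 : CondFamily d}
  {κ : ℕ → Cube d → CondFamily d} {T : ℕ} {u0 : ∀ N : ℕ, Fin N → Cube d}
  {u : ∀ N : ℕ, ℕ → Fin N → Cube (d + 1)} (R : ∀ N, Forward M κ0 κ h T (u0 N) (u N))
  {v : ∀ N : ℕ, Fin N → Cube (T + 1)} (B : ∀ N, Backward (R N) (v N))

/-- The times in the order in which the backward pass visits them. -/
def backRank (T : ℕ) (j : Fin (T + 1)) : ℕ := T - j

theorem backRank_injective (T : ℕ) : Function.Injective (backRank T) := fun i j hij => by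
  unfold backRank at hij
  exact Fin.ext (by omega)

theorem maskLT_backRank (T : ℕ) (i : Fin (T + 1)) (x : Fin (T + 1) → Cube d) :
    maskLT (backRank T) 0 (backRank T i) x = FeynmanKac.keepGT i x := by
  funext j
  unfold maskLT backRank FeynmanKac.keepGT
  refine if_congr ?_ rfl rfl
  omega

/-- Replacing `m G` by its normalised version `G̃` does not change the backward weights. -/
theorem backwardWeight_eq_tilted {N : ℕ} {t : ℕ}
    (h1 : ∀ y, ∫ x, M.Gtilde (t + 1) (M.filtering t) x y ∂M.filtering t = 1) {Z : Type}
    (y : Z → Cube d) (z : Z) (n : Fin N) :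
    tilted ((R N).W t) ((R N).x t)
      (fun q : Cube d × Z => M.Gtilde (t + 1) (M.filtering t) q.1 (y q.2)) z n =
        (R N).backwardWeight t (y z) n := by
  have hD := FeynmanKac.integral_mG_ne_zero h1 (y z)
  have e : ∀ k, (R N).W t k * M.Gtilde (t + 1) (M.filtering t) ((R N).x t k) (y z) =
      (R N).W t k * M.m (t + 1) ((R N).x t k) (y z) * M.G (t + 1) ((R N).x t k) (y z) /
        ∫ x, M.mG (t + 1) (x, y z) ∂M.filtering t := fun k => by
    simp only [FeynmanKac.Gtilde, FeynmanKac.mG]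
    ring
  simp only [tilted, e]
  rw [← Finset.sum_div, div_div_div_cancel_right₀ hD]
  rfl

/-- The last states of the trajectories are sampled from the final weighted particles, as in a
resampling step. -/
theorem seqSampledAt_backward_last (hH : IsHilbertCurve H) (hh : IsPseudoInverse H h)
    (hQ : M.filtering T ≠ 0) (hQac : M.filtering T ≪ volume)
    (hW : WConv (fun N => (R N).W T) (fun N => (R N).x T) (M.filtering T)) (m : ℕ) {k : ℕ}
    (hk : 0 < k) :
    SeqSampledAt (backRank T) 0 h ((k : ℝ) / (2 ^ (d * m) : ℕ)) v (fun _ _ => ())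
      (fun N n => (B N).path n) ((M.smoothing T).map fun x => ((), x)) (Fin.last T) := by
  have := FeynmanKac.isProbabilityMeasure_filtering hQ
  have := FeynmanKac.isProbabilityMeasure_smoothing hQ
  have hpair : Measurable fun x : Fin (T + 1) → Cube d => ((), x) := measurable_prodMk_left
  have hev : Measurable fun x : Fin (T + 1) → Cube d => x (Fin.last T) := measurable_pi_apply _
  obtain ⟨C, aN, a, hC, hhC, hiff, hlim, ham, ha, haC⟩ :=
    exists_threshold (Z := Unit × (Fin (T + 1) → Cube d)) hH hh
      (fun N n => Forward.W_nonneg R N T n) hQac hW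
      (g := fun _ => 1) continuous_const (c := 1) (fun _ => ⟨zero_le_one, le_rfl⟩)
      (fun _ => by simp) m hk
  refine ⟨C, aN, a, hC, ?_, fun N n hn => ?_, hlim, ham, ha, ?_⟩
  · rw [Measure.map_map (by fun_prop) hpair]
    exact hhC
  · beta_reduce
    rw [(B N).path_eq n (Fin.last T)]
    refine hiff N ((R N).σ T) ((R N).sorted T le_rfl) _ _ _ hn ?_
    have := (B N).last n
    simpa only [Forward.W, tilted_weight_one] using this
  · rintro φ hφ -
    -- no coordinate precedes the last one
    have hmask : ∀ x : Fin (T + 1) → Cube d,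
        maskLT (backRank T) 0 (backRank T (Fin.last T)) x = 0 := fun x => by
      funext j
      simp [maskLT, backRank]
    have hCm : Measurable (C.indicator (1 : Cube d → ℝ)) := measurable_one.indicator hC
    have : IsProbabilityMeasure ((M.smoothing T).map fun x => ((), x)) :=
      Measure.isProbabilityMeasure_map hpair.aemeasurable
    -- the test function is constant, the parameter space being a point
    have hpunit : ∀ p : Unit × (Fin (T + 1) → Cube d), φ (p.1, 0) = φ ((), 0) := fun _ => rfl
    simp only [hmask, haC, mul_one, hpunit]
    rw [integral_const_mul, integral_const, probReal_univ, one_smul]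
    congr 1
    rw [integral_map hpair.aemeasurable (Measurable.aestronglyMeasurable (by fun_prop)),
      FeynmanKac.filtering,
      integral_map hev.aemeasurable (Measurable.aestronglyMeasurable (by fun_prop))]

/-- Given the later states of a trajectory, the state at time `t` is sampled from the weighted particles
tilted by `G̃(·, x_{t+1})`. In the limit this is the backward kernel, which is the conditional
distribution under the smoothing distribution. -/
theorem seqSampledAt_backward_step (hH : IsHilbertCurve H) (hh : IsPseudoInverse H h) (t : Fin T)
    (hQ : M.filtering t ≠ 0) (hQT : M.filtering T ≠ 0) (hQac : M.filtering t ≪ volume)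
    (hcont : Continuous (Function.uncurry (M.Gtilde (t + 1) (M.filtering t))))
    (hbdd : ∃ C, ∀ x' x, M.Gtilde (t + 1) (M.filtering t) x' x ≤ C)
    (h1 : ∀ y, ∫ x, M.Gtilde (t + 1) (M.filtering t) x y ∂M.filtering t = 1)
    (hW : WConv (fun N => (R N).W t) (fun N => (R N).x t) (M.filtering t)) (m : ℕ) {k : ℕ}
    (hk : 0 < k) :
    SeqSampledAt (backRank T) 0 h ((k : ℝ) / (2 ^ (d * m) : ℕ)) v (fun _ _ => ())
      (fun N n => (B N).path n) ((M.smoothing T).map fun x => ((), x)) t.castSucc := by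
  have ht1 : 1 ≤ (t : ℕ) + 1 := Nat.le_add_left _ _
  have := FeynmanKac.isProbabilityMeasure_filtering hQ
  have := FeynmanKac.isProbabilityMeasure_smoothing hQT
  have hpair : Measurable fun x : Fin (T + 1) → Cube d => ((), x) := measurable_prodMk_left
  have hev : Measurable fun x : Fin (T + 1) → Cube d => x t.castSucc := measurable_pi_apply _
  have hk' := FeynmanKac.measurable_keepGT (d := d) (n := T + 1) t
  have := Measure.isProbabilityMeasure_map (μ := M.smoothing T) hk'.aemeasurable
  obtain ⟨c, hc⟩ := hbdd
  have hgc : ∀ x y, 0 ≤ M.Gtilde (t + 1) (M.filtering t) x y ∧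
      M.Gtilde (t + 1) (M.filtering t) x y ≤ c := fun x y =>
    ⟨div_nonneg (M.mG_nonneg ht1 (x, y)) (integral_nonneg fun x => M.mG_nonneg ht1 (x, y)), hc x y⟩
  obtain ⟨C, aN, a, hC, hhC, hiff, hlim, ham, ha, haC⟩ :=
    exists_threshold (Z := Unit × (Fin (T + 1) → Cube d)) hH hh
      (fun N n => Forward.W_nonneg R N t n) hQac hW
      (g := fun q => M.Gtilde (t + 1) (M.filtering t) q.1 (q.2.2 t.succ))
      (hcont.comp (f := fun q : Cube d × (Unit × (Fin (T + 1) → Cube d)) => (q.1, q.2.2 t.succ))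
        (by fun_prop)) (c := c) (fun q => hgc _ _) (fun z => h1 (z.2 t.succ)) m hk
  refine ⟨C, aN, a, hC, ?_, fun N n hn => ?_, hlim, ham, ha, ?_⟩
  · rw [Measure.map_map (by fun_prop) hpair]
    exact (FeynmanKac.smoothing_map_absolutelyContinuous hQ t.isLt.le).ae_le hhC
  · beta_reduce
    rw [(B N).path_eq n t.castSucc]
    refine hiff N ((R N).σ t) ((R N).sorted t t.isLt.le) _ _ _ hn ?_
    have hs := (B N).step t n
    have hy : maskLT (backRank T) 0 (backRank T t.castSucc) ((B N).path n) t.succ =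
        (B N).path n t.succ := by
      rw [maskLT_backRank]
      exact if_pos (by simp)
    simp only [backwardWeight_eq_tilted R h1
      (fun z : Unit × (Fin (T + 1) → Cube d) => z.2 t.succ), hy]
    exact hs
  · rintro φ hφ ⟨b, hb⟩
    have hφm := hφ.measurable
    have hCm : Measurable (C.indicator (1 : Cube d → ℝ)) := measurable_one.indicator hC
    simp only [maskLT_backRank]
    have hlaw := FeynmanKac.smoothing_map_eq_withDensity hQ hcont h1 hQT t.isLt
    have hcast : (t.castSucc : ℕ) = t := rfl
    have key := integral_withDensity_mul_indicator (Q := M.filtering t)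
      (ρ := (M.smoothing T).map (FeynmanKac.keepGT t))
      (g := fun q => M.Gtilde (t + 1) (M.filtering t) q.1 (q.2 t.succ))
      (hcont.measurable.comp (measurable_fst.prodMk
        ((measurable_pi_apply t.succ).comp measurable_snd))) (c := c) (fun q => hgc _ _)
      (fun z => h1 (z t.succ)) hC (φ := fun z => φ ((), z)) (hφm.comp measurable_prodMk_left)
      (fun z => hb _)
    have hlaw' : (M.smoothing T).map (fun x => (x t.castSucc, FeynmanKac.keepGT t x)) =
      ((M.filtering t).prod ((M.smoothing T).map (FeynmanKac.keepGT t))).withDensity fun q =>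
        ENNReal.ofReal (M.Gtilde (t + 1) (M.filtering t) q.1 (q.2 t.succ)) := hlaw
    have ham' : Measurable fun z : Fin (T + 1) → Cube d =>
        ∫ y, C.indicator 1 y * M.Gtilde (t + 1) (M.filtering t) y (z t.succ) ∂M.filtering t := by
      have := ham.comp (measurable_prodMk_left (x := ()) (β := Fin (T + 1) → Cube d))
      simpa only [Function.comp_def, haC] using this
    have hr : Measurable fun q : Cube d × (Fin (T + 1) → Cube d) => φ ((), q.2) *
        ∫ y, C.indicator 1 y * M.Gtilde (t + 1) (M.filtering t) y (q.2 t.succ) ∂M.filtering t :=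
      (hφm.comp (measurable_prodMk_left.comp measurable_snd)).mul (ham'.comp measurable_snd)
    rw [← hlaw', integral_map (by fun_prop) (Measurable.aestronglyMeasurable (by fun_prop)),
      integral_map (by fun_prop) hr.aestronglyMeasurable] at key
    rw [integral_map hpair.aemeasurable (Measurable.aestronglyMeasurable (by fun_prop)),
      integral_map hpair.aemeasurable (Measurable.aestronglyMeasurable (by fun_prop))]
    simp only [haC]
    exact key

end Backward

/-! ### Convergence of the backward trajectories -/

section Trajectories

variable {d : ℕ} {H : ℝ → Fin d → ℝ} {h : Cube d → ℝ} {M : FeynmanKac d} {κ0 : CondFamily d}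
  {κ : ℕ → Cube d → CondFamily d} {T : ℕ} {u0 : ∀ N : ℕ, Fin N → Cube d}
  {u : ∀ N : ℕ, ℕ → Fin N → Cube (d + 1)} (R : ∀ N, Forward M κ0 κ h T (u0 N) (u N))
  {v : ∀ N : ℕ, Fin N → Cube (T + 1)} (B : ∀ N, Backward (R N) (v N))

/-- The trajectories of the backward pass converge weakly to the smoothing distribution. -/
theorem wconv_backward (hH : IsHilbertCurve H) (hh : IsPseudoInverse H h)
    (hv : Tendsto (fun N => discrepancy (v N)) atTop (𝓝 0))
    (hQ : ∀ t, t ≤ T → M.filtering t ≠ 0) (hQac : ∀ t, t ≤ T → M.filtering t ≪ volume)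
    (hW : ∀ t, t ≤ T → WConv (fun N => (R N).W t) (fun N => (R N).x t) (M.filtering t))
    (hGt : ∀ t, t < T → Continuous (Function.uncurry (M.Gtilde (t + 1) (M.filtering t))))
    (hGt_bdd : ∀ t, t < T → ∃ C, ∀ x' x, M.Gtilde (t + 1) (M.filtering t) x' x ≤ C)
    (h1 : ∀ t, t < T → ∀ y, ∫ x, M.Gtilde (t + 1) (M.filtering t) x y ∂M.filtering t = 1) :
    WConv unif (fun N n => (B N).path n) (M.smoothing T) := by
  have := FeynmanKac.isProbabilityMeasure_smoothing (hQ T le_rfl)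
  have hpair : Measurable fun x : Fin (T + 1) → Cube d => ((), x) := measurable_prodMk_left
  have := Measure.isProbabilityMeasure_map (μ := M.smoothing T) hpair.aemeasurable
  have hfst : ((M.smoothing T).map fun x => ((), x)).map Prod.fst = Measure.dirac () := by
    rw [Measure.map_map measurable_fst hpair]
    change (M.smoothing T).map (fun _ => ()) = _
    rw [Measure.map_const, measure_univ, one_smul]
  have hsnd : ((M.smoothing T).map fun x => ((), x)).map Prod.snd = M.smoothing T := by
    rw [Measure.map_map measurable_snd hpair]
    exact Measure.map_id
  refine WConv.congr_measure ((wconv_of_seqSampledAt (r := backRank T) (o := 0) (h := h) (v := v)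
    (y := fun _ _ => ()) (backRank_injective T) (fun x => (hh x).1.2) ?_ fun ε hε => ?_).map
      unif_nonneg continuous_snd) hsnd
  · rw [hfst, Measure.dirac_prod]
    exact (wconv_of_discrepancy hv).map unif_nonneg (by fun_prop)
  · obtain ⟨m, hm⟩ := exists_gridLabel_dist_le hH hh hε
    refine ⟨2 ^ (d * m), by positivity, hm, fun k hk _ i => ?_⟩
    refine Fin.lastCases ?_ (fun t => ?_) i
    · exact seqSampledAt_backward_last R B hH hh (hQ T le_rfl) (hQac T le_rfl) (hW T le_rfl) m hk
    · have ht := t.isLt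
      exact seqSampledAt_backward_step R B hH hh t (hQ t ht.le) (hQ T le_rfl) (hQac t ht.le)
        (hGt t ht) (hGt_bdd t ht) (h1 t ht) (hW t ht.le) m hk

end Trajectories

theorem continuous_flatten {T d : ℕ} : Continuous (flatten : (Fin (T + 1) → Cube d) → _) := by
  unfold flatten; fun_prop

/-- The smoothing distribution does not charge hyperplanes orthogonal to the axes. -/
theorem smoothing_map_flatten_hyperplane {d T : ℕ} {M : FeynmanKac d}
    (hQ : ∀ t, t ≤ T → M.filtering t ≠ 0) (hQac : ∀ t, t ≤ T → M.filtering t ≪ volume)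
    (p : Fin (T + 1) × Fin d) (c : UI) :
    (M.smoothing T).map flatten {x | x p = c} = 0 := by
  obtain ⟨t, i⟩ := p
  have ht : (t : ℕ) ≤ T := Nat.lt_succ_iff.1 t.isLt
  have hev : Measurable fun x : Fin (T + 1) → Cube d => x t := measurable_pi_apply t
  have hc : MeasurableSet {y : Cube d | y i = c} :=
    measurableSet_eq_fun (measurable_pi_apply i) measurable_const
  have h0 : (volume : Measure (Cube d)) {y | y i = c} = 0 :=
    Measure.pi_hyperplane (fun _ : Fin d => (volume : Measure UI)) i c
  have h1 := (FeynmanKac.smoothing_map_absolutelyContinuous (hQ t ht) ht) (hQac t ht h0)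
  rw [Measure.map_apply hev hc] at h1
  rwa [Measure.map_apply continuous_flatten.measurable
    (measurableSet_eq_fun (measurable_pi_apply (t, i)) measurable_const)]

end SQMC

theorem mainTheorem9 {d : ℕ} (hd : 1 ≤ d) (T : ℕ)
    -- the Hilbert curve and its pseudo-inverse
    (H : ℝ → Fin d → ℝ) (hH : SQMC.IsHilbertCurve H)
    (h : SQMC.Cube d → ℝ) (hh : SQMC.IsPseudoInverse H h)
    -- the model, and the conditional distributions that define the Rosenblatt transforms
    (M : SQMC.FeynmanKac d)
    (κ0 : SQMC.CondFamily d) (hκ0 : SQMC.IsCondFamily M.m0 κ0)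
    (κ : ℕ → SQMC.Cube d → SQMC.CondFamily d)
    (hκ : ∀ t, 1 ≤ t → t ≤ T → ∀ x, SQMC.IsCondFamily (M.trans t x) (κ t x))
    -- the forward pass
    (u0 : ∀ N : ℕ, Fin N → SQMC.Cube d)
    (u : ∀ N : ℕ, ℕ → Fin N → SQMC.Cube (d + 1))
    (hu_sorted : ∀ N t, 1 ≤ t → t ≤ T → Monotone fun n => u N t n 0)
    (R : ∀ N, SQMC.Forward M κ0 κ h T (u0 N) (u N))
    -- the backward pass
    (v : ∀ N : ℕ, Fin N → SQMC.Cube (T + 1))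
    (hv_sorted : ∀ N, Monotone fun n => v N n (Fin.last T))
    (B : ∀ N, SQMC.Backward (R N) (v N))
    -- the discrepancies of the inputs vanish
    (hu0 : Tendsto (fun N => SQMC.discrepancy (u0 N)) atTop (𝓝 0))
    (hu : ∀ t, 1 ≤ t → t ≤ T → Tendsto (fun N => SQMC.discrepancy (u N t)) atTop (𝓝 0))
    (hv : Tendsto (fun N => SQMC.discrepancy (v N)) atTop (𝓝 0))
    -- assumptions of the forward consistency theorem
    (hdistinct : ∀ N t, t ≤ T → Function.Injective ((R N).x t))
    (hG0_cont : Continuous M.G0) (hG0_bdd : ∃ C, ∀ x, M.G0 x ≤ C)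
    (hG_cont : ∀ t, 1 ≤ t → t ≤ T → Continuous (Function.uncurry (M.G t)))
    (hG_bdd : ∀ t, 1 ≤ t → t ≤ T → ∃ C, ∀ x' x, M.G t x' x ≤ C)
    (hF0_mono : SQMC.RosenblattStrictMono fun _ : Unit => κ0)
    (hF0_holder : SQMC.RosenblattHolder fun _ : Unit => κ0)
    (hF0_dens : SQMC.CondDensityBounded fun _ : Unit => κ0)
    (hF_mono : ∀ t, 1 ≤ t → t ≤ T → SQMC.RosenblattStrictMono (κ t))
    (hF_holder : ∀ t, 1 ≤ t → t ≤ T → SQMC.RosenblattHolder (κ t))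
    (hF_dens : ∀ t, 1 ≤ t → t ≤ T → SQMC.CondDensityBounded (κ t))
    (hQ_dens : ∀ t, t ≤ T → ∃ (p : SQMC.Cube d → ℝ) (C : ℝ), Measurable p ∧
      (∀ x, 0 < p x ∧ p x ≤ C) ∧
      M.filtering t = volume.withDensity fun x => ENNReal.ofReal (p x))
    -- assumptions (H1) and (H2) on the backward kernels
    (hH1 : ∀ t, 1 ≤ t → t ≤ T →
      Continuous (Function.uncurry (M.Gtilde t (M.filtering (t - 1)))) ∧
      ∃ C, ∀ x' x, M.Gtilde t (M.filtering (t - 1)) x' x ≤ C)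
    (hH2 : ∀ t, 1 ≤ t → t ≤ T → ∃ κB : SQMC.Cube d → SQMC.CondFamily d,
      (∀ x, SQMC.IsCondFamily (M.backward t (M.filtering (t - 1)) x) (κB x)) ∧
      SQMC.RosenblattStrictMono κB ∧ SQMC.RosenblattHolder κB)
    -- the CDF of the backward kernel is Hölder continuous
    (hcdf : ∀ t, 1 ≤ t → t < T → SQMC.IsHolder fun q : SQMC.Cube d × SQMC.Cube d =>
      (M.backward t (M.filtering (t - 1)) q.1).real (Set.Iic q.2))
    -- the lower bound
    (hlower : ∀ t, t < T → ∃ c : ℝ, 0 < c ∧ ∀ x' x y,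
      c ≤ M.Gext t x' x * M.G (t + 1) x y * M.m (t + 1) x y)
    -- uniform continuity
    (hunif : ∀ t, 1 ≤ t → t < T → UniformContinuous fun q : SQMC.Cube d × SQMC.Cube d =>
      M.G t q.1 q.2 * M.m t q.1 q.2) :
    Tendsto
      (fun N => SQMC.extremeNorm
        (SQMC.empirical fun n => SQMC.flatten ((B N).path n))
        ((M.smoothing T).map SQMC.flatten))
      atTop (𝓝 0) := by
  have hQ : ∀ t, t ≤ T → M.filtering t ≠ 0 := fun t ht h0 => by
    obtain ⟨p, C, hp, hpos, hpQ⟩ := hQ_dens t ht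
    rw [hpQ, withDensity_eq_zero_iff hp.ennreal_ofReal.aemeasurable] at h0
    obtain ⟨x, hx⟩ := h0.exists
    exact (ENNReal.ofReal_pos.2 (hpos x).1).ne' hx
  have hQac : ∀ t, t ≤ T → M.filtering t ≪ volume := fun t ht => by
    obtain ⟨p, C, -, -, hpQ⟩ := hQ_dens t ht
    rw [hpQ]
    exact withDensity_absolutelyContinuous _ _
  have hGt : ∀ t, t < T →
      Continuous (Function.uncurry (M.Gtilde (t + 1) (M.filtering t))) := fun t ht =>
    (hH1 (t + 1) (Nat.le_add_left _ _) ht).1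
  have hGt_bdd : ∀ t, t < T → ∃ C, ∀ x' x, M.Gtilde (t + 1) (M.filtering t) x' x ≤ C :=
    fun t ht => (hH1 (t + 1) (Nat.le_add_left _ _) ht).2
  have hGext : ∀ t, t ≤ T → ∃ C, ∀ x' x, M.Gext t x' x ≤ C := fun t ht => by
    cases t with
    | zero => exact hG0_bdd.imp fun C hC _ x => hC x
    | succ t => exact hG_bdd (t + 1) (Nat.le_add_left _ _) ht
  -- the lower bound also bounds `m G` from below, since the previous potential is bounded above
  have hmG : ∀ t, t < T → ∃ c, 0 < c ∧ ∀ q, c ≤ M.mG (t + 1) q := fun t ht => by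
    obtain ⟨c, hc, hle⟩ := hlower t ht
    obtain ⟨C, hC⟩ := hGext t ht.le
    -- `max C 1` rather than `C`, to divide by a positive number
    have hC' : 0 < max C 1 := lt_max_of_lt_right one_pos
    refine ⟨c / max C 1, div_pos hc hC', fun q => ?_⟩
    rw [div_le_iff₀' hC']
    refine (hle q.1 q.1 q.2).trans ?_
    have hq := M.mG_nonneg (t := t + 1) (Nat.le_add_left _ _) q
    have e : M.Gext t q.1 q.1 * M.G (t + 1) q.1 q.2 * M.m (t + 1) q.1 q.2 =
        M.Gext t q.1 q.1 * M.mG (t + 1) q := by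
      simp only [SQMC.FeynmanKac.mG]
      ring
    rw [e]
    exact mul_le_mul_of_nonneg_right ((hC _ _).trans (le_max_left _ _)) hq
  have h1 : ∀ t, t < T →
      ∀ y, ∫ x, M.Gtilde (t + 1) (M.filtering t) x y ∂M.filtering t = 1 := fun t ht => by
    obtain ⟨c, hc, hle⟩ := hmG t ht
    exact SQMC.FeynmanKac.integral_Gtilde (hQ t ht.le) hc hle
      (hG_bdd (t + 1) (Nat.le_add_left _ _) ht) (hGt t ht) (hGt_bdd t ht)
  have hW : ∀ t, t ≤ T →
      SQMC.WConv (fun N => (R N).W t) (fun N => (R N).x t) (M.filtering t) := by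
    intro t
    induction t with
    | zero =>
      exact fun _ => SQMC.wconv_forward_zero R hκ0 hu0 hG0_cont hG0_bdd
        (SQMC.IsHolder.continuous hF0_holder) (hQ 0 T.zero_le)
    | succ t ih =>
      intro ht
      have ht1 : 1 ≤ t + 1 := Nat.le_add_left _ _
      have ht' : t ≤ T := (Nat.le_succ t).trans ht
      exact SQMC.wconv_forward_succ R hH hh ht (hu (t + 1) ht1 ht) (hκ (t + 1) ht1 ht)
        (hG_cont (t + 1) ht1 ht) (hG_bdd (t + 1) ht1 ht)
        (SQMC.IsHolder.continuous (hF_holder (t + 1) ht1 ht)) (hQ t ht') (hQ (t + 1) ht)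
        (hQac t ht') (ih ht')
  have := SQMC.FeynmanKac.isProbabilityMeasure_smoothing (hQ T le_rfl)
  have := Measure.isProbabilityMeasure_map (μ := M.smoothing T)
    (SQMC.continuous_flatten (T := T) (d := d)).measurable.aemeasurable
  exact SQMC.tendsto_extremeNorm_of_wconv (SQMC.smoothing_map_flatten_hyperplane hQ hQac)
    ((SQMC.wconv_backward R B hH hh hv hQ hQac hW hGt hGt_bdd h1).map SQMC.unif_nonneg
      SQMC.continuous_flatten)
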